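/- Let $d\ge 1$ and $n>d$ be integers. There is a constant $C_{d,n}\ge 0$, depending only on $d$ and $n$, such that for every $\hbar>0$, every $p\in[1,\infty]$ and all bounded operators $A,B$ on $L^2(\mathbb R^d)$ for which the three norms on the right-hand side are finite, $$\|[A,B]\|_{\mathcal L^p}\;\le\; C_{d,n}\,\hbar\,\|\nabla_\hbar^{\,n+1}A\|_{\mathcal L^2}^{d/n}\,\|\nabla_\hbar A\|_{\mathcal L^2}^{1-d/n}\,\|\nabla_\hbar B\|_{\mathcal L^p}.$$ Here $[A,B]=AB-BA$ and $h=2\pi\hbar$. The quantum gradient $\nabla_\hbar T$ is the family of the $2d$ operators $\frac{1}{i\hbar}[x_j,T]$ and $[\partial_{x_j},T]$, $1\le j\le d$, and $\nabla_\hbar^kT$ is the family of the $(2d)^k$ operators obtained by iterating $k$ times. The commutators are taken in the sense of sesquilinear forms on Schwartz functions. For a finite family $T=(T_i)_i$ of bounded operators, $|T|=\big(\sum_i T_i^*T_i\big)^{1/2}$, and the scaled Schatten norm is $\|T\|_{\mathcal L^p}=h^{d/p}\,\big(\mathrm{Tr}\,|T|^p\big)^{1/p}$ for $p<\infty$, and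 $\|T\|_{\mathcal L^\infty}$ is the operator norm of $|T|$. The norm $\|\nabla_\hbar^kT\|_{\mathcal L^p}$ is $+\infty$ if one of the components of $\nabla_\hbar^kT$ is not given by a bounded operator. -/

import Mathlib

open MeasureTheory
open scoped ENNReal NNReal SchwartzMap LineDeriv InnerProductSpace

noncomputable section

namespace QuantumGradient

section Schatten

variable {H : Type*} [NormedAddCommGroup H] [InnerProductSpace ℂ H] [CompleteSpace H]

/-- The sum `∑ᵢ ⟨eᵢ, T eᵢ⟩ ∈ [0, ∞]` of the diagonal matrix elements of `T` in the orthonormal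
basis `e`. -/
def diagSum {ι : Type*} (e : HilbertBasis ι ℂ H) (T : H →L[ℂ] H) : ℝ≥0∞ :=
  ∑' i, ENNReal.ofReal (⟪e i, T (e i)⟫_ℂ).re

/-- An orthonormal basis of `H`. -/
def someBasis (H : Type*) [NormedAddCommGroup H] [InnerProductSpace ℂ H] [CompleteSpace H] :
    HilbertBasis (exists_hilbertBasis ℂ H).choose ℂ H :=
  (exists_hilbertBasis ℂ H).choose_spec.choose

/-- The trace, in `[0, ∞]`, of a positive bounded operator. By `trace_eq_diagSum`, it does not
depend on the orthonormal basis. -/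
def trace (T : H →L[ℂ] H) : ℝ≥0∞ := diagSum (someBasis H) T

theorem tsum_enorm_inner_sq {ι : Type*} (e : HilbertBasis ι ℂ H) (x : H) :
    ∑' i, ‖⟪e i, x⟫_ℂ‖ₑ ^ 2 = ‖x‖ₑ ^ 2 := by
  have h := (e.hasSum_inner_mul_inner x x).mapL Complex.reCLM
  have h2 : HasSum (fun i => ‖⟪e i, x⟫_ℂ‖ ^ 2) (‖x‖ ^ 2) := by
    convert h using 1
    · funext i
      rw [← inner_conj_symm x (e i)]
      simp only [Complex.reCLM_apply, Complex.mul_re, Complex.conj_re, Complex.conj_im,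
        ← Complex.normSq_eq_norm_sq, Complex.normSq_apply]
      ring
    · simp [inner_self_eq_norm_sq_to_K, ← Complex.ofReal_pow]
  have h3 := h2.tsum_eq
  have h4 := ENNReal.ofReal_tsum_of_nonneg (fun i => sq_nonneg ‖⟪e i, x⟫_ℂ‖) h2.summable
  rw [h3] at h4
  simpa [ENNReal.ofReal_pow, ofReal_norm] using h4.symm

theorem diagSum_star_mul_self {ι κ : Type*} (e : HilbertBasis ι ℂ H) (f : HilbertBasis κ ℂ H)
    (R : H →L[ℂ] H) : diagSum e (star R * R) = ∑' k, ‖star R (f k)‖ₑ ^ 2 := by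
  have h1 : diagSum e (star R * R) = ∑' i, ‖R (e i)‖ₑ ^ 2 := by
    refine tsum_congr fun i => ?_
    rw [mul_apply_eq_comp, ContinuousLinearMap.star_eq_adjoint,
      ContinuousLinearMap.adjoint_inner_right, inner_self_eq_norm_sq_to_K]
    simp [← Complex.ofReal_pow, ENNReal.ofReal_pow]
  rw [h1]
  simp_rw [← tsum_enorm_inner_sq f (R _), ← tsum_enorm_inner_sq e (star R _)]
  rw [ENNReal.tsum_comm]
  refine tsum_congr fun k => tsum_congr fun i => ?_
  rw [ContinuousLinearMap.star_eq_adjoint, ContinuousLinearMap.adjoint_inner_right,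
    ← inner_conj_symm, RCLike.enorm_conj]

/-- Independence of the trace of a positive operator from the orthonormal basis. -/
theorem trace_eq_diagSum {ι : Type*} (e : HilbertBasis ι ℂ H) (T : H →L[ℂ] H) (hT : 0 ≤ T) :
    trace T = diagSum e T := by
  obtain ⟨R, rfl⟩ := CStarAlgebra.nonneg_iff_eq_star_mul_self.1 hT
  rw [trace, diagSum_star_mul_self (someBasis H) e, diagSum_star_mul_self e e]

/-- The absolute value `|T| = (∑ᵢ |Tᵢ|²)^{1/2}`, with `|Tᵢ|² = Tᵢ* Tᵢ`, of a finite family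
`T = (Tᵢ)ᵢ` of bounded operators. -/
def famAbs {ι : Type*} [Fintype ι] (T : ι → H →L[ℂ] H) : H →L[ℂ] H :=
  CFC.sqrt (∑ i, star (T i) * T i)

/-- The Schatten norm `(Tr |T|^p)^{1/p}`, with values in `[0, ∞]`, of a finite family
`T = (Tᵢ)ᵢ` of bounded operators, and the operator norm of `|T|` for `p = ∞`. -/
def schattenNorm {ι : Type*} [Fintype ι] (p : ℝ≥0∞) (T : ι → H →L[ℂ] H) : ℝ≥0∞ :=
  if p = ∞ then ‖famAbs T‖ₑ else trace (CFC.rpow (famAbs T) p.toReal) ^ (1 / p.toReal)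

end Schatten

/-- The space `ℝᵈ`. -/
abbrev Space (d : ℕ) : Type := EuclideanSpace ℝ (Fin d)

/-- The Hilbert space `L²(ℝᵈ)` of complex-valued functions. -/
abbrev L2 (d : ℕ) : Type := Lp ℂ 2 (volume : Measure (Space d))

/-- The scaled Schatten norm `h^{d/p} ‖T‖_p` on operators on `L²(ℝᵈ)`, where `h = 2πħ` (for
`p = ∞` it is the operator norm). -/
def scaledNorm {d : ℕ} {ι : Type*} [Fintype ι] (ħ : ℝ) (p : ℝ≥0∞) (T : ι → L2 d →L[ℂ] L2 d) :
    ℝ≥0∞ :=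
  (if p = ∞ then 1 else ENNReal.ofReal ((2 * Real.pi * ħ) ^ ((d : ℝ) / p.toReal))) *
    schattenNorm p T

/-- A form on Schwartz functions, representing an operator `T` by `(φ, ψ) ↦ ⟨φ, T ψ⟩`. -/
abbrev Form (d : ℕ) : Type := 𝓢(Space d, ℂ) → 𝓢(Space d, ℂ) → ℂ

/-- The form `(φ, ψ) ↦ ⟨φ, T ψ⟩` of a bounded operator on `L²(ℝᵈ)`. -/
def formOf {d : ℕ} (T : L2 d →L[ℂ] L2 d) : Form d :=
  fun φ ψ => ⟪φ.toLp 2, T (ψ.toLp 2)⟫_ℂ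

/-- Multiplication of a Schwartz function by the `j`-th coordinate. -/
def mulX {d : ℕ} (j : Fin d) (φ : 𝓢(Space d, ℂ)) : 𝓢(Space d, ℂ) :=
  SchwartzMap.smulLeftCLM ℂ (fun x : Space d => x j) φ

theorem mulX_apply {d : ℕ} (j : Fin d) (φ : 𝓢(Space d, ℂ)) (x : Space d) :
    mulX j φ x = (x j : ℂ) * φ x := by
  have h : Function.HasTemperateGrowth (fun x : Space d => x j) :=
    (EuclideanSpace.proj (𝕜 := ℝ) j).hasTemperateGrowth
  simp [mulX, SchwartzMap.smulLeftCLM_apply_apply h]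

/-- The partial derivative `∂_j` of a Schwartz function. -/
def dX {d : ℕ} (j : Fin d) (φ : 𝓢(Space d, ℂ)) : 𝓢(Space d, ℂ) :=
  ∂_{(EuclideanSpace.single j (1 : ℝ) : Space d)} φ

/-- The `2d` components of the quantum gradient, in the sense of forms:
`(iħ)⁻¹ [x_j, T]` for the index `inl j` and `[∂_j, T]` for the index `inr j`
(the sign in the latter comes from `⟨φ, ∂_j T ψ⟩ = -⟨∂_j φ, T ψ⟩`). -/
def formD {d : ℕ} (ħ : ℝ) : Fin d ⊕ Fin d → Form d → Form d
  | .inl j, q => fun φ ψ => (Complex.I * ħ)⁻¹ * (q (mulX j φ) ψ - q φ (mulX j ψ))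
  | .inr j, q => fun φ ψ => -q (dX j φ) ψ - q φ (dX j ψ)

/-- The component `D_{α 0} D_{α 1} ⋯ D_{α (k-1)} q` of the iterated quantum gradient of `q`. -/
def iterD {d : ℕ} (ħ : ℝ) : (k : ℕ) → (Fin k → Fin d ⊕ Fin d) → Form d → Form d
  | 0, _, q => q
  | k + 1, α, q => formD ħ (α 0) (iterD ħ k (fun i => α i.succ) q)

/-- The norm `‖∇_ħ^k A‖_{𝓛^p}`: the scaled Schatten norm of the family of the `(2d)^k` components
of the `k`-th quantum gradient of `A` if all of them are bounded operators (which are then unique,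
by density of the Schwartz functions), and `∞` otherwise. -/
def gradNorm {d : ℕ} (ħ : ℝ) (p : ℝ≥0∞) (k : ℕ) (A : L2 d →L[ℂ] L2 d) : ℝ≥0∞ :=
  ⨅ (T : (Fin k → Fin d ⊕ Fin d) → L2 d →L[ℂ] L2 d)
    (_ : ∀ α, formOf (T α) = iterD ħ k α (formOf A)), scaledNorm ħ p T

/-- The scaled Schatten norm of a single operator. -/
def opNorm {d : ℕ} (ħ : ℝ) (p : ℝ≥0∞) (T : L2 d →L[ℂ] L2 d) : ℝ≥0∞ :=
  scaledNorm ħ p (fun _ : Unit => T)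

end QuantumGradient

end

/-! The Weyl operators `W z`, a translation by r followed by a modulation of frequency s for z = (r,
s), are joint eigenvectors of the quantum gradient: its component a multiplies `W z` by `symb ħ a z`
(`formD_formOf_W`). If A were a superposition ∫ â(z) W(z) dz, then ∇A would have the symbols â ·
symb_a, and [A, B] = ∫ â(z) [W(z), B] dz. Duhamel's formula along the groups of modulations and
translations bounds the p-norm of [W(z), B] by ħ ∑ₐ |symb_a(z)| times a bound for the components of
∇B (`schattenLE_W_commutator`); this is the origin of the factor ħ. Minkowski's inequality then
reduces the theorem to L¹ bounds on the symbols of ∇A (`IsSymbol.schattenLE_commutator`).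

These bounds are a Sobolev interpolation on the phase space, of dimension 2d. By Plancherel, the
matrix elements of `W` satisfy Moyal's identity (`isMoyal_VL`), so a Hilbert–Schmidt operator has a
square-integrable symbol of no larger norm. If f is the symbol of D_a A, then symb_b^n f is the
symbol of D_b^n D_a A (`exists_gradient_symbol`). Cauchy–Schwarz against a weight growing like
|z|^{2n}, whose inverse is integrable because n > d, followed by the choice of the scale, gives the
exponents d/n and 1 - d/n (`lintegral_enorm_le`).

Two difficulties remain. First, A is only bounded: the symbols of its gradient exist, and their
compatibility yields a quotient â (`exists_mul_symb_eq`), but â need not be integrable at the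
origin. The renormalized integral ∫ â(z) (W(z) - 1) dz converges on Schwartz functions. It has the
same commutators with the Weyl operators as A, so by irreducibility it differs from A by a scalar
(`IsSymbol.exists_scalar`), and neither the scalar nor the subtraction of 1 affects commutators.

Second, the operator integrals converge only weakly. The Schatten norm is therefore replaced by the
variational bound `SchattenLE`, which passes through weak integrals (`SchattenLE.of_integral`) and
is tied to the norm by `schattenLE_of_schattenNorm` and `schattenNorm_le_of_schattenLE`. -/

noncomputable section

namespace QuantumGradient

/-! ### Positive operators: factorization, Jensen's inequality and traces. -/

section SchattenTheory

universe u

variable {H : Type u} [NormedAddCommGroup H] [InnerProductSpace ℂ H] [CompleteSpace H]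

/-- Douglas factorization: an operator dominated by `X` factors through `X`. -/
theorem exists_contraction_mul_eq (S X : H →L[ℂ] H) (h : ∀ v, ‖S v‖ ≤ ‖X v‖) :
    ∃ K : H →L[ℂ] H, ‖K‖ ≤ 1 ∧ K * X = S := by
  set V : Submodule ℂ H := (LinearMap.range X.toLinearMap).topologicalClosure with hV
  have hmem : ∀ v, X v ∈ V := fun v => Submodule.le_topologicalClosure _ ⟨v, rfl⟩
  let e : H →ₗ[ℂ] V := X.toLinearMap.codRestrict V hmem
  have hdense : DenseRange e := by
    intro y
    rw [closure_subtype]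
    have h1 : (fun x : V => (x : H)) '' Set.range e = (LinearMap.range X.toLinearMap : Set H) := by
      ext z
      constructor
      · rintro ⟨_, ⟨v, rfl⟩, rfl⟩
        exact ⟨v, rfl⟩
      · rintro ⟨v, rfl⟩
        exact ⟨e v, ⟨v, rfl⟩, rfl⟩
    have h2 : (y : H) ∈ closure (LinearMap.range X.toLinearMap : Set H) := y.2
    rw [← h1] at h2
    exact h2
  have hnorm : ∀ v, ‖S.toLinearMap v‖ ≤ 1 * ‖e v‖ := fun v => by
    rw [one_mul]; exact h v
  have : CompleteSpace V := (Submodule.isClosed_topologicalClosure _).completeSpace_coe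
  -- K sends X v to S v, is extended by continuity to the closure of the range of X, and vanishes on
  -- the orthogonal complement.
  refine ⟨(S.toLinearMap.extendOfNorm e) ∘L V.orthogonalProjectionOnto, ?_, ?_⟩
  · refine ContinuousLinearMap.opNorm_le_bound _ zero_le_one fun v => ?_
    refine (LinearMap.norm_extendOfNorm_apply_le hdense 1 hnorm _).trans ?_
    rw [one_mul, one_mul]
    exact V.norm_orthogonalProjectionOnto_apply_le v
  · ext v
    have h3 : V.orthogonalProjectionOnto (X v) = e v :=
      Submodule.orthogonalProjectionOnto_mem_subspace_eq_self (⟨X v, hmem v⟩ : V)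
    change S.toLinearMap.extendOfNorm e (V.orthogonalProjectionOnto (X v)) = S v
    rw [h3]
    exact LinearMap.extendOfNorm_eq hdense ⟨1, hnorm⟩ v


/-- Cauchy–Schwarz for the positive semidefinite form of X, through X = R*R. -/
theorem norm_inner_apply_sq_le {X : H →L[ℂ] H} (hX : 0 ≤ X) (f e : H) :
    ‖⟪f, X e⟫_ℂ‖ ^ 2 ≤ (⟪f, X f⟫_ℂ).re * (⟪e, X e⟫_ℂ).re := by
  obtain ⟨R, rfl⟩ := CStarAlgebra.nonneg_iff_eq_star_mul_self.1 hX
  have h : ∀ a b : H, ⟪a, (star R * R) b⟫_ℂ = ⟪R a, R b⟫_ℂ := fun a b => by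
    rw [mul_apply_eq_comp, ContinuousLinearMap.star_eq_adjoint,
      ContinuousLinearMap.adjoint_inner_right]
  have h2 : ∀ a : H, (⟪R a, R a⟫_ℂ).re = ‖R a‖ ^ 2 := fun a => by
    rw [inner_self_eq_norm_sq_to_K]; simp [← Complex.ofReal_pow]
  rw [h, h, h, h2, h2, ← mul_pow]
  gcongr
  exact norm_inner_le_norm _ _

theorem re_inner_nonneg {X : H →L[ℂ] H} (hX : 0 ≤ X) (v : H) : 0 ≤ (⟪v, X v⟫_ℂ).re :=
  ((ContinuousLinearMap.nonneg_iff_isPositive X).1 hX).re_inner_nonneg_right v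

theorem re_inner_mono {X Y : H →L[ℂ] H} (h : X ≤ Y) (v : H) :
    (⟪v, X v⟫_ℂ).re ≤ (⟪v, Y v⟫_ℂ).re := by
  have := re_inner_nonneg (sub_nonneg.2 h) v
  rw [sub_apply, inner_sub_right, Complex.sub_re] at this
  linarith

theorem re_inner_affine (X : H →L[ℂ] H) (hX : IsSelfAdjoint X) (a b : ℝ) (v : H) :
    (⟪v, cfc (fun x : ℝ => a + b * x) X v⟫_ℂ).re = a * ‖v‖ ^ 2 + b * (⟪v, X v⟫_ℂ).re := by
  have h6 : cfc (fun x : ℝ => a + b * x) X = a • (1 : H →L[ℂ] H) + b • X := by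
    rw [cfc_const_add a (fun x : ℝ => b * x) X (by fun_prop) hX,
      cfc_const_mul_id b X hX, Algebra.algebraMap_eq_smul_one]
  rw [h6, add_apply, inner_add_right, Complex.add_re, smul_apply, smul_apply, one_apply_eq_self,
    RCLike.real_smul_eq_coe_smul (K := ℂ), RCLike.real_smul_eq_coe_smul (K := ℂ),
    inner_smul_right, inner_smul_right, inner_self_eq_norm_sq_to_K]
  simp [← Complex.ofReal_pow]

/-- By convexity, the power function lies above its tangent at c; this is Bernoulli's inequality at
x/c - 1. -/
theorem rpow_tangent_le {p c x : ℝ} (hp : 1 ≤ p) (hc : 0 < c) (hx : 0 ≤ x) :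
    (1 - p) * c ^ p + p * c ^ (p - 1) * x ≤ x ^ p := by
  have h3 := one_add_mul_self_le_rpow_one_add (s := x / c - 1)
    (by linarith [div_nonneg hx hc.le]) hp
  rw [show 1 + (x / c - 1) = x / c by ring, Real.div_rpow hx hc.le,
    le_div_iff₀ (by positivity)] at h3
  have h4 : c ^ p = c ^ (p - 1) * c := by
    rw [← Real.rpow_add_one hc.ne', sub_add_cancel]
  refine le_trans (le_of_eq ?_) h3
  rw [h4]; field_simp; ring

/-- Jensen's inequality for the spectral measure of a positive operator. -/
theorem rpow_re_inner_le {X : H →L[ℂ] H} (hX : 0 ≤ X) {p : ℝ} (hp : 1 ≤ p) {v : H}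
    (hv : ‖v‖ ≤ 1) : (⟪v, X v⟫_ℂ).re ^ p ≤ (⟪v, (CFC.rpow X p) v⟫_ℂ).re := by
  generalize hc : (⟪v, X v⟫_ℂ).re = c
  have hc0 : 0 ≤ c := hc ▸ re_inner_nonneg hX v
  rcases hc0.eq_or_lt with h0 | hpos
  · rw [← h0, Real.zero_rpow (by linarith)]
    exact re_inner_nonneg CFC.rpow_nonneg v
  have h1 : CFC.rpow X p = cfc (fun x : ℝ => x ^ p) X := CFC.rpow_eq_cfc_real hX
  have hcont : Continuous (fun x : ℝ => x ^ p) := Real.continuous_rpow_const (by linarith)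
  -- The tangent is taken at the mean value c = ⟨v, X v⟩, and the scalar inequality is transported
  -- by the functional calculus.
  have h2 : cfc (fun x : ℝ => (1 - p) * c ^ p + p * c ^ (p - 1) * x) X ≤
      cfc (fun x : ℝ => x ^ p) X :=
    cfc_mono (fun x hx => rpow_tangent_le hp hpos (spectrum_nonneg_of_nonneg hX hx))
      (by fun_prop) hcont.continuousOn
  have h5 := re_inner_mono h2 v
  rw [h1]
  refine le_trans ?_ h5
  rw [re_inner_affine X (.of_nonneg hX), hc]
  have h8 : c ^ p = c ^ (p - 1) * c := by
    rw [← Real.rpow_add_one hpos.ne', sub_add_cancel]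
  -- The constant term (1 - p) c^p is nonpositive, so a vector shorter than 1 only improves the
  -- estimate.
  have h9 : ‖v‖ ^ 2 ≤ 1 := pow_le_one₀ (norm_nonneg _) hv
  have h10 : 0 ≤ c ^ p := by positivity
  have h11 : p * c ^ (p - 1) * c = p * c ^ p := by rw [h8]; ring
  rw [h11]
  nlinarith [mul_nonneg (mul_nonneg (sub_nonneg.2 hp) h10) (sub_nonneg.2 h9)]

/-- A weighted finite family of vectors of the unit ball satisfying Bessel's inequality. -/
structure WeightedBessel {ι : Type*} [Fintype ι] (w : ι → ℝ) (e : ι → H) : Prop where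
  norm_le_one : ∀ i, ‖e i‖ ≤ 1
  sum_le : ∀ v, ∑ i, w i * ‖⟪e i, v⟫_ℂ‖ ^ 2 ≤ ‖v‖ ^ 2

/-- Moving K to the other side of the inner product preserves Bessel's inequality. Orthonormality
would not survive a contraction, hence the weaker notion. -/
theorem WeightedBessel.map {ι : Type*} [Fintype ι] {w : ι → ℝ} {e : ι → H}
    (h : WeightedBessel w e) {K : H →L[ℂ] H} (hK : ‖K‖ ≤ 1) :
    WeightedBessel w (fun i => K (e i)) where
  norm_le_one i := (K.le_of_opNorm_le hK _).trans (by rw [one_mul]; exact h.norm_le_one i)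
  sum_le v := by
    have h1 : ∀ i, ⟪K (e i), v⟫_ℂ = ⟪e i, star K v⟫_ℂ := fun i => by
      rw [ContinuousLinearMap.star_eq_adjoint, ContinuousLinearMap.adjoint_inner_right]
    simp_rw [h1]
    refine (h.sum_le _).trans ?_
    have h2 : ‖star K v‖ ≤ 1 * ‖v‖ := ContinuousLinearMap.le_of_opNorm_le _ (by rwa [norm_star]) _
    rw [one_mul] at h2
    gcongr

/-- With Y = R*R and a Hilbert basis (b_k), the left side is the double sum of w_i |⟨e_i, R* b_k⟩|².
Bessel's inequality at each R* b_k leaves ∑ ‖R* b_k‖², which is the trace. -/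
theorem sum_re_inner_le_trace {ι : Type*} [Fintype ι] {w : ι → ℝ} (hw : ∀ i, 0 ≤ w i)
    {e : ι → H} (h : WeightedBessel w e) {Y : H →L[ℂ] H} (hY : 0 ≤ Y) :
    ENNReal.ofReal (∑ i, w i * (⟪e i, Y (e i)⟫_ℂ).re) ≤ trace Y := by
  obtain ⟨R, rfl⟩ := CStarAlgebra.nonneg_iff_eq_star_mul_self.1 hY
  have h2 : ∀ a : H, (⟪a, (star R * R) a⟫_ℂ).re = ‖R a‖ ^ 2 := fun a => by
    rw [mul_apply_eq_comp, ContinuousLinearMap.star_eq_adjoint,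
      ContinuousLinearMap.adjoint_inner_right, inner_self_eq_norm_sq_to_K]
    simp [← Complex.ofReal_pow]
  simp_rw [h2]
  rw [trace, diagSum_star_mul_self _ (someBasis H),
    ENNReal.ofReal_sum_of_nonneg fun i _ => mul_nonneg (hw i) (sq_nonneg _)]
  have h3 : ∀ i, ENNReal.ofReal (w i * ‖R (e i)‖ ^ 2) =
      ∑' k, ENNReal.ofReal (w i * ‖⟪e i, star R (someBasis H k)⟫_ℂ‖ ^ 2) := fun i => by
    rw [ENNReal.ofReal_mul (hw i), ENNReal.ofReal_pow (norm_nonneg _), ofReal_norm,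
      ← tsum_enorm_inner_sq (someBasis H), ← ENNReal.tsum_mul_left]
    refine tsum_congr fun k => ?_
    rw [ENNReal.ofReal_mul (hw i), ENNReal.ofReal_pow (norm_nonneg _), ofReal_norm,
      ContinuousLinearMap.star_eq_adjoint, ContinuousLinearMap.adjoint_inner_right,
      ← inner_conj_symm, RCLike.enorm_conj]
  simp_rw [h3]
  rw [← Summable.tsum_finsetSum fun _ _ => ENNReal.summable]
  refine ENNReal.tsum_le_tsum fun k => ?_
  rw [← ENNReal.ofReal_sum_of_nonneg fun i _ => mul_nonneg (hw i) (sq_nonneg _),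
    ← ofReal_norm, ← ENNReal.ofReal_pow (norm_nonneg _)]
  exact ENNReal.ofReal_le_ofReal (h.sum_le _)

end SchattenTheory

/-! ### The variational Schatten bound and Minkowski's inequality. -/

section SchattenBound

universe u

variable {H : Type u} [NormedAddCommGroup H] [InnerProductSpace ℂ H] [CompleteSpace H]

/-- A variational form of the inequality `‖S‖_p ≤ M` for the Schatten norm, stable under
weak integrals. -/
def SchattenLE (p : ℝ≥0∞) (S : H →L[ℂ] H) (M : ℝ) : Prop :=
  if p = ∞ then ‖S‖ ≤ M else
    ∀ (ι : Type u) [Fintype ι] (w : ι → ℝ) (e f : ι → H), (∀ i, 0 ≤ w i) →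
      WeightedBessel w e → WeightedBessel w f →
      ∑ i, w i * ‖⟪f i, S (e i)⟫_ℂ‖ ^ p.toReal ≤ M ^ p.toReal

/-- The contractions are absorbed by the test families: D acts on e and the adjoint of C on f. -/
theorem SchattenLE.mul_mul {p : ℝ≥0∞} {S : H →L[ℂ] H} {M : ℝ} (h : SchattenLE p S M)
    {C D : H →L[ℂ] H} (hC : ‖C‖ ≤ 1) (hD : ‖D‖ ≤ 1) : SchattenLE p (C * S * D) M := by
  unfold SchattenLE at h ⊢
  split_ifs at h ⊢ with hp
  · refine (norm_mul_le _ _).trans ?_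
    have h1 : ‖C * S‖ ≤ ‖S‖ := (norm_mul_le _ _).trans
      (by nlinarith [norm_nonneg S])
    nlinarith [norm_nonneg (C * S)]
  · intro ι _ w e f hw he hf
    have h1 : ∀ i, ⟪f i, (C * S * D) (e i)⟫_ℂ = ⟪star C (f i), S (D (e i))⟫_ℂ := fun i => by
      rw [ContinuousLinearMap.star_eq_adjoint, ContinuousLinearMap.adjoint_inner_left]
      rfl
    simp_rw [h1]
    exact h ι w _ _ hw (he.map hD) (hf.map (by rwa [norm_star]))

theorem SchattenLE.smul {p : ℝ≥0∞} {S : H →L[ℂ] H} {M : ℝ} (hM : 0 ≤ M) (h : SchattenLE p S M)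
    (c : ℂ) : SchattenLE p (c • S) (‖c‖ * M) := by
  unfold SchattenLE at h ⊢
  split_ifs at h ⊢ with hp
  · rw [norm_smul]; gcongr
  · intro ι _ w e f hw he hf
    have h1 : ∀ i, w i * ‖⟪f i, (c • S) (e i)⟫_ℂ‖ ^ p.toReal =
        ‖c‖ ^ p.toReal * (w i * ‖⟪f i, S (e i)⟫_ℂ‖ ^ p.toReal) := fun i => by
      rw [smul_apply, inner_smul_right, norm_mul,
        Real.mul_rpow (norm_nonneg _) (norm_nonneg _)]
      ring
    simp_rw [h1]
    rw [← Finset.mul_sum, Real.mul_rpow (norm_nonneg _) hM]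
    gcongr
    exact h ι w e f hw he hf

/-- Minkowski's integral inequality for Schatten norms. -/
theorem SchattenLE.of_integral {p : ℝ≥0∞} (hp : 1 ≤ p) {Ω : Type*} [MeasurableSpace Ω]
    {μ : Measure Ω} {S : H →L[ℂ] H} {s : Ω → H →L[ℂ] H} {b : Ω → ℝ}
    (hs : ∀ f e, Integrable (fun ω => ⟪f, s ω e⟫_ℂ) μ)
    (hS : ∀ f e, ⟪f, S e⟫_ℂ = ∫ ω, ⟪f, s ω e⟫_ℂ ∂μ) (hb : Integrable b μ) (hb0 : ∀ ω, 0 ≤ b ω)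
    (h : ∀ ω, SchattenLE p (s ω) (b ω)) : SchattenLE p S (∫ ω, b ω ∂μ) := by
  have hI : 0 ≤ ∫ ω, b ω ∂μ := integral_nonneg hb0
  unfold SchattenLE at h ⊢
  split_ifs at h ⊢ with hptop
  · refine ContinuousLinearMap.opNorm_le_bound _ hI fun e => ?_
    -- For p = ∞, the weak identity is tested against S e itself; one factor ‖S e‖ is divided out
    -- afterwards.
    have h1 : ‖⟪S e, S e⟫_ℂ‖ ≤ ∫ ω, b ω * (‖S e‖ * ‖e‖) ∂μ := by
      rw [hS]
      refine norm_integral_le_of_norm_le (hb.mul_const _) (.of_forall fun ω => ?_)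
      refine (norm_inner_le_norm _ _).trans ?_
      have h2 := (s ω).le_of_opNorm_le (h ω) e
      nlinarith [norm_nonneg (S e)]
    rw [integral_mul_const, inner_self_eq_norm_sq_to_K] at h1
    simp only [norm_pow, RCLike.norm_ofReal, abs_norm] at h1
    rcases (norm_nonneg (S e)).eq_or_lt with h0 | h0
    · rw [← h0]; positivity
    · refine le_of_mul_le_mul_right ?_ h0
      nlinarith
  · intro ι _ w e f hw he hf
    have : Fact (1 ≤ p) := ⟨hp⟩
    have hq : 0 < p.toReal := ENNReal.toReal_pos (by positivity) hptop
    -- The weights are absorbed as w^{1/p} into a finite-dimensional ℓ^p space, where Minkowski's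
    -- inequality is the bound of the norm of an integral by the integral of the norm.
    let g : (ι → ℂ) → PiLp p (fun _ : ι => ℂ) := fun z =>
      WithLp.toLp p (fun i => ((w i) ^ (1 / p.toReal) : ℝ) • z i)
    have hg : ∀ z, ‖g z‖ = (∑ i, w i * ‖z i‖ ^ p.toReal) ^ (1 / p.toReal) := fun z => by
      rw [PiLp.norm_eq_sum hq]
      congr 1
      refine Finset.sum_congr rfl fun i _ => ?_
      simp only [g, norm_smul, Real.norm_eq_abs]
      rw [abs_of_nonneg (Real.rpow_nonneg (hw i) _), Real.mul_rpow (Real.rpow_nonneg (hw i) _)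
        (norm_nonneg _), ← Real.rpow_mul (hw i), one_div, inv_mul_cancel₀ hq.ne', Real.rpow_one]
    have hint : Integrable (fun ω => g fun i => ⟪f i, s ω (e i)⟫_ℂ) μ := by
      refine (PiLp.continuousLinearEquiv p ℂ (fun _ : ι => ℂ)).symm.toContinuousLinearMap.integrable_comp
        (Integrable.of_eval fun i => ?_)
      exact (hs (f i) (e i)).smul ((w i) ^ (1 / p.toReal) : ℝ)
    have h3 : g (fun i => ⟪f i, S (e i)⟫_ℂ) = ∫ ω, g (fun i => ⟪f i, s ω (e i)⟫_ℂ) ∂μ := by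
      ext i
      have h4 := (PiLp.proj (𝕜 := ℂ) p (fun _ : ι => ℂ) i).integral_comp_comm hint
      change _ = (PiLp.proj (𝕜 := ℂ) p (fun _ : ι => ℂ) i) _
      rw [← h4]
      simp only [g, PiLp.proj_apply]
      rw [integral_smul, hS]
    have h5 : ‖g (fun i => ⟪f i, S (e i)⟫_ℂ)‖ ≤ ∫ ω, b ω ∂μ := by
      rw [h3]
      refine norm_integral_le_of_norm_le hb (.of_forall fun ω => ?_)
      rw [hg]
      refine (Real.rpow_le_rpow (Finset.sum_nonneg fun i _ => mul_nonneg (hw i) (by positivity))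
        (h ω ι w e f hw he hf) (by positivity)).trans_eq ?_
      rw [one_div, Real.rpow_rpow_inv (hb0 ω) hq.ne']
    rw [hg] at h5
    have h6 : 0 ≤ ∑ i, w i * ‖⟪f i, S (e i)⟫_ℂ‖ ^ p.toReal :=
      Finset.sum_nonneg fun i _ => mul_nonneg (hw i) (by positivity)
    calc _ = ((∑ i, w i * ‖⟪f i, S (e i)⟫_ℂ‖ ^ p.toReal) ^ (1 / p.toReal)) ^ p.toReal := by
          rw [one_div, Real.rpow_inv_rpow h6 hq.ne']
      _ ≤ _ := by gcongr

/-- A finite sum is an integral for the counting measure. -/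
theorem SchattenLE.sum {p : ℝ≥0∞} (hp : 1 ≤ p) {κ : Type*} [Fintype κ] {s : κ → H →L[ℂ] H}
    {b : κ → ℝ} (hb0 : ∀ k, 0 ≤ b k) (h : ∀ k, SchattenLE p (s k) (b k)) :
    SchattenLE p (∑ k, s k) (∑ k, b k) := by
  let _ : MeasurableSpace κ := ⊤
  have h1 := SchattenLE.of_integral (μ := Measure.count) (S := ∑ k, s k) hp
    (fun f e => Integrable.of_finite) (fun f e => by
      simp [integral_fintype, sum_apply, Measure.real])
    (Integrable.of_finite (f := b)) hb0 h
  simpa [integral_fintype, Measure.real] using h1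

theorem SchattenLE.add {p : ℝ≥0∞} (hp : 1 ≤ p) {S T : H →L[ℂ] H} {M N : ℝ} (hM : 0 ≤ M)
    (hN : 0 ≤ N) (hS : SchattenLE p S M) (hT : SchattenLE p T N) :
    SchattenLE p (S + T) (M + N) := by
  have := SchattenLE.sum hp (s := ![S, T]) (b := ![M, N])
    (by intro k; fin_cases k <;> simpa) (by intro k; fin_cases k <;> simpa)
  simpa using this

theorem famAbs_nonneg {ι : Type*} [Fintype ι] (T : ι → H →L[ℂ] H) : 0 ≤ famAbs T :=
  CFC.sqrt_nonneg _

theorem famAbs_mul_self {ι : Type*} [Fintype ι] (T : ι → H →L[ℂ] H) :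
    famAbs T * famAbs T = ∑ i, star (T i) * T i :=
  CFC.sqrt_mul_sqrt_self _ (Finset.sum_nonneg fun i _ => star_mul_self_nonneg (T i))

theorem re_inner_star_mul_self (R : H →L[ℂ] H) (v : H) :
    (⟪v, (star R * R) v⟫_ℂ).re = ‖R v‖ ^ 2 := by
  rw [mul_apply_eq_comp, ContinuousLinearMap.star_eq_adjoint,
    ContinuousLinearMap.adjoint_inner_right, inner_self_eq_norm_sq_to_K]
  simp [← Complex.ofReal_pow]

theorem norm_famAbs_apply_sq {ι : Type*} [Fintype ι] (T : ι → H →L[ℂ] H) (v : H) :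
    ‖famAbs T v‖ ^ 2 = ∑ i, ‖T i v‖ ^ 2 := by
  have hsa : star (famAbs T) = famAbs T := (IsSelfAdjoint.of_nonneg (famAbs_nonneg T)).star_eq
  have h1 := re_inner_star_mul_self (famAbs T) v
  rw [← h1, hsa, famAbs_mul_self, sum_apply, inner_sum, Complex.re_sum]
  exact Finset.sum_congr rfl fun i _ => re_inner_star_mul_self _ _

theorem norm_apply_le_norm_famAbs {ι : Type*} [Fintype ι] (T : ι → H →L[ℂ] H) (i : ι) (v : H) :
    ‖T i v‖ ≤ ‖famAbs T v‖ := by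
  refine le_of_sq_le_sq ?_ (norm_nonneg _)
  rw [norm_famAbs_apply_sq]
  exact Finset.single_le_sum (f := fun i => ‖T i v‖ ^ 2) (fun _ _ => sq_nonneg _)
    (Finset.mem_univ i)

/-- Each component of a family is bounded by the Schatten norm of the family. -/
theorem schattenLE_of_schattenNorm {ι : Type*} [Fintype ι] {p : ℝ≥0∞} (hp : 1 ≤ p)
    {T : ι → H →L[ℂ] H} (hT : schattenNorm p T ≠ ∞) (j : ι) :
    SchattenLE p (T j) (schattenNorm p T).toReal := by
  -- This is a one-sided polar decomposition T_j = K |T| with K a contraction.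
  obtain ⟨K, hK, hKT⟩ := exists_contraction_mul_eq (T j) (famAbs T) (norm_apply_le_norm_famAbs T j)
  unfold SchattenLE schattenNorm at *
  split_ifs at hT ⊢ with hptop
  · rw [toReal_enorm, ← hKT]
    refine (norm_mul_le _ _).trans ?_
    nlinarith [norm_nonneg (famAbs T)]
  · intro κ _ w e f hw he hf
    have hq : 0 < p.toReal := ENNReal.toReal_pos (by positivity) hptop
    have hq1 : 1 ≤ p.toReal := by
      rw [← ENNReal.toReal_one]; exact ENNReal.toReal_mono hptop hp
    set X := famAbs T with hX
    set q := p.toReal with hqdef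
    have hX0 : 0 ≤ X := famAbs_nonneg T
    have htr : trace (CFC.rpow X q) ≠ ∞ := by
      intro h; rw [h, ENNReal.top_rpow_of_pos (by positivity)] at hT; exact hT rfl
    rw [← ENNReal.toReal_rpow, one_div, Real.rpow_inv_rpow ENNReal.toReal_nonneg hq.ne']
    have hbound : ∀ g : κ → H, WeightedBessel w g →
        ∑ i, w i * (⟪g i, X (g i)⟫_ℂ).re ^ q ≤ (trace (CFC.rpow X q)).toReal := by
      intro g hg
      have h1 := sum_re_inner_le_trace hw hg (Y := CFC.rpow X q) CFC.rpow_nonneg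
      rw [ENNReal.ofReal_le_iff_le_toReal htr] at h1
      refine le_trans (Finset.sum_le_sum fun i _ => ?_) h1
      exact mul_le_mul_of_nonneg_left (rpow_re_inner_le hX0 hq1 (hg.norm_le_one i)) (hw i)
    have hf' := hf.map (K := star K) (by rwa [norm_star])
    have hA := hbound _ he
    have hB := hbound _ hf'
    -- Cauchy–Schwarz for the form of |T| between K* f_i and e_i, then the arithmetic-geometric mean
    -- of the q-th powers. Jensen and the trace bound (`hbound`) control both halves, since (K* f_i)
    -- is again a Bessel family.
    have h2 : ∀ i, w i * ‖⟪f i, T j (e i)⟫_ℂ‖ ^ q ≤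
        (w i * (⟪e i, X (e i)⟫_ℂ).re ^ q +
          w i * (⟪star K (f i), X (star K (f i))⟫_ℂ).re ^ q) / 2 := by
      intro i
      have h3 : ⟪f i, T j (e i)⟫_ℂ = ⟪star K (f i), X (e i)⟫_ℂ := by
        rw [ContinuousLinearMap.star_eq_adjoint, ContinuousLinearMap.adjoint_inner_left, ← hKT]
        rfl
      have h4 := norm_inner_apply_sq_le hX0 (star K (f i)) (e i)
      rw [h3]
      set a := (⟪e i, X (e i)⟫_ℂ).re
      set b := (⟪star K (f i), X (star K (f i))⟫_ℂ).re
      set n := ‖⟪star K (f i), X (e i)⟫_ℂ‖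
      have ha : 0 ≤ a := re_inner_nonneg hX0 _
      have hb : 0 ≤ b := re_inner_nonneg hX0 _
      have hn : 0 ≤ n := norm_nonneg _
      have h5 : (n ^ q) ^ 2 ≤ b ^ q * a ^ q := by
        rw [← Real.mul_rpow hb ha, ← Real.rpow_natCast, ← Real.rpow_mul hn, mul_comm q,
          Real.rpow_mul hn, Real.rpow_natCast]
        exact Real.rpow_le_rpow (sq_nonneg _) h4 hq.le
      have h6 : n ^ q ≤ (a ^ q + b ^ q) / 2 := by
        refine le_of_sq_le_sq (h5.trans ?_) (by positivity)
        nlinarith [sq_nonneg (a ^ q - b ^ q)]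
      nlinarith [hw i, mul_le_mul_of_nonneg_left h6 (hw i)]
    calc _ ≤ _ := Finset.sum_le_sum fun i _ => h2 i
      _ = (∑ i, w i * (⟪e i, X (e i)⟫_ℂ).re ^ q +
        ∑ i, w i * (⟪star K (f i), X (star K (f i))⟫_ℂ).re ^ q) / 2 := by
          rw [← Finset.sum_div, Finset.sum_add_distrib]
      _ ≤ _ := by linarith

end SchattenBound

/-! ### From the variational bound back to the Schatten norm. -/

section SchattenDuality

universe u

variable {H : Type u} [NormedAddCommGroup H] [InnerProductSpace ℂ H] [CompleteSpace H]

/-- The piecewise linear function equal to `0` on `(-∞, 0]` and to `1` on `[1, ∞)`. -/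
def ramp (t : ℝ) : ℝ := max 0 (min 1 t)

theorem continuous_ramp : Continuous ramp := by unfold ramp; fun_prop

/-- The tent function supported in `[k - 1, k + 1]`. -/
def tent (k : ℕ) (t : ℝ) : ℝ := ramp (t + 1 - k) - ramp (t - k)

theorem continuous_tent (k : ℕ) : Continuous (tent k) := by
  have := continuous_ramp
  unfold tent; fun_prop

theorem tent_nonneg (k : ℕ) (t : ℝ) : 0 ≤ tent k t := by
  unfold tent ramp
  refine sub_nonneg.2 (max_le_max le_rfl (min_le_min le_rfl (by linarith)))

/-- The tents telescope: the first ramp is saturated at 1 and the last one still vanishes. -/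
theorem sum_tent (N : ℕ) {t : ℝ} (h0 : 0 ≤ t) (hN : t + 1 ≤ N) :
    ∑ k : Fin N, tent k t = 1 := by
  rw [Fin.sum_univ_eq_sum_range (fun k => tent k t)]
  have h1 : ∀ k : ℕ, tent k t = ramp (t + 1 - k) - ramp (t + 1 - (k + 1 : ℕ)) := fun k => by
    unfold tent; push_cast; congr 2; ring
  simp_rw [h1]
  rw [Finset.sum_range_sub' (fun k : ℕ => ramp (t + 1 - k))]
  unfold ramp
  rw [min_eq_left (by push_cast; linarith), min_eq_right (by linarith),
    max_eq_left (a := (0 : ℝ)) (b := t + 1 - N) (by linarith)]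
  simp

theorem tent_eq_zero_of_le {k : ℕ} {t : ℝ} (h : t + 1 ≤ k) : tent k t = 0 := by
  unfold tent ramp
  rw [min_eq_right (by linarith), min_eq_right (by linarith), max_eq_left (by linarith),
    max_eq_left (by linarith), sub_zero]

theorem tent_eq_zero_of_ge {k : ℕ} {t : ℝ} (h : (k : ℝ) + 1 ≤ t) : tent k t = 0 := by
  unfold tent ramp
  rw [min_eq_left (by linarith), min_eq_left (by linarith), sub_self]

theorem norm_cfc_apply_sq {X : H →L[ℂ] H} {f : ℝ → ℝ} (hf : Continuous f)
    (v : H) : ‖cfc f X v‖ ^ 2 = (⟪v, cfc (fun x => f x * f x) X v⟫_ℂ).re := by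
  have hsa : star (cfc f X) = cfc f X := (cfc_predicate f X).star_eq
  rw [← re_inner_star_mul_self, hsa, ← cfc_mul f f X hf.continuousOn hf.continuousOn]

theorem inner_cfc_apply_cfc {X : H →L[ℂ] H} (hX : IsSelfAdjoint X) {f : ℝ → ℝ}
    (hf : Continuous f) (v : H) :
    ⟪cfc f X v, X (cfc f X v)⟫_ℂ = ⟪v, cfc (fun x => f x * f x * x) X v⟫_ℂ := by
  have hsa : star (cfc f X) = cfc f X := (cfc_predicate f X).star_eq
  have h1 : cfc (fun x => f x * f x * x) X = cfc f X * (X * cfc f X) := by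
    calc cfc (fun x => f x * f x * x) X = cfc f X * (cfc (fun x : ℝ => x) X * cfc f X) := ?_
      _ = _ := by rw [cfc_id' ℝ X hX]
    rw [← cfc_mul (fun x => x) f X (by fun_prop) hf.continuousOn,
      ← cfc_mul f _ X hf.continuousOn (by fun_prop)]
    congr 1
    ext x; ring
  rw [h1, mul_apply_eq_comp, mul_apply_eq_comp]
  nth_rewrite 3 [← hsa]
  rw [ContinuousLinearMap.star_eq_adjoint, ContinuousLinearMap.adjoint_inner_right]

theorem le_norm_of_mem_spectrum {X : H →L[ℂ] H} {x : ℝ} (hx : x ∈ spectrum ℝ X) :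
    x ≤ ‖X‖ := by
  rcases subsingleton_or_nontrivial H with h | h
  · have : Subsingleton (H →L[ℂ] H) := inferInstance
    exact absurd hx (by simp [spectrum.of_subsingleton])
  · exact (le_abs_self x).trans (spectrum.norm_le_norm_of_mem hx)

theorem re_inner_cfc_mono {X : H →L[ℂ] H} (hX : 0 ≤ X) {f g : ℝ → ℝ} (hf : Continuous f)
    (hg : Continuous g) (h : ∀ x, 0 ≤ x → x ≤ ‖X‖ → f x ≤ g x) (v : H) :
    (⟪v, cfc f X v⟫_ℂ).re ≤ (⟪v, cfc g X v⟫_ℂ).re :=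
  re_inner_mono (cfc_mono (fun x hx => h x (spectrum_nonneg_of_nonneg hX hx)
    (le_norm_of_mem_spectrum hx)) hf.continuousOn hg.continuousOn) v

theorem re_inner_cfc_const_mul {X : H →L[ℂ] H} {f : ℝ → ℝ} (hf : Continuous f)
    (c : ℝ) (v : H) :
    (⟪v, cfc (fun x => c * f x) X v⟫_ℂ).re = c * (⟪v, cfc f X v⟫_ℂ).re := by
  rw [cfc_const_mul c f X hf.continuousOn, smul_apply, RCLike.real_smul_eq_coe_smul (K := ℂ),
    inner_smul_right]
  simp

theorem re_inner_cfc_sum {X : H →L[ℂ] H} {κ : Type*} [Fintype κ] {f : κ → ℝ → ℝ}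
    (hf : ∀ k, Continuous (f k)) (v : H) :
    (⟪v, cfc (fun x => ∑ k, f k x) X v⟫_ℂ).re = ∑ k, (⟪v, cfc (f k) X v⟫_ℂ).re := by
  have h1 : (fun x => ∑ k, f k x) = ∑ k, f k := by ext x; simp
  rw [h1, cfc_sum_univ (fun k => f k) X (fun k => (hf k).continuousOn), sum_apply, inner_sum,
    Complex.re_sum]

/-- An approximate spectral decomposition of a positive operator `X` relative to `X ^ q`. -/
theorem exists_spectral_partition {X : H →L[ℂ] H} (hX : 0 ≤ X) {q : ℝ} (hq : 1 ≤ q) {δ : ℝ}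
    (hδ : 0 < δ) : ∃ (N : ℕ) (Q : Fin N → H →L[ℂ] H) (a : Fin N → ℝ),
      (∀ k, star (Q k) = Q k) ∧ (∀ k, 0 ≤ a k) ∧ (∀ v, ∑ k, ‖Q k v‖ ^ 2 = ‖v‖ ^ 2) ∧
      (∀ k v, a k * ‖Q k v‖ ^ 2 ≤ (⟪Q k v, X (Q k v)⟫_ℂ).re) ∧
      ∀ v, (⟪v, (CFC.rpow X q) v⟫_ℂ).re ≤ ∑ k, (a k ^ q + 2 * δ) * ‖Q k v‖ ^ 2 := by
  have hq0 : 0 < q := by linarith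
  have hXsa : IsSelfAdjoint X := .of_nonneg hX
  -- Enough tents to cover the range [0, ‖X‖^q / δ] of x^q / δ on the spectrum.
  obtain ⟨N, hN⟩ := exists_nat_ge (‖X‖ ^ q / δ + 1)
  have hpow : Continuous (fun x : ℝ => x ^ q) := Real.continuous_rpow_const hq0.le
  have hθ : ∀ k : ℕ, Continuous (fun x : ℝ => tent k (x ^ q / δ)) := fun k =>
    (continuous_tent k).comp (hpow.div_const δ)
  have hsq : ∀ k : ℕ, Continuous (fun x : ℝ => √(tent k (x ^ q / δ))) := fun k => (hθ k).sqrt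
  have hQ : ∀ (k : ℕ) (v : H), ‖cfc (fun x : ℝ => √(tent k (x ^ q / δ))) X v‖ ^ 2 =
      (⟪v, cfc (fun x : ℝ => tent k (x ^ q / δ)) X v⟫_ℂ).re := fun k v => by
    rw [norm_cfc_apply_sq (hsq k)]
    simp_rw [Real.mul_self_sqrt (tent_nonneg _ _)]
  have hsum : ∀ x : ℝ, 0 ≤ x → x ≤ ‖X‖ → ∑ k : Fin N, tent k (x ^ q / δ) = 1 := by
    intro x h0 h1
    refine sum_tent N (by positivity) (le_trans ?_ hN)
    gcongr
  -- Q_k is the square root of the k-th tent evaluated at X^q / δ. On its support x^q runs over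
  -- [(k-1)δ, (k+1)δ] ∩ [0, ∞), and a_k^q is the lower end of this interval; its length is the error
  -- 2δ.
  refine ⟨N, fun k => cfc (fun x : ℝ => √(tent k (x ^ q / δ))) X,
    fun k => (max 0 ((k : ℝ) - 1) * δ) ^ (1 / q), 
    fun k => (cfc_predicate (fun x : ℝ => √(tent k (x ^ q / δ))) X : IsSelfAdjoint _).star_eq,
    fun k => by positivity, fun v => ?_, fun k v => ?_, fun v => ?_⟩
  · simp_rw [hQ]
    rw [← re_inner_cfc_sum (fun k : Fin N => hθ k)]
    have h1 : cfc (fun x => ∑ k : Fin N, tent k (x ^ q / δ)) X = cfc (fun _ : ℝ => (1 : ℝ)) X :=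
      cfc_congr fun x hx => hsum x (spectrum_nonneg_of_nonneg hX hx) (le_norm_of_mem_spectrum hx)
    rw [h1, cfc_const_one ℝ X hXsa, one_apply_eq_self, inner_self_eq_norm_sq_to_K]
    simp [← Complex.ofReal_pow]
  · rw [inner_cfc_apply_cfc hXsa (hsq k), hQ, ← re_inner_cfc_const_mul (hθ k)]
    refine re_inner_cfc_mono hX ((hθ k).const_mul _) (by fun_prop) (fun x h0 h1 => ?_) v
    rw [Real.mul_self_sqrt (tent_nonneg _ _), mul_comm]
    rcases le_or_gt (x ^ q / δ + 1) k with h | h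
    · rw [tent_eq_zero_of_le h]; simp
    · refine mul_le_mul_of_nonneg_left ?_ (tent_nonneg _ _)
      have h2 : max 0 ((k : ℝ) - 1) * δ ≤ x ^ q := by
        rw [← le_div_iff₀ hδ]
        exact max_le (by positivity) (by linarith)
      calc (max 0 ((k : ℝ) - 1) * δ) ^ (1 / q) ≤ (x ^ q) ^ (1 / q) := by gcongr
        _ = x := by rw [one_div, Real.rpow_rpow_inv h0 hq0.ne']
  · have h1 : CFC.rpow X q = cfc (fun x : ℝ => x ^ q) X := CFC.rpow_eq_cfc_real hX
    have h2 : ∀ k : Fin N, ((max 0 ((k : ℝ) - 1) * δ) ^ (1 / q)) ^ q = max 0 ((k : ℝ) - 1) * δ :=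
      fun k => by rw [one_div, Real.rpow_inv_rpow (by positivity) hq0.ne']
    simp_rw [h2, hQ, ← re_inner_cfc_const_mul (hθ _)]
    rw [h1, ← re_inner_cfc_sum (fun k : Fin N => (hθ k).const_mul _)]
    refine re_inner_cfc_mono hX hpow (by fun_prop) (fun x h0 hx1 => ?_) v
    calc x ^ q = ∑ k : Fin N, x ^ q * tent k (x ^ q / δ) := by
          rw [← Finset.mul_sum, hsum x h0 hx1, mul_one]
      _ ≤ _ := by
        refine Finset.sum_le_sum fun k _ => ?_
        rcases le_or_gt ((k : ℝ) + 1) (x ^ q / δ) with h | h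
        · rw [tent_eq_zero_of_ge h]; simp
        · refine mul_le_mul_of_nonneg_right ?_ (tent_nonneg _ _)
          rw [div_lt_iff₀ hδ] at h
          have h5 : (k : ℝ) - 1 ≤ max 0 ((k : ℝ) - 1) := le_max_right _ _
          nlinarith

/-- X may have no eigenvectors, so the e_i are cut into spectral pieces Q_k e_i, normalized and
weighted by their squared norms. On such a piece u, ⟨K* u, S u⟩ = ⟨u, X u⟩ is at least a_k. The
variational bound thus controls the sum of a_k^q ‖Q_k e_i‖², which is the left side up to the error
in δ. -/
theorem sum_re_inner_rpow_le {S X : H →L[ℂ] H} (hX : 0 ≤ X) {K : H →L[ℂ] H} (hK : ‖K‖ ≤ 1)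
    (hKS : K * S = X) {p : ℝ≥0∞} (hp : 1 ≤ p) (hptop : p ≠ ∞) {M : ℝ} (h : SchattenLE p S M)
    {ι : Type u} [Fintype ι] {e : ι → H} (he : Orthonormal ℂ e) :
    ∑ i, (⟪e i, (CFC.rpow X p.toReal) (e i)⟫_ℂ).re ≤ M ^ p.toReal := by
  have hq1 : 1 ≤ p.toReal := by
    rw [← ENNReal.toReal_one]; exact ENNReal.toReal_mono hptop hp
  unfold SchattenLE at h
  rw [if_neg hptop] at h
  generalize p.toReal = q at *
  have hq0 : 0 < q := by linarith
  refine le_of_forall_pos_le_add fun ε hε => ?_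
  -- Each of the vectors e_i contributes an error 2δ; the total stays below ε.
  set δ : ℝ := ε / (2 * (Fintype.card ι + 1)) with hδdef
  have hδ : 0 < δ := by positivity
  obtain ⟨N, Q, a, hQsa, ha, hQsum, hQX, hXq⟩ := exists_spectral_partition hX hq1 hδ
  -- If the piece vanishes, the inverse is 0 by convention, so both u and its weight are 0.
  let u : ι × Fin N → H := fun j => ((‖Q j.2 (e j.1)‖⁻¹ : ℝ) : ℂ) • Q j.2 (e j.1)
  let w : ι × Fin N → ℝ := fun j => ‖Q j.2 (e j.1)‖ ^ 2
  have hB : WeightedBessel w u := by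
    constructor
    · intro j
      simp only [u, norm_smul, Complex.norm_real, norm_inv, norm_norm]
      exact inv_mul_le_one
    · intro v
      have h1 : ∀ j, w j * ‖⟪u j, v⟫_ℂ‖ ^ 2 ≤ ‖⟪e j.1, Q j.2 v⟫_ℂ‖ ^ 2 := by
        intro j
        have h2 : ⟪Q j.2 (e j.1), v⟫_ℂ = ⟪e j.1, Q j.2 v⟫_ℂ := by
          nth_rewrite 1 [← hQsa]
          rw [ContinuousLinearMap.star_eq_adjoint, ContinuousLinearMap.adjoint_inner_left]
        simp only [u, w, inner_smul_left, h2, norm_mul, RCLike.norm_conj, Complex.norm_real,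
          norm_inv, norm_norm]
        rw [mul_pow, ← mul_assoc, ← mul_pow]
        refine mul_le_of_le_one_left (sq_nonneg _) (pow_le_one₀ (by positivity) mul_inv_le_one)
      calc _ ≤ ∑ j : ι × Fin N, ‖⟪e j.1, Q j.2 v⟫_ℂ‖ ^ 2 := Finset.sum_le_sum fun j _ => h1 j
        _ = ∑ k : Fin N, ∑ i, ‖⟪e i, Q k v⟫_ℂ‖ ^ 2 := by
          rw [Fintype.sum_prod_type, Finset.sum_comm]
        _ ≤ ∑ k : Fin N, ‖Q k v‖ ^ 2 := Finset.sum_le_sum fun k _ =>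
          he.sum_inner_products_le (s := Finset.univ) (Q k v)
        _ = _ := hQsum v
  -- `SchattenLE` quantifies over index types in the universe of H.
  let eqv : ULift.{u} (Fin N) ≃ Fin N := Equiv.ulift
  have key : ∑ j : ι × Fin N, w j * ‖⟪u j, X (u j)⟫_ℂ‖ ^ q ≤ M ^ q := by
    let E : ι × ULift.{u} (Fin N) ≃ ι × Fin N := Equiv.prodCongr (Equiv.refl ι) eqv
    have hB' : WeightedBessel (fun j => w (E j)) (fun j => u (E j)) :=
      ⟨fun j => hB.1 _, fun v =>
        (Equiv.sum_comp E (fun j => w j * ‖⟪u j, v⟫_ℂ‖ ^ 2)).trans_le (hB.2 v)⟩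
    have h3 := h (ι × ULift.{u} (Fin N)) (fun j => w (E j)) (fun j => u (E j))
      (fun j => star K (u (E j))) (fun j => sq_nonneg _) hB' (hB'.map (by rwa [norm_star]))
    have h4 : ∀ j, ⟪star K (u j), S (u j)⟫_ℂ = ⟪u j, X (u j)⟫_ℂ := fun j => by
      rw [ContinuousLinearMap.star_eq_adjoint, ContinuousLinearMap.adjoint_inner_left, ← hKS]
      rfl
    simp_rw [h4] at h3
    rwa [Equiv.sum_comp E (fun j => w j * ‖⟪u j, X (u j)⟫_ℂ‖ ^ q)] at h3
  have hlow : ∀ j : ι × Fin N, a j.2 ^ q * ‖Q j.2 (e j.1)‖ ^ 2 ≤ w j * ‖⟪u j, X (u j)⟫_ℂ‖ ^ q := by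
    intro j
    rw [mul_comm]
    by_cases h0 : ‖Q j.2 (e j.1)‖ = 0
    · simp [w, h0]
    refine mul_le_mul_of_nonneg_left (Real.rpow_le_rpow (ha _) ?_ hq0.le) (sq_nonneg _)
    have h5 : ⟪u j, X (u j)⟫_ℂ =
        ((‖Q j.2 (e j.1)‖⁻¹ ^ 2 : ℝ) : ℂ) * ⟪Q j.2 (e j.1), X (Q j.2 (e j.1))⟫_ℂ := by
      simp only [u, inner_smul_left, map_smul, inner_smul_right, Complex.conj_ofReal]
      push_cast; ring
    refine le_trans ?_ ((le_abs_self _).trans (Complex.abs_re_le_norm _))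
    rw [h5, Complex.re_ofReal_mul]
    have h6 := hQX j.2 (e j.1)
    rw [inv_pow, ← div_eq_inv_mul, le_div_iff₀ (by positivity)]
    exact h6
  calc ∑ i, (⟪e i, (CFC.rpow X q) (e i)⟫_ℂ).re
      ≤ ∑ i, ∑ k, (a k ^ q + 2 * δ) * ‖Q k (e i)‖ ^ 2 := Finset.sum_le_sum fun i _ => hXq _
    _ = ∑ i, ((∑ k, a k ^ q * ‖Q k (e i)‖ ^ 2) + 2 * δ) := by
      refine Finset.sum_congr rfl fun i _ => ?_
      simp_rw [add_mul]
      rw [Finset.sum_add_distrib, ← Finset.mul_sum _ _ (2 * δ), hQsum, he.norm_eq_one]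
      ring
    _ = (∑ j : ι × Fin N, a j.2 ^ q * ‖Q j.2 (e j.1)‖ ^ 2) + Fintype.card ι * (2 * δ) := by
      rw [Finset.sum_add_distrib, Fintype.sum_prod_type]
      simp
    _ ≤ M ^ q + ε := by
      refine add_le_add ((Finset.sum_le_sum fun j _ => hlow j).trans key) ?_
      rw [hδdef]
      have : (0 : ℝ) ≤ Fintype.card ι := by positivity
      rw [show (Fintype.card ι : ℝ) * (2 * (ε / (2 * (Fintype.card ι + 1)))) =
        ε * (Fintype.card ι / (Fintype.card ι + 1)) by field_simp]
      exact mul_le_of_le_one_right hε.le ((div_le_one (by positivity)).2 (by linarith))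

/-- The variational bound controls the Schatten norm. -/
theorem schattenNorm_le_of_schattenLE {p : ℝ≥0∞} (hp : 1 ≤ p) {S : H →L[ℂ] H} {M : ℝ} (hM : 0 ≤ M)
    (h : SchattenLE p S M) : schattenNorm p (fun _ : Unit => S) ≤ ENNReal.ofReal M := by
  set X := famAbs (fun _ : Unit => S) with hX
  have hnorm : ∀ v, ‖X v‖ = ‖S v‖ := fun v => by
    have := norm_famAbs_apply_sq (fun _ : Unit => S) v
    rw [Fintype.sum_unique] at this
    exact (pow_left_inj₀ (norm_nonneg _) (norm_nonneg _) two_ne_zero).1 this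
  obtain ⟨K, hK, hKS⟩ := exists_contraction_mul_eq X S fun v => (hnorm v).le
  have hpos : 0 ≤ CFC.rpow X p.toReal := CFC.rpow_nonneg
  unfold schattenNorm
  split_ifs with hptop
  · unfold SchattenLE at h
    rw [if_pos hptop] at h
    rw [← hX, ← ofReal_norm]
    refine ENNReal.ofReal_le_ofReal (le_trans ?_ h)
    exact ContinuousLinearMap.opNorm_le_bound _ (norm_nonneg _) fun v =>
      (hnorm v).trans_le (S.le_opNorm v)
  · have hq : 0 < p.toReal := ENNReal.toReal_pos (by positivity) hptop
    -- The trace is the supremum of its finite partial sums, and each of them runs over a finite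
    -- orthonormal family.
    rw [one_div, ENNReal.rpow_inv_le_iff hq, ENNReal.ofReal_rpow_of_nonneg hM hq.le, trace,
      diagSum, ENNReal.tsum_eq_iSup_sum]
    refine iSup_le fun F => ?_
    rw [← ENNReal.ofReal_sum_of_nonneg fun i _ => re_inner_nonneg hpos _]
    refine ENNReal.ofReal_le_ofReal ?_
    rw [← Finset.sum_coe_sort F]
    exact sum_re_inner_rpow_le (famAbs_nonneg _) hK hKS hp hptop h
      ((someBasis H).orthonormal.comp _ Subtype.val_injective)

end SchattenDuality

/-! ### Modulations, translations and Weyl operators. -/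

section Weyl

open FourierTransform Real

variable {d : ℕ}

theorem denseRange_toLp : DenseRange (fun φ : 𝓢(Space d, ℂ) => (φ.toLp 2 : L2 d)) :=
  SchwartzMap.denseRange_toLpCLM (F := ℂ) (p := 2) ENNReal.ofNat_ne_top

theorem clm_ext_schwartz {F : Type*} [NormedAddCommGroup F] [NormedSpace ℂ F]
    {S T : L2 d →L[ℂ] F} (h : ∀ φ : 𝓢(Space d, ℂ), S (φ.toLp 2) = T (φ.toLp 2)) : S = T :=
  ContinuousLinearMap.ext fun v =>
    congrFun (denseRange_toLp.equalizer S.continuous T.continuous (funext h)) v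

theorem eq_of_inner_schwartz {u v : L2 d}
    (h : ∀ φ : 𝓢(Space d, ℂ), ⟪φ.toLp 2, u⟫_ℂ = ⟪φ.toLp 2, v⟫_ℂ) : u = v :=
  ext_inner_left ℂ fun w =>
    congrFun (denseRange_toLp.equalizer (g := fun w : L2 d => ⟪w, u⟫_ℂ)
      (h := fun w : L2 d => ⟪w, v⟫_ℂ)
      (by fun_prop) (by fun_prop) (funext h)) w

theorem formOf_injective : Function.Injective (formOf : (L2 d →L[ℂ] L2 d) → Form d) := by
  intro S T h
  refine clm_ext_schwartz fun ψ => eq_of_inner_schwartz fun φ => ?_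
  exact congrFun (congrFun h φ) ψ

/-- The character `x ↦ exp (2π i ⟨s, x⟩)`. -/
def chi (s x : Space d) : ℂ := Complex.exp (Complex.I * ((2 * π * ⟪s, x⟫_ℝ : ℝ) : ℂ))

theorem norm_chi (s x : Space d) : ‖chi s x‖ = 1 := by
  rw [chi, mul_comm]; exact Complex.norm_exp_ofReal_mul_I _

theorem chi_add_left (s t x : Space d) : chi (s + t) x = chi s x * chi t x := by
  simp only [chi, inner_add_left, ← Complex.exp_add]
  push_cast; ring_nf

theorem chi_add_right (s x y : Space d) : chi s (x + y) = chi s x * chi s y := by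
  simp only [chi, inner_add_right, ← Complex.exp_add]
  push_cast; ring_nf

theorem chi_zero_left (x : Space d) : chi 0 x = 1 := by simp [chi]

theorem chi_zero_right (x : Space d) : chi x 0 = 1 := by simp [chi]

theorem continuous_chi : Continuous fun z : Space d × Space d => chi z.1 z.2 := by
  unfold chi; fun_prop

theorem hasTemperateGrowth_cexp_I_mul :
    (fun t : ℝ => Complex.exp (Complex.I * t)).HasTemperateGrowth := by
  have hd : ∀ n : ℕ, iteratedDeriv n (fun t : ℝ => Complex.exp (Complex.I * t)) =
      fun t : ℝ => Complex.I ^ n * Complex.exp (Complex.I * t) := by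
    intro n
    induction n with
    | zero => simp
    | succ n ih =>
      rw [iteratedDeriv_succ, ih]
      ext t
      have h1 : HasDerivAt (fun t : ℝ => Complex.I * (t : ℂ)) Complex.I t := by
        simpa using (Complex.ofRealCLM.hasDerivAt (x := t)).const_mul Complex.I
      rw [(h1.cexp.const_mul (Complex.I ^ n)).deriv]
      ring
  refine ⟨?_, fun n => ⟨0, 1, fun t => ?_⟩⟩
  · exact Complex.contDiff_exp.comp (contDiff_const.mul Complex.ofRealCLM.contDiff)
  · rw [norm_iteratedFDeriv_eq_norm_iteratedDeriv, hd, norm_mul, norm_pow, Complex.norm_I,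
      mul_comm Complex.I, Complex.norm_exp_ofReal_mul_I]
    simp

theorem hasTemperateGrowth_chi (s : Space d) : (chi s).HasTemperateGrowth := by
  have h1 : (fun x : Space d => 2 * π * ⟪s, x⟫_ℝ).HasTemperateGrowth :=
    (Function.HasTemperateGrowth.const (2 * π)).mul (innerSL ℝ s).hasTemperateGrowth
  exact hasTemperateGrowth_cexp_I_mul.comp h1

/-- Modulation of a Schwartz function. -/
def modS (s : Space d) (φ : 𝓢(Space d, ℂ)) : 𝓢(Space d, ℂ) := SchwartzMap.smulLeftCLM ℂ (chi s) φ

theorem modS_apply (s : Space d) (φ : 𝓢(Space d, ℂ)) (x : Space d) :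
    modS s φ x = chi s x * φ x := by
  simp [modS, SchwartzMap.smulLeftCLM_apply_apply (hasTemperateGrowth_chi s)]

/-- Translation of a Schwartz function. -/
def transS (r : Space d) (φ : 𝓢(Space d, ℂ)) : 𝓢(Space d, ℂ) := SchwartzMap.compSubConstCLM ℂ r φ

theorem transS_apply (r : Space d) (φ : 𝓢(Space d, ℂ)) (x : Space d) :
    transS r φ x = φ (x - r) := rfl

theorem memLp_chi_mul (s : Space d) (ψ : L2 d) :
    MemLp (fun x => chi s x * ψ x) 2 (volume : Measure (Space d)) := by
  refine (Lp.memLp ψ).of_le_mul (c := 1) (AEStronglyMeasurable.mul ?_ (Lp.aestronglyMeasurable ψ))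
    (.of_forall fun x => ?_)
  · exact (continuous_chi.comp (Continuous.prodMk_right s)).aestronglyMeasurable
  · rw [norm_mul, norm_chi]

/-- Modulation on `L²`. -/
def modI (s : Space d) : L2 d →ₗᵢ[ℂ] L2 d where
  toFun ψ := (memLp_chi_mul s ψ).toLp _
  map_add' ψ ψ' := by
    rw [← MemLp.toLp_add]
    refine MemLp.toLp_congr _ _ ?_
    filter_upwards [Lp.coeFn_add ψ ψ'] with x hx
    change chi s x * (ψ + ψ' : L2 d) x = chi s x * ψ x + chi s x * ψ' x
    rw [hx, Pi.add_apply, mul_add]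
  map_smul' c ψ := by
    rw [RingHom.id_apply, ← MemLp.toLp_const_smul]
    refine MemLp.toLp_congr _ _ ?_
    filter_upwards [Lp.coeFn_smul c ψ] with x hx
    change chi s x * (c • ψ : L2 d) x = c • (chi s x * ψ x)
    rw [hx, Pi.smul_apply, smul_eq_mul, smul_eq_mul, mul_left_comm]
  norm_map' ψ := by
    change ‖(memLp_chi_mul s ψ).toLp _‖ = ‖ψ‖
    rw [Lp.norm_toLp, Lp.norm_def]
    congr 1
    refine eLpNorm_congr_norm_ae (.of_forall fun x => ?_)
    rw [norm_mul, norm_chi, one_mul]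

theorem coeFn_modI (s : Space d) (ψ : L2 d) : modI s ψ =ᵐ[volume] fun x => chi s x * ψ x :=
  MemLp.coeFn_toLp (memLp_chi_mul s ψ)

theorem modI_toLp (s : Space d) (φ : 𝓢(Space d, ℂ)) :
    modI s (φ.toLp 2) = (modS s φ).toLp 2 := by
  refine Lp.ext ?_
  filter_upwards [coeFn_modI s (φ.toLp 2), φ.coeFn_toLp 2, (modS s φ).coeFn_toLp 2]
    with x h1 h2 h3
  rw [h1, h2, h3, modS_apply]

/-- Translation on `L²`. -/
def transI (r : Space d) : L2 d →ₗᵢ[ℂ] L2 d :=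
  Lp.compMeasurePreservingₗᵢ ℂ (fun x => x - r) (measurePreserving_sub_right volume r)

theorem coeFn_transI (r : Space d) (ψ : L2 d) : transI r ψ =ᵐ[volume] fun x => ψ (x - r) :=
  Lp.coeFn_compMeasurePreserving ψ _

theorem transI_toLp (r : Space d) (φ : 𝓢(Space d, ℂ)) :
    transI r (φ.toLp 2) = (transS r φ).toLp 2 := by
  refine Lp.ext ?_
  filter_upwards [coeFn_transI r (φ.toLp 2), (transS r φ).coeFn_toLp 2,
    (measurePreserving_sub_right volume r).quasiMeasurePreserving.ae
      (φ.coeFn_toLp 2 volume)]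
    with x h1 h2 h3
  rw [h1, h2, h3, transS_apply]

/-- Modulation on `L²` as a bounded operator. -/
def Mod (s : Space d) : L2 d →L[ℂ] L2 d := (modI s).toContinuousLinearMap

/-- Translation on `L²` as a bounded operator. -/
def Trans (r : Space d) : L2 d →L[ℂ] L2 d := (transI r).toContinuousLinearMap

theorem Mod_toLp (s : Space d) (φ : 𝓢(Space d, ℂ)) : Mod s (φ.toLp 2) = (modS s φ).toLp 2 :=
  modI_toLp s φ

theorem Trans_toLp (s : Space d) (φ : 𝓢(Space d, ℂ)) :
    Trans s (φ.toLp 2) = (transS s φ).toLp 2 := transI_toLp s φ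

theorem norm_Mod_apply (s : Space d) (ψ : L2 d) : ‖Mod s ψ‖ = ‖ψ‖ := (modI s).norm_map ψ

theorem norm_Trans_apply (s : Space d) (ψ : L2 d) : ‖Trans s ψ‖ = ‖ψ‖ := (transI s).norm_map ψ

theorem Mod_add (s t : Space d) : Mod (s + t) = Mod s * Mod t := by
  refine clm_ext_schwartz fun φ => ?_
  rw [mul_apply_eq_comp, Mod_toLp, Mod_toLp, Mod_toLp]
  congr 1; ext x
  rw [modS_apply, modS_apply, modS_apply, chi_add_left, mul_assoc]

theorem Mod_zero : Mod (0 : Space d) = 1 := by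
  refine clm_ext_schwartz fun φ => ?_
  rw [Mod_toLp, one_apply_eq_self]
  congr 1; ext x
  rw [modS_apply, chi_zero_left, one_mul]

theorem Trans_add (s t : Space d) : Trans (s + t) = Trans s * Trans t := by
  refine clm_ext_schwartz fun φ => ?_
  rw [mul_apply_eq_comp, Trans_toLp, Trans_toLp, Trans_toLp]
  congr 1; ext x
  rw [transS_apply, transS_apply, transS_apply, sub_sub]

theorem Trans_zero : Trans (0 : Space d) = 1 := by
  refine clm_ext_schwartz fun φ => ?_
  rw [Trans_toLp, one_apply_eq_self]
  congr 1; ext x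
  rw [transS_apply, sub_zero]

/-- The Weyl form of the canonical commutation relations. -/
theorem Mod_mul_Trans (s r : Space d) : Mod s * Trans r = chi s r • (Trans r * Mod s) := by
  refine clm_ext_schwartz fun φ => ?_
  rw [smul_apply, mul_apply_eq_comp, mul_apply_eq_comp, Mod_toLp, Trans_toLp, Mod_toLp, Trans_toLp]
  change _ = chi s r • (SchwartzMap.toLpCLM ℂ ℂ 2 volume) _
  rw [← map_smul]
  change _ = (chi s r • transS r (modS s φ)).toLp 2 volume
  congr 1; ext x
  rw [modS_apply, transS_apply, smul_apply, transS_apply, modS_apply, smul_eq_mul,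
    ← mul_assoc, ← chi_add_right, add_sub_cancel]

theorem toLp_add' (φ ψ : 𝓢(Space d, ℂ)) :
    ((φ + ψ).toLp 2 volume : L2 d) = φ.toLp 2 volume + ψ.toLp 2 volume :=
  map_add (SchwartzMap.toLpCLM ℂ ℂ 2 volume) φ ψ

theorem toLp_sub' (φ ψ : 𝓢(Space d, ℂ)) :
    ((φ - ψ).toLp 2 volume : L2 d) = φ.toLp 2 volume - ψ.toLp 2 volume :=
  map_sub (SchwartzMap.toLpCLM ℂ ℂ 2 volume) φ ψ

theorem toLp_smul' (c : ℂ) (φ : 𝓢(Space d, ℂ)) :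
    ((c • φ).toLp 2 volume : L2 d) = c • φ.toLp 2 volume :=
  map_smul (SchwartzMap.toLpCLM ℂ ℂ 2 volume) c φ

theorem toLp_sum' {κ : Type*} (s : Finset κ) (φ : κ → 𝓢(Space d, ℂ)) :
    ((∑ k ∈ s, φ k).toLp 2 volume : L2 d) = ∑ k ∈ s, (φ k).toLp 2 volume :=
  map_sum (SchwartzMap.toLpCLM ℂ ℂ 2 volume) φ s

theorem inner_mulX (j : Fin d) (φ ψ : 𝓢(Space d, ℂ)) :
    ⟪((mulX j φ).toLp 2 : L2 d), ψ.toLp 2⟫_ℂ = ⟪(φ.toLp 2 : L2 d), (mulX j ψ).toLp 2⟫_ℂ := by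
  rw [SchwartzMap.inner_toL2_toL2_eq _ _ volume, SchwartzMap.inner_toL2_toL2_eq _ _ volume]
  refine integral_congr_ae (.of_forall fun x => ?_)
  simp only [mulX_apply, RCLike.inner_apply, map_mul, Complex.conj_ofReal]
  ring

theorem inner_dX (j : Fin d) (φ ψ : 𝓢(Space d, ℂ)) :
    ⟪((dX j φ).toLp 2 : L2 d), ψ.toLp 2⟫_ℂ = -⟪(φ.toLp 2 : L2 d), (dX j ψ).toLp 2⟫_ℂ := by
  rw [SchwartzMap.inner_toL2_toL2_eq _ _ volume, SchwartzMap.inner_toL2_toL2_eq _ _ volume]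
  have h := SchwartzMap.integral_bilinear_lineDerivOp_right_eq_neg_left (μ := volume) φ ψ
    ((ContinuousLinearMap.mul ℝ ℂ).comp (Complex.conjCLE : ℂ →L[ℝ] ℂ))
    (EuclideanSpace.single j (1 : ℝ) : Space d)
  simp only [ContinuousLinearMap.comp_apply, ContinuousLinearEquiv.coe_coe, Complex.conjCLE_apply,
    ContinuousLinearMap.mul_apply'] at h
  simp only [RCLike.inner_apply, dX]
  rw [eq_neg_iff_add_eq_zero]
  simp_rw [mul_comm _ ((starRingEnd ℂ) _)]
  rw [h]; ring

theorem hasDerivAt_chi_line (s x : Space d) (j : Fin d) :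
    HasDerivAt (fun t : ℝ => chi s (x + t • EuclideanSpace.single j (1 : ℝ)))
      (2 * π * Complex.I * s j * chi s x) 0 := by
  have h1 : ∀ t : ℝ, chi s (x + t • EuclideanSpace.single j (1 : ℝ)) =
      chi s x * Complex.exp (t * (2 * π * Complex.I * s j)) := fun t => by
    rw [chi_add_right]
    congr 1
    rw [chi, inner_smul_right, EuclideanSpace.inner_single_right]
    simp only [one_mul, conj_trivial]
    push_cast; ring_nf
  simp_rw [h1]
  have h2 : HasDerivAt (fun t : ℝ => (t : ℂ) * (2 * π * Complex.I * s j))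
      (2 * π * Complex.I * s j) 0 := by
    simpa using (Complex.ofRealCLM.hasDerivAt (x := 0)).mul_const (2 * π * Complex.I * s j : ℂ)
  convert! h2.cexp.const_mul (chi s x) using 1
  simp; ring

theorem dX_modS (j : Fin d) (s : Space d) (φ : 𝓢(Space d, ℂ)) :
    dX j (modS s φ) = modS s (dX j φ) + (2 * π * Complex.I * s j) • modS s φ := by
  ext x
  rw [add_apply, smul_apply, modS_apply, modS_apply, dX, dX,
    SchwartzMap.lineDerivOp_apply, SchwartzMap.lineDerivOp_apply, lineDeriv, lineDeriv]
  have h1 : HasDerivAt (fun t : ℝ => φ (x + t • EuclideanSpace.single j (1 : ℝ)))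
      (deriv (fun t : ℝ => φ (x + t • EuclideanSpace.single j (1 : ℝ))) 0) 0 := by
    refine DifferentiableAt.hasDerivAt ?_
    have := φ.differentiable
    fun_prop
  simp_rw [modS_apply]
  have h2 := ((hasDerivAt_chi_line s x j).mul h1).deriv
  simp only [Pi.mul_def] at h2
  rw [h2]
  simp only [zero_smul, add_zero, smul_eq_mul]
  ring

theorem dX_transS (j : Fin d) (r : Space d) (φ : 𝓢(Space d, ℂ)) :
    dX j (transS r φ) = transS r (dX j φ) := by
  ext x
  rw [transS_apply, dX, dX,
    SchwartzMap.lineDerivOp_apply, SchwartzMap.lineDerivOp_apply, lineDeriv, lineDeriv]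
  simp_rw [transS_apply, add_sub_right_comm]

theorem mulX_modS (j : Fin d) (s : Space d) (φ : 𝓢(Space d, ℂ)) :
    mulX j (modS s φ) = modS s (mulX j φ) := by
  ext x
  simp only [mulX_apply, modS_apply]; ring

theorem mulX_transS (j : Fin d) (r : Space d) (φ : 𝓢(Space d, ℂ)) :
    mulX j (transS r φ) = transS r (mulX j φ) + (r j : ℂ) • transS r φ := by
  ext x
  rw [add_apply, smul_apply]
  simp only [mulX_apply, transS_apply, smul_eq_mul, PiLp.sub_apply]
  push_cast; ring

/-- The Weyl operator `ψ ↦ exp (2π i ⟨s, ·⟩) ψ (· - r)` for `z = (r, s)`. -/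
def W (z : Space d × Space d) : L2 d →L[ℂ] L2 d := Mod z.2 * Trans z.1

/-- The Weyl operator on Schwartz functions. -/
def WS (z : Space d × Space d) (φ : 𝓢(Space d, ℂ)) : 𝓢(Space d, ℂ) := modS z.2 (transS z.1 φ)

theorem W_toLp (z : Space d × Space d) (φ : 𝓢(Space d, ℂ)) :
    W z (φ.toLp 2) = (WS z φ).toLp 2 := by
  rw [W, mul_apply_eq_comp, Trans_toLp, Mod_toLp, WS]

theorem norm_W_apply (z : Space d × Space d) (ψ : L2 d) : ‖W z ψ‖ = ‖ψ‖ := by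
  rw [W, mul_apply_eq_comp, norm_Mod_apply, norm_Trans_apply]

theorem modS_add (s : Space d) (φ ψ : 𝓢(Space d, ℂ)) : modS s (φ + ψ) = modS s φ + modS s ψ :=
  map_add _ _ _

theorem modS_smul (s : Space d) (c : ℂ) (φ : 𝓢(Space d, ℂ)) : modS s (c • φ) = c • modS s φ :=
  map_smul _ _ _

/-- The eigenvalue of the component `a` of the quantum gradient on the Weyl operators. -/
def symb (ħ : ℝ) : Fin d ⊕ Fin d → Space d × Space d → ℂ
  | .inl j, z => (Complex.I * ħ)⁻¹ * z.1 j
  | .inr j, z => 2 * π * Complex.I * z.2 j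

/-- Commuting x_j past a translation produces r_j, and commuting ∂_j past a modulation produces 2πi
s_j. This is what turns the quantum gradient into multiplication on symbols. -/
theorem formD_formOf_W (ħ : ℝ) (a : Fin d ⊕ Fin d) (z : Space d × Space d) (φ ψ : 𝓢(Space d, ℂ)) :
    formD ħ a (formOf (W z)) φ ψ = symb ħ a z * formOf (W z) φ ψ := by
  rcases a with j | j
  · simp only [formD, formOf, symb, W_toLp, inner_mulX, ← inner_sub_right, ← toLp_sub']
    rw [WS, WS, mulX_modS, mulX_transS, modS_add, modS_smul, add_sub_cancel_left, toLp_smul',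
      inner_smul_right]
    ring
  · simp only [formD, formOf, symb, W_toLp, inner_dX, neg_neg, ← inner_sub_right, ← toLp_sub']
    rw [WS, WS, dX_modS, dX_transS, add_sub_cancel_left, toLp_smul', inner_smul_right]

end Weyl

/-! ### Weak operator integrals, unitary groups and Duhamel's formula. -/

section Groups

open Real

/-- The weak integral of a bounded strongly measurable family of operators. -/
theorem exists_integral_operator {H Ω : Type*} [NormedAddCommGroup H] [InnerProductSpace ℂ H]
    [CompleteSpace H] [MeasurableSpace Ω] {μ : Measure Ω} {s : Ω → H →L[ℂ] H}
    (hs : ∀ v, AEStronglyMeasurable (fun ω => s ω v) μ) {b : Ω → ℝ} (hb : Integrable b μ)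
    (hsb : ∀ᵐ ω ∂μ, ‖s ω‖ ≤ b ω) :
    ∃ R : H →L[ℂ] H, (∀ f v, Integrable (fun ω => ⟪f, s ω v⟫_ℂ) μ) ∧
      ∀ f v, ⟪f, R v⟫_ℂ = ∫ ω, ⟪f, s ω v⟫_ℂ ∂μ := by
  have hint : ∀ v, Integrable (fun ω => s ω v) μ := fun v =>
    (hb.mul_const ‖v‖).mono' (hs v) (hsb.mono fun ω h => (s ω).le_of_opNorm_le h v)
  refine ⟨LinearMap.mkContinuous
    { toFun := fun v => ∫ ω, s ω v ∂μ
      map_add' := fun v w => by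
        simp_rw [map_add]; exact integral_add (hint v) (hint w)
      map_smul' := fun c v => by
        simp_rw [map_smul]; exact integral_smul c _ } (∫ ω, b ω ∂μ) fun v => ?_, fun f v => ?_,
    fun f v => ?_⟩
  · change ‖∫ ω, s ω v ∂μ‖ ≤ _
    rw [← integral_mul_const]
    exact norm_integral_le_of_norm_le (hb.mul_const _)
      (hsb.mono fun ω h => (s ω).le_of_opNorm_le h v)
  · exact (innerSL ℂ f).integrable_comp (hint v)
  · exact ((innerSL ℂ f).integral_comp_comm (hint v)).symm

/-- A unitary one-parameter group preserving a core parametrized by `J : D → H`, on which its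
generator is `G`. -/
structure CoreGroup {H D : Type*} [NormedAddCommGroup H] [InnerProductSpace ℂ H] (J : D → H) where
  /-- The group. -/
  U : ℝ → H →L[ℂ] H
  /-- Its action on the core. -/
  u : ℝ → D → D
  /-- The generator. -/
  G : D → D
  norm_U : ∀ t ψ, ‖U t ψ‖ = ‖ψ‖
  U_zero : U 0 = 1
  U_add : ∀ s t, U (s + t) = U s * U t
  U_J : ∀ t φ, U t (J φ) = J (u t φ)
  G_u : ∀ t φ, G (u t φ) = u t (G φ)
  deriv_zero : ∀ φ : D,
    HasDerivAt (fun t => U t (J φ)) (J (G φ)) 0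

namespace CoreGroup

variable {H : Type*} [NormedAddCommGroup H] [InnerProductSpace ℂ H] {D : Type*} {J : D → H}
  (𝒢 : CoreGroup J)

theorem inner_U_U (t : ℝ) (φ ψ : H) : ⟪𝒢.U t φ, 𝒢.U t ψ⟫_ℂ = ⟪φ, ψ⟫_ℂ :=
  (LinearMap.norm_map_iff_inner_map_map (𝒢.U t)).1 (𝒢.norm_U t) φ ψ

theorem inner_U_neg (t : ℝ) (φ ψ : H) : ⟪𝒢.U (-t) φ, ψ⟫_ℂ = ⟪φ, 𝒢.U t ψ⟫_ℂ := by
  rw [← 𝒢.inner_U_U t, ← mul_apply_eq_comp, ← 𝒢.U_add, add_neg_cancel, 𝒢.U_zero]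
  rfl

theorem hasDerivAt (φ : D) (t : ℝ) :
    HasDerivAt (fun t => 𝒢.U t (J φ)) (𝒢.U t (J (𝒢.G φ))) t := by
  have h1 : HasDerivAt (fun s => 𝒢.U t (𝒢.U (s - t) (J φ))) (𝒢.U t (J (𝒢.G φ))) t := by
    have h0 := 𝒢.deriv_zero φ
    rw [← sub_self t] at h0
    have h2 := h0.comp_sub_const t t
    have h3 := ((𝒢.U t).restrictScalars ℝ).hasFDerivAt.comp_hasDerivAt t h2
    exact h3
  refine h1.congr_of_eventuallyEq (.of_forall fun s => ?_)
  change _ = (𝒢.U t * 𝒢.U (s - t)) _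
  rw [← 𝒢.U_add, add_sub_cancel]

/-- Mean value inequality: along the orbit, the derivative has the constant norm ‖J (G φ)‖. -/
theorem norm_U_one_sub_le (φ : D) :
    ‖𝒢.U 1 (J φ) - J φ‖ ≤ ‖(J (𝒢.G φ))‖ := by
  have h := norm_image_sub_le_of_norm_deriv_le_segment_01' (f := fun t => 𝒢.U t (J φ))
    (fun t _ => (𝒢.hasDerivAt φ t).hasDerivWithinAt) (C := ‖(J (𝒢.G φ))‖)
    (fun t _ => (𝒢.norm_U t _).le)
  rwa [𝒢.U_zero] at h

theorem norm_U_le (t : ℝ) : ‖𝒢.U t‖ ≤ 1 :=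
  ContinuousLinearMap.opNorm_le_bound _ zero_le_one fun ψ => by rw [𝒢.norm_U, one_mul]

theorem continuous_U (hJ : DenseRange J) (ψ : H) : Continuous fun t => 𝒢.U t ψ := by
  rw [Metric.continuous_iff]
  intro t ε hε
  obtain ⟨φ, hφ⟩ := Metric.denseRange_iff.1 hJ ψ (ε / 3) (by positivity)
  obtain ⟨δ, hδ, h⟩ := Metric.continuousAt_iff.1 (𝒢.hasDerivAt φ t).continuousAt (ε / 3)
    (by positivity)
  refine ⟨δ, hδ, fun s hs => ?_⟩
  have h1 : ∀ s, dist (𝒢.U s ψ) (𝒢.U s (J φ)) < ε / 3 := fun s => by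
    rw [dist_eq_norm, ← map_sub, 𝒢.norm_U, ← dist_eq_norm]; exact hφ
  have h2 := h1 t
  rw [dist_comm] at h2
  calc _ ≤ _ := dist_triangle4 _ (𝒢.U s (J φ)) (𝒢.U t (J φ)) _
    _ < ε / 3 + ε / 3 + ε / 3 := by linarith [h1 s, h hs]
    _ = ε := by ring

/-- If `S` represents the commutator of the generator with `B`, then the commutator of the group
with `B` is an integral. -/
theorem exists_integral [CompleteSpace H] (hJ : DenseRange J) {B S : H →L[ℂ] H}
    (hS : ∀ φ ψ, ⟪J φ, S (J ψ)⟫_ℂ = -⟪J (𝒢.G φ), B (J ψ)⟫_ℂ - ⟪J φ, B (J (𝒢.G ψ))⟫_ℂ) (f g : H) :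
    Integrable (fun t => ⟪f, (𝒢.U t * S * 𝒢.U (1 - t)) g⟫_ℂ) (volume.restrict (Set.Ioc 0 1)) ∧
    ⟪f, (𝒢.U 1 * B - B * 𝒢.U 1) g⟫_ℂ =
      ∫ t in Set.Ioc (0 : ℝ) 1, ⟪f, (𝒢.U t * S * 𝒢.U (1 - t)) g⟫_ℂ := by
  have hcont : ∀ h k : H, Continuous fun t => ⟪h, (𝒢.U t * S * 𝒢.U (1 - t)) k⟫_ℂ := by
    intro h k
    have h1 : ∀ t, ⟪h, (𝒢.U t * S * 𝒢.U (1 - t)) k⟫_ℂ = ⟪𝒢.U (-t) h, S (𝒢.U (1 - t) k)⟫_ℂ :=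
      fun t => (𝒢.inner_U_neg t _ _).symm
    simp_rw [h1]
    exact Continuous.inner ((𝒢.continuous_U hJ h).comp continuous_neg)
      (S.continuous.comp ((𝒢.continuous_U hJ k).comp (continuous_const.sub continuous_id)))
  have hmeas : ∀ v, AEStronglyMeasurable (fun t => (𝒢.U t * S * 𝒢.U (1 - t)) v)
      (volume.restrict (Set.Ioc (0 : ℝ) 1)) := by
    intro v
    refine Continuous.aestronglyMeasurable ?_
    rw [Metric.continuous_iff]
    intro t ε hε
    have hk : Continuous fun s => S (𝒢.U (1 - s) v) :=
      S.continuous.comp ((𝒢.continuous_U hJ v).comp (continuous_const.sub continuous_id))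
    obtain ⟨δ, hδ, h⟩ := Metric.continuous_iff.1 hk t (ε / 2) (by positivity)
    obtain ⟨δ', hδ', h'⟩ := Metric.continuous_iff.1
      (𝒢.continuous_U hJ (S (𝒢.U (1 - t) v))) t (ε / 2)
      (by positivity)
    refine ⟨min δ δ', by positivity, fun s hs => ?_⟩
    calc dist (𝒢.U s (S (𝒢.U (1 - s) v))) (𝒢.U t (S (𝒢.U (1 - t) v)))
        ≤ dist (𝒢.U s (S (𝒢.U (1 - s) v))) (𝒢.U s (S (𝒢.U (1 - t) v))) +
          dist (𝒢.U s (S (𝒢.U (1 - t) v))) (𝒢.U t (S (𝒢.U (1 - t) v))) := dist_triangle _ _ _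
      _ < ε / 2 + ε / 2 := by
        refine add_lt_add ?_ (h' s (hs.trans_le (min_le_right _ _)))
        rw [dist_eq_norm, ← map_sub, 𝒢.norm_U, ← dist_eq_norm]
        exact h s (hs.trans_le (min_le_left _ _))
      _ = ε := by ring
  -- Both sides of the formula are bounded operators once the integral is realized as R, so it
  -- suffices to compare them on the core, where the group is differentiable.
  obtain ⟨R, hRint, hR⟩ := exists_integral_operator hmeas (b := fun _ => ‖S‖)
    (integrable_const _) (.of_forall fun t => by
      calc ‖𝒢.U t * S * 𝒢.U (1 - t)‖ ≤ ‖𝒢.U t * S‖ * ‖𝒢.U (1 - t)‖ := norm_mul_le _ _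
        _ ≤ (‖𝒢.U t‖ * ‖S‖) * ‖𝒢.U (1 - t)‖ := by gcongr; exact norm_mul_le _ _
        _ ≤ (1 * ‖S‖) * 1 := by gcongr <;> exact 𝒢.norm_U_le _
        _ = ‖S‖ := by ring)
  refine ⟨hRint f g, ?_⟩
  rw [← hR]
  congr 1
  revert g
  refine fun g => congrFun (hJ.equalizer (g := (𝒢.U 1 * B - B * 𝒢.U 1)) (h := R)
    (ContinuousLinearMap.continuous _) R.continuous (funext fun ψ => ?_)) g
  refine ext_inner_left ℂ fun w => congrFun (hJ.equalizer
    (g := fun w => ⟪w, (𝒢.U 1 * B - B * 𝒢.U 1) (J ψ)⟫_ℂ) (h := fun w => ⟪w, R (J ψ)⟫_ℂ)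
    (by fun_prop) (by fun_prop) (funext fun φ => ?_)) w
  change ⟪J φ, (𝒢.U 1 * B - B * 𝒢.U 1) (J ψ)⟫_ℂ = ⟪J φ, R (J ψ)⟫_ℂ
  rw [hR, ← intervalIntegral.integral_of_le zero_le_one]
  have hneg : ∀ t, HasDerivAt (fun t => 𝒢.U (-t) (J φ)) (-𝒢.U (-t) (J (𝒢.G φ))) t :=
    fun t => by
      have := (𝒢.hasDerivAt φ (-t)).scomp t (hasDerivAt_neg t)
      rw [neg_one_smul] at this
      exact this
  have hone : ∀ t, HasDerivAt (fun t => 𝒢.U (1 - t) (J ψ))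
      (-𝒢.U (1 - t) (J (𝒢.G ψ))) t := fun t => by
    have := (𝒢.hasDerivAt ψ (1 - t)).scomp t ((hasDerivAt_id t).const_sub 1)
    rw [neg_one_smul] at this
    exact this
  -- Duhamel's formula: this function of t equals ⟨φ, B U(1) ψ⟩ at 0 and ⟨φ, U(1) B ψ⟩ at 1, and its
  -- derivative is the commutator with the generator, represented by S.
  have hder : ∀ t, HasDerivAt
      (fun t => ⟪𝒢.U (-t) (J φ), B (𝒢.U (1 - t) (J ψ))⟫_ℂ)
      ⟪J φ, (𝒢.U t * S * 𝒢.U (1 - t)) (J ψ)⟫_ℂ t := by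
    intro t
    have hB := (B.restrictScalars ℝ).hasFDerivAt.comp_hasDerivAt t (hone t)
    have h1 := (hneg t).inner ℂ hB
    convert! h1 using 1
    change ⟪J φ, 𝒢.U t (S (𝒢.U (1 - t) (J ψ)))⟫_ℂ =
      ⟪𝒢.U (-t) (J φ), B (-𝒢.U (1 - t) (J (𝒢.G ψ)))⟫_ℂ +
      ⟪-𝒢.U (-t) (J (𝒢.G φ)), B (𝒢.U (1 - t) (J ψ))⟫_ℂ
    rw [← 𝒢.inner_U_neg, 𝒢.U_J, 𝒢.U_J, 𝒢.U_J, 𝒢.U_J, ← 𝒢.G_u, ← 𝒢.G_u,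
      map_neg, inner_neg_left, inner_neg_right]
    have := hS (𝒢.u (-t) φ) (𝒢.u (1 - t) ψ)
    rw [this]; ring
  rw [intervalIntegral.integral_eq_sub_of_hasDerivAt (fun t _ => hder t)
    ((hcont _ _).intervalIntegrable _ _), 𝒢.inner_U_neg]
  simp [𝒢.U_zero]

/-- The Duhamel integrand U(t) S U(1-t) inherits the bound of S, and the interval of integration has
length 1. -/
theorem schattenLE [CompleteSpace H] (hJ : DenseRange J) {p : ℝ≥0∞} (hp : 1 ≤ p) {B S : H →L[ℂ] H}
    (hS : ∀ φ ψ, ⟪J φ, S (J ψ)⟫_ℂ = -⟪J (𝒢.G φ), B (J ψ)⟫_ℂ - ⟪J φ, B (J (𝒢.G ψ))⟫_ℂ)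
    {M : ℝ} (hM : 0 ≤ M)
    (h : SchattenLE p S M) : SchattenLE p (𝒢.U 1 * B - B * 𝒢.U 1) M := by
  have := SchattenLE.of_integral hp (μ := volume.restrict (Set.Ioc (0 : ℝ) 1))
    (fun f e => (𝒢.exists_integral hJ hS f e).1) (fun f e => (𝒢.exists_integral hJ hS f e).2)
    (b := fun _ => M) (integrable_const _) (fun _ => hM)
    (fun t => h.mul_mul (𝒢.norm_U_le t) (𝒢.norm_U_le _))
  simpa using this

end CoreGroup

end Groups

/-! ### The groups of modulations and of translations. -/

section WeylGroups

open FourierTransform Real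

variable {d : ℕ}

/-- Taylor's formula when |θ| ≤ 1, and the triangle inequality with 2 + |θ| ≤ 3 θ² otherwise. -/
theorem norm_cexp_sub_one_sub_le (θ : ℝ) :
    ‖Complex.exp (Complex.I * θ) - 1 - Complex.I * θ‖ ≤ 3 * θ ^ 2 := by
  rcases le_or_gt |θ| 1 with h | h
  · have h1 : ‖Complex.I * (θ : ℂ)‖ ≤ 1 := by simpa using h
    refine (Complex.norm_exp_sub_one_sub_id_le h1).trans ?_
    simp only [norm_mul, Complex.norm_I, one_mul, Complex.norm_real, Real.norm_eq_abs, sq_abs]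
    nlinarith [sq_nonneg θ]
  · have h1 : ‖Complex.exp (Complex.I * θ)‖ = 1 := by
      rw [mul_comm]; exact Complex.norm_exp_ofReal_mul_I _
    calc _ ≤ ‖Complex.exp (Complex.I * θ)‖ + ‖(1 : ℂ)‖ + ‖Complex.I * θ‖ :=
          (norm_sub_le _ _).trans (add_le_add_left (norm_sub_le _ _) _)
      _ = 2 + |θ| := by rw [h1]; simp; norm_num
      _ ≤ 3 * θ ^ 2 := by rw [← sq_abs]; nlinarith

/-- The inclusion of the Schwartz functions into `L²`. -/
abbrev schwartzL2 (d : ℕ) : 𝓢(Space d, ℂ) → L2 d := fun φ => φ.toLp 2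

/-- The generator of the modulations `t ↦ Mod (t s)`. -/
def modG (s : Space d) (φ : 𝓢(Space d, ℂ)) : 𝓢(Space d, ℂ) :=
  ∑ j, (2 * π * Complex.I * s j) • mulX j φ

theorem modG_apply (s : Space d) (φ : 𝓢(Space d, ℂ)) (x : Space d) :
    modG s φ x = Complex.I * ((2 * π * ⟪s, x⟫_ℝ : ℝ) : ℂ) * φ x := by
  rw [modG, sum_apply, PiLp.inner_apply]
  simp only [smul_apply, mulX_apply, smul_eq_mul, RCLike.inner_apply, conj_trivial]
  push_cast
  rw [Finset.mul_sum, Finset.mul_sum, Finset.sum_mul]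
  refine Finset.sum_congr rfl fun j _ => ?_
  ring

/-- The second-order remainder is dominated by t² times a fixed Schwartz function, so that
differentiability in L² follows. -/
theorem norm_modS_sub_sub_le (s : Space d) (t : ℝ) (φ : 𝓢(Space d, ℂ)) (x : Space d) :
    ‖(modS (t • s) φ - φ - ((t : ℝ) : ℂ) • modG s φ) x‖ ≤
      ‖(((3 * t ^ 2 : ℝ) : ℂ) • modG s (modG s φ)) x‖ := by
  rw [sub_apply, sub_apply, smul_apply, smul_apply, modG_apply, modG_apply, modG_apply,
    modS_apply, smul_eq_mul, smul_eq_mul, chi, real_inner_smul_left,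
    show 2 * π * (t * ⟪s, x⟫_ℝ) = t * (2 * π * ⟪s, x⟫_ℝ) by ring]
  generalize 2 * π * ⟪s, x⟫_ℝ = θ
  have h4 := norm_cexp_sub_one_sub_le (t * θ)
  calc _ = ‖Complex.exp (Complex.I * ((t * θ : ℝ) : ℂ)) - 1 - Complex.I * ((t * θ : ℝ) : ℂ)‖ *
        ‖φ x‖ := by
        rw [← norm_mul]; congr 1; push_cast; ring
    _ ≤ 3 * (t * θ) ^ 2 * ‖φ x‖ := by gcongr
    _ = _ := by
      simp only [norm_mul, Complex.norm_I, Complex.norm_real, Real.norm_eq_abs, one_mul]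
      rw [abs_of_pos (by norm_num : (0 : ℝ) < 3), abs_of_nonneg (sq_nonneg t), ← mul_assoc |θ|,
        abs_mul_abs_self]
      ring

theorem norm_toLp_le_norm_toLp {φ ψ : 𝓢(Space d, ℂ)} (h : ∀ x, ‖φ x‖ ≤ ‖ψ x‖) :
    ‖(φ.toLp 2 volume : L2 d)‖ ≤ ‖(ψ.toLp 2 volume : L2 d)‖ := by
  refine Lp.norm_le_norm_of_ae_le ?_
  filter_upwards [SchwartzMap.coeFn_toLp φ 2 volume, SchwartzMap.coeFn_toLp ψ 2 volume]
    with x h1 h2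
  rw [h1, h2]
  exact h x

theorem norm_Mod_sub_sub_le (s : Space d) (t : ℝ) (φ : 𝓢(Space d, ℂ)) :
    ‖Mod (t • s) (φ.toLp 2 volume) - φ.toLp 2 volume - t • ((modG s φ).toLp 2 volume : L2 d)‖ ≤
      (3 * ‖((modG s (modG s φ)).toLp 2 volume : L2 d)‖) * ‖t ^ 2‖ := by
  have h : t • ((modG s φ).toLp 2 volume : L2 d) = (t : ℂ) • (modG s φ).toLp 2 volume :=
    RCLike.real_smul_eq_coe_smul t _
  rw [Mod_toLp, h, ← toLp_smul', ← toLp_sub', ← toLp_sub']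
  refine (norm_toLp_le_norm_toLp (norm_modS_sub_sub_le s t φ)).trans_eq ?_
  rw [toLp_smul', norm_smul, Complex.norm_real, norm_mul]
  norm_num; ring

theorem hasDerivAt_Mod (s : Space d) (φ : 𝓢(Space d, ℂ)) :
    HasDerivAt (fun t : ℝ => Mod (t • s) (φ.toLp 2)) ((modG s φ).toLp 2 : L2 d) 0 := by
  rw [hasDerivAt_iff_isLittleO_nhds_zero]
  have h2 : (fun t : ℝ => t ^ 2) =o[nhds 0] fun t : ℝ => t := by
    simpa using Asymptotics.isLittleO_pow_pow (𝕜 := ℝ) (m := 1) (n := 2) (by norm_num)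
  refine (Asymptotics.IsBigO.of_bound (3 * ‖((modG s (modG s φ)).toLp 2 : L2 d)‖)
    (.of_forall fun t => ?_)).trans_isLittleO h2
  rw [zero_add, zero_smul, Mod_zero]
  exact norm_Mod_sub_sub_le s t φ

/-- The group of modulations in the direction `s`. -/
def modGroup (s : Space d) : CoreGroup (schwartzL2 d) where
  U t := Mod (t • s)
  u t := modS (t • s)
  G := modG s
  norm_U _ _ := norm_Mod_apply _ _
  U_zero := by rw [zero_smul, Mod_zero]
  U_add t t' := by rw [add_smul, Mod_add]
  U_J _ _ := Mod_toLp _ _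
  G_u t φ := by
    ext x
    simp only [modG_apply, modS_apply]; ring
  deriv_zero := hasDerivAt_Mod s

/-- The generator of the translations `t ↦ Trans (t r)`. -/
def transG (r : Space d) (φ : 𝓢(Space d, ℂ)) : 𝓢(Space d, ℂ) := ∑ j, (-(r j : ℂ)) • dX j φ

theorem fourier_transS (r : Space d) (φ : 𝓢(Space d, ℂ)) :
    𝓕 (transS r φ) = modS (-r) (𝓕 φ) := by
  ext ξ
  rw [modS_apply, SchwartzMap.fourier_coe, SchwartzMap.fourier_coe, Real.fourier_eq,
    Real.fourier_eq]
  simp_rw [transS_apply]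
  rw [← integral_add_right_eq_self (μ := volume) _ r, ← integral_const_mul]
  refine integral_congr_ae (.of_forall fun x => ?_)
  simp only [add_sub_cancel_right, Circle.smul_def, smul_eq_mul, Real.fourierChar_apply, chi]
  rw [← mul_assoc, ← Complex.exp_add]
  congr 2
  rw [inner_add_left, inner_neg_left]
  push_cast; ring

theorem fourier_dX (j : Fin d) (φ : 𝓢(Space d, ℂ)) :
    𝓕 (dX j φ) = (2 * Real.pi * Complex.I : ℂ) • mulX j (𝓕 φ) := by
  rw [dX, SchwartzMap.fourier_lineDerivOp_eq]
  ext ξ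
  have hg : (fun x : Space d =>
      ⟪x, (EuclideanSpace.single j (1 : ℝ) : Space d)⟫_ℝ).HasTemperateGrowth :=
    ((innerSL ℝ).flip (EuclideanSpace.single j (1 : ℝ) : Space d)).hasTemperateGrowth
  rw [smul_apply, smul_apply, SchwartzMap.smulLeftCLM_apply_apply hg, mulX_apply,
    EuclideanSpace.inner_single_right]
  simp only [Complex.real_smul, one_mul, conj_trivial]

theorem fourier_transG (r : Space d) (φ : 𝓢(Space d, ℂ)) :
    𝓕 (transG r φ) = modG (-r) (𝓕 φ) := by
  rw [transG, modG]
  change FourierTransform.fourierCLM ℂ _ _ = _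
  rw [map_sum]
  refine Finset.sum_congr rfl fun j _ => ?_
  rw [map_smul]
  change (-(r j : ℂ)) • 𝓕 (dX j φ) = _
  rw [fourier_dX, smul_smul]
  congr 1
  simp only [PiLp.neg_apply]
  push_cast; ring

/-- The Fourier transform conjugates translation by r to modulation by -r; the derivative is carried
back by the inverse Plancherel isometry. -/
theorem hasDerivAt_Trans (r : Space d) (φ : 𝓢(Space d, ℂ)) :
    HasDerivAt (fun t : ℝ => Trans (t • r) (φ.toLp 2)) ((transG r φ).toLp 2 : L2 d) 0 := by
  have h1 := hasDerivAt_Mod (-r) (𝓕 φ)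
  let F : L2 d →L[ℝ] L2 d :=
    ((Lp.fourierTransformₗᵢ (Space d) ℂ).symm.toContinuousLinearEquiv
      : L2 d →L[ℂ] L2 d).restrictScalars ℝ
  have hF : ∀ χ : 𝓢(Space d, ℂ), F ((𝓕 χ).toLp 2) = χ.toLp 2 := fun χ => by
    rw [← SchwartzMap.toLp_fourier_eq]
    exact (Lp.fourierTransformₗᵢ (Space d) ℂ).symm_apply_apply _
  have h2 := F.hasFDerivAt.comp_hasDerivAt 0 h1
  rw [← fourier_transG, hF] at h2
  refine h2.congr_of_eventuallyEq (.of_forall fun t => ?_)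
  change _ = F (Mod (t • -r) ((𝓕 φ).toLp 2))
  rw [smul_neg, Mod_toLp, ← fourier_transS, hF]
  exact Trans_toLp _ _

/-- The group of translations in the direction `r`. -/
def transGroup (r : Space d) : CoreGroup (schwartzL2 d) where
  U t := Trans (t • r)
  u t := transS (t • r)
  G := transG r
  norm_U _ _ := norm_Trans_apply _ _
  U_zero := by rw [zero_smul, Trans_zero]
  U_add t t' := by rw [add_smul, Trans_add]
  U_J _ _ := Trans_toLp _ _
  G_u t φ := by
    simp only [transG, dX_transS]
    simp only [transS, map_sum, map_smul]
  deriv_zero := hasDerivAt_Trans r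

end WeylGroups

/-! ### Plancherel's identity for the matrix elements of the Weyl operators. -/

section Plancherel

open FourierTransform Real

variable {d : ℕ}

/-- The L² and the integral Fourier transforms agree on L¹ ∩ L²: tested against a smooth compactly
supported function, both are moved onto that function. -/
theorem fourier_toLp_ae_eq {u : Space d → ℂ} (h1 : Integrable u) (h2 : MemLp u 2) :
    (𝓕 (h2.toLp u) : L2 d) =ᵐ[volume] 𝓕 u := by
  have hcont : Continuous (𝓕 u) := by
    exact VectorFourier.fourierIntegral_continuous Real.continuous_fourierChar
      (by exact continuous_inner) h1
  refine ae_eq_of_integral_contDiff_smul_eq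
    ((Lp.memLp (𝓕 (h2.toLp u) : L2 d)).locallyIntegrable (by norm_num))
    hcont.locallyIntegrable fun g hg hgc => ?_
  have hgc' : HasCompactSupport fun x => (g x : ℂ) := by
    exact hgc.comp_left (g := fun t : ℝ => (t : ℂ)) (by simp)
  let G : 𝓢(Space d, ℂ) := hgc'.toSchwartzMap (Complex.ofRealCLM.contDiff.comp hg)
  have hG : ∀ x, G x = (g x : ℂ) := fun x => rfl
  have e1 : ∀ f : Space d → ℂ, ∫ x, g x • f x = ∫ x, G x • f x := fun f => by
    simp [hG]
  rw [e1, e1, ← Lp.toTemperedDistribution_apply, ← Lp.fourier_toTemperedDistribution_eq,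
    TemperedDistribution.fourier_apply, Lp.toTemperedDistribution_apply]
  have h3 := VectorFourier.integral_fourierIntegral_smul_eq_flip (μ := volume) (ν := volume)
    (L := innerₗ (Space d)) Real.continuous_fourierChar (by exact continuous_inner)
    G.integrable h1
  rw [flip_innerₗ] at h3
  refine Eq.trans (integral_congr_ae ?_) h3
  filter_upwards [h2.coeFn_toLp] with x hx
  rw [hx]
  rfl

theorem lintegral_enorm_fourier_sq {u : Space d → ℂ} (h1 : Integrable u) (h2 : MemLp u 2) :
    ∫⁻ ξ, ‖𝓕 u ξ‖ₑ ^ 2 = ∫⁻ x, ‖u x‖ₑ ^ 2 := by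
  have e1 : ∀ f : Space d → ℂ, ∫⁻ x, ‖f x‖ₑ ^ 2 = eLpNorm f 2 volume ^ 2 := fun f => by
    simpa using (eLpNorm_nnreal_pow_eq_lintegral (f := f) (μ := volume) (p := 2) two_ne_zero).symm
  rw [e1, e1, ← eLpNorm_congr_ae (fourier_toLp_ae_eq h1 h2), ← Lp.enorm_def, ← ofReal_norm,
    Lp.norm_fourier_eq, ofReal_norm, Lp.enorm_toLp]

theorem continuous_apply_of_isometric {X H : Type*} [TopologicalSpace X] [NormedAddCommGroup H]
    [NormedSpace ℂ H] {F : X → H →L[ℂ] H} (hF : ∀ s ψ, ‖F s ψ‖ = ‖ψ‖)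
    (hc : ∀ ψ, Continuous fun s => F s ψ) {Y : Type*} [TopologicalSpace Y] {s : Y → X} {v : Y → H}
    (hs : Continuous s) (hv : Continuous v) : Continuous fun y => F (s y) (v y) := by
  rw [continuous_iff_continuousAt]
  intro y
  have h1 : Filter.Tendsto (fun y' => ‖F (s y') (v y) - F (s y) (v y)‖ + ‖v y' - v y‖) (nhds y)
      (nhds 0) := by
    have h2 := ((((hc (v y)).comp hs).sub continuous_const).norm.add
      (hv.sub continuous_const).norm).tendsto (f := fun y' =>
      ‖F (s y') (v y) - F (s y) (v y)‖ + ‖v y' - v y‖) y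
    simpa using h2
  rw [ContinuousAt, tendsto_iff_norm_sub_tendsto_zero]
  refine squeeze_zero (fun _ => norm_nonneg _) (fun y' => ?_) h1
  calc ‖F (s y') (v y') - F (s y) (v y)‖
      = ‖(F (s y') (v y) - F (s y) (v y)) + F (s y') (v y' - v y)‖ := by
        rw [map_sub]; congr 1; abel
    _ ≤ _ := by
        refine (norm_add_le _ _).trans ?_
        rw [hF]

/-- Isometry extends continuity at 0 from the dense core to H, and the group law transports it to
every point. -/
theorem continuous_of_core_bound {H D : Type*} [NormedAddCommGroup H] [NormedSpace ℂ H]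
    {J : D → H} (hJ : DenseRange J) {F : Space d → H →L[ℂ] H} (hF : ∀ s ψ, ‖F s ψ‖ = ‖ψ‖)
    (hadd : ∀ s t, F (s + t) = F s * F t) (h : ∀ φ : D, ∃ C : Fin d → ℝ,
      ∀ s, ‖F s (J φ) - J φ‖ ≤ ∑ j, |s j| * C j) (ψ : H) :
    Continuous fun s => F s ψ := by
  have h0 : Filter.Tendsto (fun s => ‖F s ψ - ψ‖) (nhds 0) (nhds 0) := by
    rw [Metric.tendsto_nhds]
    intro ε hε
    obtain ⟨φ, hφ⟩ := Metric.denseRange_iff.1 hJ ψ (ε / 3) (by positivity)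
    obtain ⟨C, hC⟩ := h φ
    have hlim : Filter.Tendsto (fun s : Space d => ∑ j, |s j| * C j) (nhds 0) (nhds 0) := by
      have : Continuous fun s : Space d => ∑ j, |s j| * C j := by fun_prop
      simpa using this.tendsto 0
    filter_upwards [(Metric.tendsto_nhds.1 hlim) (ε / 3) (by positivity)] with s hs
    rw [dist_eq_norm] at hφ
    rw [dist_zero_right, norm_norm]
    rw [dist_zero_right] at hs
    have h1 : F s ψ - ψ = F s (ψ - J φ) + (F s (J φ) - J φ) - (ψ - J φ) := by
      rw [map_sub]; abel
    have h2 := norm_sub_le (F s (ψ - J φ) + (F s (J φ) - J φ)) (ψ - J φ)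
    have h3 := norm_add_le (F s (ψ - J φ)) (F s (J φ) - J φ)
    have h5 := (hC s).trans_lt ((le_abs_self _).trans_lt hs)
    rw [hF] at h3
    rw [h1]
    linarith
  rw [continuous_iff_continuousAt]
  intro s
  rw [ContinuousAt, tendsto_iff_norm_sub_tendsto_zero]
  have h1 : Filter.Tendsto (fun t => t - s) (nhds s) (nhds (0 : Space d)) := by
    have : Continuous fun t : Space d => t - s := by fun_prop
    simpa using this.tendsto s
  refine (h0.comp h1).congr fun t => ?_
  have h2 : F t ψ = F s (F (t - s) ψ) := by
    rw [← mul_apply_eq_comp, ← hadd, add_sub_cancel]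
  rw [Function.comp_apply, h2, ← map_sub, hF]

theorem norm_Mod_sub_le (s : Space d) (φ : 𝓢(Space d, ℂ)) :
    ‖Mod s (φ.toLp 2 volume) - φ.toLp 2 volume‖ ≤
      ∑ j, |s j| * (2 * π * ‖((mulX j φ).toLp 2 volume : L2 d)‖) := by
  have h := (modGroup s).norm_U_one_sub_le φ
  change ‖Mod ((1 : ℝ) • s) (φ.toLp 2 volume) - φ.toLp 2 volume‖ ≤
    ‖((modG s φ).toLp 2 volume : L2 d)‖ at h
  rw [one_smul] at h
  refine h.trans ?_
  rw [modG, toLp_sum']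
  refine (norm_sum_le _ _).trans (Finset.sum_le_sum fun j _ => ?_)
  rw [toLp_smul', norm_smul]
  simp only [norm_mul, Complex.norm_I, Complex.norm_real, Real.norm_eq_abs, mul_one,
    abs_of_pos pi_pos, Complex.norm_ofNat]
  exact le_of_eq (by ring)

theorem norm_Trans_sub_le (r : Space d) (φ : 𝓢(Space d, ℂ)) :
    ‖Trans r (φ.toLp 2 volume) - φ.toLp 2 volume‖ ≤
      ∑ j, |r j| * ‖((dX j φ).toLp 2 volume : L2 d)‖ := by
  have h := (transGroup r).norm_U_one_sub_le φ
  change ‖Trans ((1 : ℝ) • r) (φ.toLp 2 volume) - φ.toLp 2 volume‖ ≤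
    ‖((transG r φ).toLp 2 volume : L2 d)‖ at h
  rw [one_smul] at h
  refine h.trans ?_
  rw [transG, toLp_sum']
  refine (norm_sum_le _ _).trans (Finset.sum_le_sum fun j _ => ?_)
  rw [toLp_smul', norm_smul]
  simp

theorem continuous_Mod (ψ : L2 d) : Continuous fun s => Mod s ψ :=
  continuous_of_core_bound denseRange_toLp norm_Mod_apply Mod_add
    (fun φ => ⟨_, fun s => norm_Mod_sub_le s φ⟩) ψ

theorem continuous_Trans (ψ : L2 d) : Continuous fun s => Trans s ψ :=
  continuous_of_core_bound denseRange_toLp norm_Trans_apply Trans_add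
    (fun φ => ⟨_, fun s => norm_Trans_sub_le s φ⟩) ψ

theorem continuous_W (ψ : L2 d) : Continuous fun z => W z ψ :=
  continuous_apply_of_isometric norm_Mod_apply continuous_Mod continuous_snd
    ((continuous_Trans ψ).comp continuous_fst)

/-- The matrix elements of the Weyl operators. -/
def V (φ ψ : L2 d) (z : Space d × Space d) : ℂ := ⟪φ, W z ψ⟫_ℂ

theorem continuous_V (φ ψ : L2 d) : Continuous (V φ ψ) :=
  continuous_const.inner (continuous_W ψ)

theorem norm_V_le (φ ψ : L2 d) (z : Space d × Space d) : ‖V φ ψ z‖ ≤ ‖φ‖ * ‖ψ‖ := by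
  rw [V, ← norm_W_apply z ψ]; exact norm_inner_le_norm _ _

theorem coeFn_W (z : Space d × Space d) (ψ : L2 d) :
    W z ψ =ᵐ[volume] fun x => chi z.2 x * ψ (x - z.1) := by
  filter_upwards [coeFn_modI z.2 (transI z.1 ψ), coeFn_transI z.1 ψ] with x h1 h2
  change (modI z.2 (transI z.1 ψ)) x = _
  rw [h1, h2]

theorem integrable_mul_sub (φ ψ : L2 d) (r : Space d) :
    Integrable fun x => starRingEnd ℂ (φ x) * ψ (x - r) := by
  have h1 : MemLp (fun x => ψ (x - r)) 2 (volume : Measure (Space d)) :=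
    (Lp.memLp ψ).comp_measurePreserving (measurePreserving_sub_right volume r)
  exact (Lp.memLp φ).star.integrable_mul h1

theorem V_eq_fourier (φ ψ : L2 d) (r s : Space d) :
    V φ ψ (r, s) = 𝓕 (fun x => starRingEnd ℂ (φ x) * ψ (x - r)) (-s) := by
  rw [V, L2.inner_def, Real.fourier_eq]
  refine integral_congr_ae ?_
  filter_upwards [coeFn_W (r, s) ψ] with x hx
  rw [hx]
  simp only [RCLike.inner_apply, Circle.smul_def, smul_eq_mul, Real.fourierChar_apply, chi,
    inner_neg_right, neg_neg, real_inner_comm s x]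
  rw [mul_comm Complex.I]
  ring

/-- For fixed r, the matrix element is, up to s ↦ -s, the Fourier transform in s of the product of
the conjugate of φ with the translate of ψ. Plancherel in s is followed by Tonelli in (r, x). -/
theorem lintegral_enorm_V_sq (φ ψ : L2 d) :
    ∫⁻ z, ‖V φ ψ z‖ₑ ^ 2 = ‖φ‖ₑ ^ 2 * ‖ψ‖ₑ ^ 2 := by
  have e1 : ∀ f : L2 d, ∫⁻ x, ‖f x‖ₑ ^ 2 = ‖f‖ₑ ^ 2 := fun f => by
    rw [Lp.enorm_def]
    simpa using (eLpNorm_nnreal_pow_eq_lintegral (f := f) (μ := volume) (p := 2) two_ne_zero).symm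
  have hm : Measurable fun q : Space d × Space d => starRingEnd ℂ (φ q.2) * ψ (q.2 - q.1) := by
    have h1 := (Lp.stronglyMeasurable φ).measurable
    have h2 := (Lp.stronglyMeasurable ψ).measurable
    have h3 : Measurable fun x : ℂ => starRingEnd ℂ x := Complex.continuous_conj.measurable
    exact (h3.comp (h1.comp measurable_snd)).mul (h2.comp (measurable_snd.sub measurable_fst))
  have hfin : ∫⁻ r : Space d, ∫⁻ x, ‖starRingEnd ℂ (φ x) * ψ (x - r)‖ₑ ^ 2 =
      ‖φ‖ₑ ^ 2 * ‖ψ‖ₑ ^ 2 := by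
    rw [lintegral_lintegral_swap (by exact (hm.enorm.pow_const 2).aemeasurable)]
    simp_rw [enorm_mul, mul_pow, RCLike.enorm_conj]
    rw [← e1 φ]
    rw [← lintegral_mul_const _ (by exact (Lp.stronglyMeasurable φ).measurable.enorm.pow_const 2)]
    refine lintegral_congr fun x => ?_
    rw [lintegral_const_mul' _ _ (by finiteness)]
    congr 1
    rw [lintegral_sub_left_eq_self (fun y => ‖ψ y‖ₑ ^ 2) x, e1]
  -- Plancherel needs the product to lie in L², which holds only for almost every r.
  have hae : ∀ᵐ r : Space d, ∫⁻ x, ‖starRingEnd ℂ (φ x) * ψ (x - r)‖ₑ ^ 2 < ∞ := by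
    refine ae_lt_top ?_ (by rw [hfin]; finiteness)
    exact (hm.enorm.pow_const 2).lintegral_prod_right'
  rw [← hfin, Measure.volume_eq_prod,
    lintegral_prod _ (by exact ((continuous_V φ ψ).measurable.enorm.pow_const 2).aemeasurable)]
  refine lintegral_congr_ae (hae.mono fun r hr => ?_)
  have hmem : MemLp (fun x => starRingEnd ℂ (φ x) * ψ (x - r)) 2 volume := by
    refine ⟨(integrable_mul_sub φ ψ r).aestronglyMeasurable, ?_⟩
    rw [eLpNorm_lt_top_iff_lintegral_rpow_enorm_lt_top two_ne_zero ENNReal.ofNat_ne_top]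
    simpa using hr
  simp_rw [V_eq_fourier]
  rw [lintegral_neg_eq_self (fun s => ‖𝓕 (fun x => starRingEnd ℂ (φ x) * ψ (x - r)) s‖ₑ ^ 2),
    lintegral_enorm_fourier_sq (integrable_mul_sub φ ψ r) hmem]

end Plancherel

/-! ### Moyal's identity and symbols of Hilbert–Schmidt operators. -/

section Moyal

variable {H K : Type*} [NormedAddCommGroup H] [InnerProductSpace ℂ H] [NormedAddCommGroup K]
  [InnerProductSpace ℂ K]

theorem sesquilinear_eq_zero {E : Type*} [AddCommGroup E] [Module ℂ E] {B : E → E → ℂ}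
    (hl : ∀ x y z, B (x + y) z = B x z + B y z) (hr : ∀ x y z, B x (y + z) = B x y + B x z)
    (hsl : ∀ (c : ℂ) x y, B (c • x) y = c * B x y)
    (hsr : ∀ (c : ℂ) x y, B x (c • y) = starRingEnd ℂ c * B x y) (h : ∀ x, B x x = 0) (x y : E) :
    B x y = 0 := by
  have h1 := h (x + y)
  have h2 := h (x + Complex.I • y)
  simp only [hl, hr, hsl, hsr, h, Complex.conj_I] at h1 h2
  have h3 : Complex.I * (B x y - B y x) = 0 := by linear_combination -h2
  have h4 := (mul_eq_zero.1 h3).resolve_left Complex.I_ne_zero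
  linear_combination (h1 + h4) / 2

/-- A map that is conjugate-linear in the first argument, linear in the second one and
multiplicative for the norms. -/
structure IsMoyal (Φ : H → H → K) : Prop where
  add_left : ∀ φ φ' ψ, Φ (φ + φ') ψ = Φ φ ψ + Φ φ' ψ
  smul_left : ∀ (c : ℂ) φ ψ, Φ (c • φ) ψ = starRingEnd ℂ c • Φ φ ψ
  add_right : ∀ φ ψ ψ', Φ φ (ψ + ψ') = Φ φ ψ + Φ φ ψ'
  smul_right : ∀ (c : ℂ) φ ψ, Φ φ (c • ψ) = c • Φ φ ψ
  norm_eq : ∀ φ ψ, ‖Φ φ ψ‖ = ‖φ‖ * ‖ψ‖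

namespace IsMoyal

variable {Φ : H → H → K} (hΦ : IsMoyal Φ)
include hΦ

/-- The norm identity is polarized twice, in the second argument and then in the first. -/
theorem inner_eq (φ ψ φ' ψ' : H) : ⟪Φ φ ψ, Φ φ' ψ'⟫_ℂ = ⟪φ', φ⟫_ℂ * ⟪ψ, ψ'⟫_ℂ := by
  have h1 : ∀ φ ψ ψ', ⟪Φ φ ψ', Φ φ ψ⟫_ℂ - ⟪φ, φ⟫_ℂ * ⟪ψ', ψ⟫_ℂ = 0 := by
    intro φ
    refine sesquilinear_eq_zero ?_ ?_ ?_ ?_ ?_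
    · intro x y z; rw [hΦ.add_right, inner_add_right, inner_add_right]; ring
    · intro x y z; rw [hΦ.add_right, inner_add_left, inner_add_left]; ring
    · intro c x y; rw [hΦ.smul_right, inner_smul_right, inner_smul_right]; ring
    · intro c x y; rw [hΦ.smul_right, inner_smul_left, inner_smul_left]; ring
    · intro x
      simp only [inner_self_eq_norm_sq_to_K, hΦ.norm_eq, RCLike.ofReal_mul]
      ring
  have h2 : ∀ φ φ', ⟪Φ φ' ψ, Φ φ ψ'⟫_ℂ - ⟪φ, φ'⟫_ℂ * ⟪ψ, ψ'⟫_ℂ = 0 := by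
    have := sesquilinear_eq_zero (E := H)
      (B := fun φ φ' => ⟪Φ φ ψ, Φ φ' ψ'⟫_ℂ - ⟪φ', φ⟫_ℂ * ⟪ψ, ψ'⟫_ℂ) ?_ ?_ ?_ ?_
      (fun φ => h1 φ ψ' ψ)
    · exact fun φ φ' => this φ' φ
    · intro x y z; simp only [hΦ.add_left, inner_add_left, inner_add_right]; ring
    · intro x y z; simp only [hΦ.add_left, inner_add_left, inner_add_right]; ring
    · intro c x y
      simp only [hΦ.smul_left, inner_smul_left, inner_smul_right, Complex.conj_conj]; ring
    · intro c x y
      simp only [hΦ.smul_left, inner_smul_left, inner_smul_right]; ring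
  linear_combination h2 φ' φ

/-- The symbol of a Hilbert–Schmidt operator. -/
theorem exists_symbol [CompleteSpace H] [CompleteSpace K] {ι : Type*} (e : HilbertBasis ι ℂ H)
    (T : H →L[ℂ] H) (hT : Summable fun k => ‖T (e k)‖ ^ 2) :
    ∃ F : K, ‖F‖ ^ 2 ≤ ∑' k, ‖T (e k)‖ ^ 2 ∧ ∀ φ ψ, ⟪F, Φ φ ψ⟫_ℂ = ⟪φ, T ψ⟫_ℂ := by
  -- Each v_k is the symbol of the rank-one operator ψ ↦ ⟨e_k, ψ⟩ T e_k. They are pairwise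
  -- orthogonal by Moyal's identity, so their series converges exactly under the Hilbert–Schmidt
  -- condition.
  let v : ι → K := fun k => Φ (T (e k)) (e k)
  have hv : ∀ k, ‖v k‖ ^ 2 = ‖T (e k)‖ ^ 2 := fun k => by
    simp [v, hΦ.norm_eq, e.orthonormal.1 k]
  have hof : OrthogonalFamily ℂ (fun k => (ℂ ∙ v k : Submodule ℂ K))
      fun k => (ℂ ∙ v k : Submodule ℂ K).subtypeₗᵢ := by
    refine OrthogonalFamily.of_pairwise fun k l hkl => ?_
    refine Submodule.isOrtho_span.2 ?_
    rintro _ rfl _ rfl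
    rw [hΦ.inner_eq, e.orthonormal.2 hkl, mul_zero]
  let g : ∀ k, (ℂ ∙ v k : Submodule ℂ K) := fun k => ⟨v k, Submodule.mem_span_singleton_self _⟩
  have hsum : Summable v := by
    refine (hof.summable_iff_norm_sq_summable g).2 ?_
    refine hT.congr fun k => (hv k).symm
  refine ⟨∑' k, v k, ?_, fun φ ψ => ?_⟩
  · refine le_of_tendsto (hsum.hasSum.norm.pow 2) (.of_forall fun s => ?_)
    have h := hof.norm_sum g s
    change ‖∑ k ∈ s, v k‖ ^ 2 = ∑ k ∈ s, ‖v k‖ ^ 2 at h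
    rw [h]
    simp_rw [hv]
    exact hT.sum_le_tsum s fun _ _ => sq_nonneg _
  · have h1 : HasSum (fun k => ⟪v k, Φ φ ψ⟫_ℂ) ⟪∑' k, v k, Φ φ ψ⟫_ℂ := by
      have h := (hsum.hasSum.mapL (innerSL ℂ (Φ φ ψ))).star
      simpa using h
    have h2 : HasSum (fun k => ⟪φ, T (e k)⟫_ℂ * ⟪e k, ψ⟫_ℂ) ⟪φ, T ψ⟫_ℂ := by
      have h := (e.hasSum_repr ψ).mapL ((innerSL ℂ φ).comp T)
      simpa [e.repr_apply_apply, inner_smul_right, mul_comm] using h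
    simp_rw [v, hΦ.inner_eq] at h1
    exact h1.unique h2

end IsMoyal

/-- For p = 2 the power |T|² is the explicit sum of the T_i* T_i, and each component contributes a
part of its trace. -/
theorem tsum_norm_apply_sq_le [CompleteSpace H] {ι : Type*} [Fintype ι] {T : ι → H →L[ℂ] H}
    (hT : schattenNorm 2 T ≠ ∞) (j : ι) :
    (Summable fun k => ‖T j (someBasis H k)‖ ^ 2) ∧
      ∑' k, ‖T j (someBasis H k)‖ ^ 2 ≤ (schattenNorm 2 T).toReal ^ 2 := by
  have h1 : schattenNorm 2 T ^ 2 = ∑' k, ENNReal.ofReal (∑ i, ‖T i (someBasis H k)‖ ^ 2) := by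
    rw [schattenNorm, if_neg (by simp), ← ENNReal.rpow_natCast, ← ENNReal.rpow_mul]
    have h2 : CFC.rpow (famAbs T) (2 : ℝ≥0∞).toReal = famAbs T * famAbs T := by
      have := CFC.rpow_natCast (famAbs T) 2 (famAbs_nonneg T)
      rw [pow_two] at this
      rw [← this]
      simp [CFC.rpow_eq_pow]
    rw [h2]
    simp only [ENNReal.toReal_ofNat, Nat.cast_ofNat, one_div, isUnit_iff_ne_zero, ne_eq,
      OfNat.ofNat_ne_zero, not_false_eq_true, IsUnit.inv_mul_cancel, ENNReal.rpow_one]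
    refine tsum_congr fun k => ?_
    rw [famAbs_mul_self, sum_apply, inner_sum, Complex.re_sum]
    simp_rw [re_inner_star_mul_self]
  have h3 : ∑' k, ENNReal.ofReal (‖T j (someBasis H k)‖ ^ 2) ≤ schattenNorm 2 T ^ 2 := by
    rw [h1]
    refine ENNReal.tsum_le_tsum fun k => ENNReal.ofReal_le_ofReal ?_
    exact Finset.single_le_sum (f := fun i => ‖T i (someBasis H k)‖ ^ 2)
      (fun i _ => sq_nonneg _) (Finset.mem_univ j)
  have hfin : schattenNorm 2 T ^ 2 ≠ ∞ := by finiteness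
  have hs : Summable fun k => ‖T j (someBasis H k)‖ ^ 2 := by
    have := ENNReal.summable_toReal (h3.trans_lt hfin.lt_top).ne
    simpa using this
  refine ⟨hs, ?_⟩
  rw [← ENNReal.ofReal_tsum_of_nonneg (fun _ => sq_nonneg _) hs] at h3
  have h4 := ENNReal.toReal_mono hfin h3
  rwa [ENNReal.toReal_ofReal (tsum_nonneg fun _ => sq_nonneg _), ENNReal.toReal_pow] at h4

end Moyal

/-! ### Weyl symbols in L² of the phase space. -/

section Symbol

variable {d : ℕ}

theorem memLp_V (φ ψ : L2 d) : MemLp (V φ ψ) 2 := by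
  refine ⟨(continuous_V φ ψ).aestronglyMeasurable, ?_⟩
  rw [eLpNorm_lt_top_iff_lintegral_rpow_enorm_lt_top two_ne_zero ENNReal.ofNat_ne_top]
  simp only [ENNReal.toReal_ofNat, ENNReal.rpow_ofNat, lintegral_enorm_V_sq]
  finiteness

/-- The matrix elements of the Weyl operators as a vector of `L²`. -/
def VL (φ ψ : L2 d) : Lp ℂ 2 (volume : Measure (Space d × Space d)) := (memLp_V φ ψ).toLp

theorem V_add_left (φ φ' ψ : L2 d) : V (φ + φ') ψ = V φ ψ + V φ' ψ :=
  funext fun _ => inner_add_left _ _ _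

theorem V_smul_left (c : ℂ) (φ ψ : L2 d) : V (c • φ) ψ = starRingEnd ℂ c • V φ ψ :=
  funext fun _ => inner_smul_left _ _ _

theorem V_add_right (φ ψ ψ' : L2 d) : V φ (ψ + ψ') = V φ ψ + V φ ψ' :=
  funext fun z => by simp only [V, map_add, inner_add_right, Pi.add_apply]

theorem V_smul_right (c : ℂ) (φ ψ : L2 d) : V φ (c • ψ) = c • V φ ψ :=
  funext fun z => by simp only [V, map_smul, inner_smul_right, Pi.smul_apply, smul_eq_mul]

theorem isMoyal_VL : IsMoyal (VL (d := d)) where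
  add_left φ φ' ψ := by
    rw [VL, VL, VL, ← MemLp.toLp_add]; congr 1; exact V_add_left _ _ _
  smul_left c φ ψ := by
    rw [VL, VL, ← MemLp.toLp_const_smul]; congr 1; exact V_smul_left _ _ _
  add_right φ ψ ψ' := by
    rw [VL, VL, VL, ← MemLp.toLp_add]; congr 1; exact V_add_right _ _ _
  smul_right c φ ψ := by
    rw [VL, VL, ← MemLp.toLp_const_smul]; congr 1; exact V_smul_right _ _ _
  norm_eq φ ψ := by
    have h : ‖VL φ ψ‖ₑ ^ 2 = (‖φ‖ₑ * ‖ψ‖ₑ) ^ 2 := by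
      rw [mul_pow, ← lintegral_enorm_V_sq, VL, Lp.enorm_toLp]
      simpa using (eLpNorm_nnreal_pow_eq_lintegral (f := V φ ψ)
        (μ := (volume : Measure (Space d × Space d))) (p := 2) two_ne_zero)
    have h2 := congrArg ENNReal.toReal h
    simp only [ENNReal.toReal_pow, ENNReal.toReal_mul, toReal_enorm] at h2
    exact (pow_left_inj₀ (norm_nonneg _) (by positivity) two_ne_zero).1 h2

theorem integrable_mul_V {f : Space d × Space d → ℂ} (hf : MemLp f 2) (φ ψ : L2 d) :
    Integrable fun z => f z * V φ ψ z :=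
  hf.integrable_mul (memLp_V φ ψ)

/-- The symbol of a Hilbert–Schmidt operator, with its norm. -/
theorem exists_symbol_of_schattenNorm {ι : Type*} [Fintype ι] {T : ι → L2 d →L[ℂ] L2 d}
    (hT : schattenNorm 2 T ≠ ∞) (j : ι) :
    ∃ f : Space d × Space d → ℂ, MemLp f 2 ∧ eLpNorm f 2 volume ≤ schattenNorm 2 T ∧
      ∀ φ ψ, ⟪φ, T j ψ⟫_ℂ = ∫ z, f z * V φ ψ z := by
  obtain ⟨h1, h2⟩ := tsum_norm_apply_sq_le hT j
  obtain ⟨F, hF, hF2⟩ := isMoyal_VL.exists_symbol (someBasis (L2 d)) (T j) h1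
  refine ⟨fun z => starRingEnd ℂ (F z), (Lp.memLp F).star, ?_, fun φ ψ => ?_⟩
  · have h3 : eLpNorm (fun z => starRingEnd ℂ (F z)) 2 volume = ‖F‖ₑ := by
      rw [Lp.enorm_def]
      exact eLpNorm_congr_norm_ae (.of_forall fun z => by simp)
    rw [h3, ← ofReal_norm, ← ENNReal.ofReal_toReal hT]
    refine ENNReal.ofReal_le_ofReal ?_
    exact pow_le_pow_iff_left₀ (norm_nonneg _) ENNReal.toReal_nonneg two_ne_zero |>.1
      (hF.trans h2)
  · rw [← hF2, L2.inner_def]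
    refine integral_congr_ae ?_
    filter_upwards [(memLp_V φ ψ).coeFn_toLp] with z hz
    rw [VL, hz, RCLike.inner_apply, mul_comm]

end Symbol

/-! ### Uniqueness of the symbol and its multiplication by coordinates. -/

section Uniqueness

open FourierTransform Real

/-- A test function is the Fourier transform of a Schwartz function; moving the transform onto g
makes every pairing vanish. -/
theorem ae_eq_zero_of_fourier_eq_zero {E : Type*} [NormedAddCommGroup E] [InnerProductSpace ℝ E]
    [FiniteDimensional ℝ E] [MeasurableSpace E] [BorelSpace E] {g : E → ℂ} (hg : Integrable g)
    (h : ∀ w, 𝓕 g w = 0) : g =ᵐ[volume] 0 := by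
  refine ae_eq_zero_of_integral_contDiff_smul_eq_zero hg.locallyIntegrable fun φ hφ hφc => ?_
  have hφc' : HasCompactSupport fun x => (φ x : ℂ) :=
    hφc.comp_left (g := fun t : ℝ => (t : ℂ)) (by simp)
  let Φ : 𝓢(E, ℂ) := hφc'.toSchwartzMap (Complex.ofRealCLM.contDiff.comp hφ)
  have h1 : ∀ x, φ x • g x = 𝓕 (𝓕⁻ Φ) x • g x := fun x => by
    rw [FourierTransform.fourier_fourierInv_eq]
    change _ = (φ x : ℂ) • g x
    simp
  simp_rw [h1]
  have h3 := VectorFourier.integral_fourierIntegral_smul_eq_flip (μ := volume) (ν := volume)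
    (L := innerₗ E) Real.continuous_fourierChar (by exact continuous_inner)
    (𝓕⁻ Φ).integrable hg
  rw [flip_innerₗ] at h3
  simp_rw [SchwartzMap.fourier_coe]
  refine h3.trans ?_
  refine integral_eq_zero_of_ae (.of_forall fun x => ?_)
  change (𝓕⁻ Φ) x • 𝓕 g x = 0
  rw [h, smul_zero]

variable {d : ℕ}

theorem ae_eq_zero_of_integral_chi_eq_zero {g : Space d × Space d → ℂ} (hg : Integrable g)
    (h : ∀ r s, ∫ ξ : Space d × Space d, chi s (-ξ.1) * chi ξ.2 r * g ξ = 0) :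
    g =ᵐ[volume] 0 := by
  -- The phases are the characters of ℝ^{2d}; the product is given its Euclidean structure, which
  -- preserves the volume, to apply injectivity of the Fourier transform.
  have hm := WithLp.volume_preserving_ofLp (U := Space d) (V := Space d)
  have hme : MeasurableEmbedding (@WithLp.ofLp 2 (Space d × Space d)) :=
    (MeasurableEquiv.toLp 2 (Space d × Space d)).symm.measurableEmbedding
  have h1 := ae_eq_zero_of_fourier_eq_zero (g := fun ξ : WithLp 2 (Space d × Space d) => g ξ.ofLp)
    (hm.integrable_comp_of_integrable hg) fun w => ?_
  · have h2 : ∀ᵐ ξ ∂((volume : Measure (WithLp 2 (Space d × Space d))).map WithLp.ofLp),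
        g ξ = 0 := hme.ae_map_iff.2 h1
    rwa [hm.map_eq] at h2
  · rw [Real.fourier_eq, ← h (-w.ofLp.2) w.ofLp.1, ← hm.integral_comp hme]
    refine integral_congr_ae (.of_forall fun ξ => ?_)
    simp only [Circle.smul_def, smul_eq_mul, Real.fourierChar_apply, chi, WithLp.prod_inner_apply,
      ← Complex.exp_add]
    congr 2
    rw [inner_neg_right, inner_neg_right, real_inner_comm ξ.ofLp.1]
    push_cast
    ring

theorem Trans_mul_Mod (r s : Space d) : Trans r * Mod s = chi s (-r) • (Mod s * Trans r) := by
  rw [Mod_mul_Trans, smul_smul, ← chi_add_right, neg_add_cancel, chi_zero_right, one_smul]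

theorem W_mul_W_eq (z ξ : Space d × Space d) :
    W ξ * W z = chi z.2 (-ξ.1) • (Mod (ξ.2 + z.2) * Trans (ξ.1 + z.1)) := by
  rw [W, W, mul_assoc, ← mul_assoc (Trans _) (Mod _), Trans_mul_Mod, smul_mul_assoc,
    mul_smul_comm, Mod_add, Trans_add]
  simp only [mul_assoc]

/-- Conjugation by one Weyl operator multiplies another by a character of its argument. -/
theorem W_mul_W (z ξ : Space d × Space d) :
    W ξ * W z = (chi z.2 (-ξ.1) * chi ξ.2 z.1) • (W z * W ξ) := by
  rw [W_mul_W_eq, W_mul_W_eq, smul_smul, mul_assoc, ← chi_add_right, add_neg_cancel,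
    chi_zero_right, mul_one, add_comm ξ.1, add_comm ξ.2]

theorem exists_schwartz_ne_zero : ∃ ψ : 𝓢(Space d, ℂ), (ψ.toLp 2 volume : L2 d) ≠ 0 := by
  let f : ContDiffBump (0 : Space d) := ⟨1, 2, one_pos, by norm_num⟩
  have hc : HasCompactSupport fun x => (f x : ℂ) :=
    f.hasCompactSupport.comp_left (g := fun t : ℝ => (t : ℂ)) (by simp)
  let ψ : 𝓢(Space d, ℂ) := hc.toSchwartzMap (Complex.ofRealCLM.contDiff.comp f.contDiff)
  refine ⟨ψ, fun h => ?_⟩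
  have h0 : ((0 : 𝓢(Space d, ℂ)).toLp 2 volume : L2 d) = 0 :=
    map_zero (SchwartzMap.toLpCLM ℂ ℂ 2 volume)
  have h1 : ψ = 0 := SchwartzMap.injective_toLp 2 volume (h.trans h0.symm)
  have h2 : ψ 0 = 1 := by
    change ((f 0 : ℝ) : ℂ) = 1
    rw [f.one_of_mem_closedBall (Metric.mem_closedBall_self zero_le_one)]
    simp
  rw [h1] at h2
  simp at h2

/-- Uniqueness of the symbol. -/
theorem symbol_ae_eq_zero {h : Space d × Space d → ℂ}
    (hi : ∀ φ ψ : 𝓢(Space d, ℂ), Integrable fun z => h z * formOf (W z) φ ψ)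
    (h0 : ∀ φ ψ : 𝓢(Space d, ℂ), ∫ z, h z * formOf (W z) φ ψ = 0) : h =ᵐ[volume] 0 := by
  have h1 : ∀ φ ψ : 𝓢(Space d, ℂ), (fun z => h z * formOf (W z) φ ψ) =ᵐ[volume] 0 := by
    intro φ ψ
    refine ae_eq_zero_of_integral_chi_eq_zero (hi φ ψ) fun r s => ?_
    -- Replacing φ and ψ by their images under W(r, s) inserts an arbitrary character into the
    -- integral.
    rw [← h0 (WS (r, s) φ) (WS (r, s) ψ)]
    refine integral_congr_ae (.of_forall fun ξ => ?_)
    simp only [formOf]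
    rw [← W_toLp, ← W_toLp, ← mul_apply_eq_comp (W ξ), W_mul_W, smul_apply, inner_smul_right,
      mul_apply_eq_comp,
      (LinearMap.norm_map_iff_inner_map_map (W (r, s))).1 (norm_W_apply (r, s))]
    ring
  -- It remains to divide by a matrix element: near ξ, the one between W(ξ) ψ and ψ does not vanish.
  refine measure_null_of_locally_null _ fun ξ _ => ?_
  obtain ⟨ψ, hψ⟩ := exists_schwartz_ne_zero (d := d)
  have h2 : formOf (W ξ) (WS ξ ψ) ψ ≠ 0 := by
    rw [formOf, ← W_toLp, inner_self_ne_zero, ← norm_ne_zero_iff, norm_W_apply]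
    exact norm_ne_zero_iff.2 hψ
  have h3 : ∀ᶠ z in nhds ξ, formOf (W z) (WS ξ ψ) ψ ≠ 0 :=
    (continuous_V _ _).continuousAt.eventually_ne h2
  refine ⟨_, Filter.inter_mem self_mem_nhdsWithin (mem_nhdsWithin_of_mem_nhds h3), ?_⟩
  refine measure_mono_null (fun z hz => ?_) (h1 (WS ξ ψ) ψ)
  exact mul_ne_zero hz.1 hz.2

theorem formD_apply_eq (ħ : ℝ) (a : Fin d ⊕ Fin d) (φ ψ : 𝓢(Space d, ℂ)) :
    ∃ (c₁ c₂ : ℂ) (φ' ψ' : 𝓢(Space d, ℂ)), ∀ q : Form d,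
      formD ħ a q φ ψ = c₁ * q φ' ψ + c₂ * q φ ψ' := by
  rcases a with j | j
  · exact ⟨(Complex.I * ħ)⁻¹, -(Complex.I * ħ)⁻¹, mulX j φ, mulX j ψ,
      fun q => by simp only [formD]; ring⟩
  · exact ⟨-1, -1, dX j φ, dX j ψ, fun q => by simp only [formD]; ring⟩

/-- Multiplying a matrix element of W(z) by `symb` amounts to changing φ and ψ into other Schwartz
functions, so integrability is preserved without any decay of h. -/
theorem integrable_symb_mul {h : Space d × Space d → ℂ}
    (hi : ∀ φ ψ : 𝓢(Space d, ℂ), Integrable fun z => h z * formOf (W z) φ ψ) (ħ : ℝ)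
    (a : Fin d ⊕ Fin d) (φ ψ : 𝓢(Space d, ℂ)) :
    (Integrable fun z => symb ħ a z * h z * formOf (W z) φ ψ) ∧
      formD ħ a (fun φ ψ => ∫ z, h z * formOf (W z) φ ψ) φ ψ =
        ∫ z, symb ħ a z * h z * formOf (W z) φ ψ := by
  obtain ⟨c₁, c₂, φ', ψ', hq⟩ := formD_apply_eq ħ a φ ψ
  have h1 : ∀ z, symb ħ a z * h z * formOf (W z) φ ψ =
      c₁ * (h z * formOf (W z) φ' ψ) + c₂ * (h z * formOf (W z) φ ψ') := fun z => by
    have h2 := formD_formOf_W ħ a z φ ψ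
    rw [hq] at h2
    linear_combination -(h z) * h2
  simp_rw [h1]
  refine ⟨((hi φ' ψ).const_mul c₁).add ((hi φ ψ').const_mul c₂), ?_⟩
  rw [hq, integral_add ((hi φ' ψ).const_mul c₁) ((hi φ ψ').const_mul c₂), integral_const_mul,
    integral_const_mul]

theorem iterD_integral {h : Space d × Space d → ℂ}
    (hi : ∀ φ ψ : 𝓢(Space d, ℂ), Integrable fun z => h z * formOf (W z) φ ψ) (ħ : ℝ) :
    ∀ (k : ℕ) (α : Fin k → Fin d ⊕ Fin d),
      (∀ φ ψ : 𝓢(Space d, ℂ), Integrable fun z => (∏ i, symb ħ (α i) z) * h z * formOf (W z) φ ψ) ∧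
      iterD ħ k α (fun φ ψ => ∫ z, h z * formOf (W z) φ ψ) =
        fun φ ψ => ∫ z, (∏ i, symb ħ (α i) z) * h z * formOf (W z) φ ψ
  | 0, α => by simpa [iterD] using hi
  | k + 1, α => by
    obtain ⟨h1, h2⟩ := iterD_integral hi ħ k fun i => α i.succ
    simp only [Fin.prod_univ_succ, mul_assoc]
    simp only [mul_assoc] at h1 h2
    refine ⟨fun φ ψ => ?_, ?_⟩
    · have := (integrable_symb_mul (h := fun z => (∏ i : Fin k, symb ħ (α i.succ) z) * h z)
        (by simpa only [mul_assoc] using h1) ħ (α 0) φ ψ).1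
      simpa only [mul_assoc] using this
    · funext φ ψ
      rw [iterD, h2]
      have := (integrable_symb_mul (h := fun z => (∏ i : Fin k, symb ħ (α i.succ) z) * h z)
        (by simpa only [mul_assoc] using h1) ħ (α 0) φ ψ).2
      simpa only [mul_assoc] using this

end Uniqueness

/-! ### Symbols of the quantum gradients of A. -/

section Gradient

variable {d : ℕ}

/-- The infimum ranges over at most one family by density of the Schwartz functions, and over at
least one because it is finite. -/
theorem gradNorm_eq_scaledNorm {ħ : ℝ} {p : ℝ≥0∞} {k : ℕ} {A : L2 d →L[ℂ] L2 d}
    (hA : gradNorm ħ p k A ≠ ∞) :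
    ∃ T : (Fin k → Fin d ⊕ Fin d) → L2 d →L[ℂ] L2 d,
      (∀ α, formOf (T α) = iterD ħ k α (formOf A)) ∧ gradNorm ħ p k A = scaledNorm ħ p T := by
  obtain ⟨T, hT⟩ : ∃ T : (Fin k → Fin d ⊕ Fin d) → L2 d →L[ℂ] L2 d,
      ∀ α, formOf (T α) = iterD ħ k α (formOf A) := by
    by_contra! h
    refine hA (iInf_eq_top.2 fun T => iInf_eq_top.2 fun hT => ?_)
    obtain ⟨α, hα⟩ := h T
    exact absurd (hT α) hα
  refine ⟨T, hT, le_antisymm (iInf₂_le T hT) (le_iInf₂ fun T' hT' => ?_)⟩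
  have h : T' = T := funext fun α => formOf_injective ((hT' α).trans (hT α).symm)
  rw [h]

theorem schattenNorm_ne_top_of_scaledNorm {ι : Type*} [Fintype ι] {ħ : ℝ} (hħ : 0 < ħ) {p : ℝ≥0∞}
    {T : ι → L2 d →L[ℂ] L2 d} (h : scaledNorm ħ p T ≠ ∞) : schattenNorm p T ≠ ∞ := by
  intro h1
  rw [scaledNorm, h1, ENNReal.mul_top] at h
  · exact h rfl
  · split_ifs
    · exact one_ne_zero
    · simpa using Real.rpow_pos_of_pos (by positivity) _

theorem dX_mulX (j k : Fin d) (φ : 𝓢(Space d, ℂ)) :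
    dX k (mulX j φ) = mulX j (dX k φ) + ((if j = k then 1 else 0 : ℝ) : ℂ) • φ := by
  ext x
  rw [add_apply, smul_apply, mulX_apply, dX, dX, SchwartzMap.lineDerivOp_apply,
    SchwartzMap.lineDerivOp_apply, lineDeriv, lineDeriv]
  simp_rw [mulX_apply]
  have h1 : HasDerivAt (fun t : ℝ => φ (x + t • EuclideanSpace.single k (1 : ℝ)))
      (deriv (fun t : ℝ => φ (x + t • EuclideanSpace.single k (1 : ℝ))) 0) 0 := by
    refine DifferentiableAt.hasDerivAt ?_
    have := φ.differentiable
    fun_prop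
  have h2 : HasDerivAt
      (fun t : ℝ => (((x + t • EuclideanSpace.single k (1 : ℝ) : Space d) j : ℝ) : ℂ))
      ((if j = k then 1 else 0 : ℝ) : ℂ) 0 := by
    refine HasDerivAt.ofReal_comp ?_
    have h3 := (hasDerivAt_id (0 : ℝ)).mul_const (if j = k then 1 else 0 : ℝ)
    have h4 := h3.const_add (x j)
    simpa [PiLp.add_apply, PiLp.smul_apply, Pi.single_apply] using h4
  have h5 := (h2.mul h1).deriv
  simp only [Pi.mul_def] at h5
  rw [h5]
  simp only [zero_smul, add_zero, smul_eq_mul]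
  ring

theorem mulX_mulX (j k : Fin d) (φ : 𝓢(Space d, ℂ)) : mulX j (mulX k φ) = mulX k (mulX j φ) := by
  ext x
  simp only [mulX_apply]
  ring

open FourierTransform

theorem mulX_smul (j : Fin d) (c : ℂ) (φ : 𝓢(Space d, ℂ)) : mulX j (c • φ) = c • mulX j φ := by
  ext x
  simp only [smul_apply, mulX_apply, smul_eq_mul]
  ring

theorem dX_dX (j k : Fin d) (φ : 𝓢(Space d, ℂ)) : dX j (dX k φ) = dX k (dX j φ) := by
  refine (FourierTransform.fourierCLE ℂ 𝓢(Space d, ℂ)).injective ?_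
  change 𝓕 (dX j (dX k φ)) = 𝓕 (dX k (dX j φ))
  rw [fourier_dX, fourier_dX, fourier_dX, fourier_dX, mulX_smul, mulX_mulX, mulX_smul]

theorem formOf_add_left (A : L2 d →L[ℂ] L2 d) (φ φ' ψ : 𝓢(Space d, ℂ)) :
    formOf A (φ + φ') ψ = formOf A φ ψ + formOf A φ' ψ := by
  rw [formOf, toLp_add', inner_add_left]; rfl

theorem formOf_add_right (A : L2 d →L[ℂ] L2 d) (φ ψ ψ' : 𝓢(Space d, ℂ)) :
    formOf A φ (ψ + ψ') = formOf A φ ψ + formOf A φ ψ' := by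
  rw [formOf, toLp_add', map_add, inner_add_right]; rfl

theorem formOf_real_smul_left (A : L2 d →L[ℂ] L2 d) (c : ℝ) (φ ψ : 𝓢(Space d, ℂ)) :
    formOf A ((c : ℂ) • φ) ψ = c * formOf A φ ψ := by
  rw [formOf, toLp_smul', inner_smul_left, Complex.conj_ofReal]; rfl

theorem formOf_smul_right (A : L2 d →L[ℂ] L2 d) (c : ℂ) (φ ψ : 𝓢(Space d, ℂ)) :
    formOf A φ (c • ψ) = c * formOf A φ ψ := by
  rw [formOf, toLp_smul', map_smul, inner_smul_right]; rfl

/-- The commutators [x_j, ∂_k] are scalar, so the terms they produce on the two sides of the form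
cancel. -/
theorem formD_comm (ħ : ℝ) (a b : Fin d ⊕ Fin d) (A : L2 d →L[ℂ] L2 d) :
    formD ħ a (formD ħ b (formOf A)) = formD ħ b (formD ħ a (formOf A)) := by
  funext φ ψ
  rcases a with j | j <;> rcases b with k | k
  · simp only [formD, mulX_mulX k j]; ring
  · simp only [formD, dX_mulX, formOf_add_left, formOf_add_right, formOf_real_smul_left,
      formOf_smul_right]
    ring
  · simp only [formD, dX_mulX, formOf_add_left, formOf_add_right, formOf_real_smul_left,
      formOf_smul_right]
    ring
  · simp only [formD, dX_dX k j]; ring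

theorem iterD_succ_last (ħ : ℝ) : ∀ (k : ℕ) (α : Fin (k + 1) → Fin d ⊕ Fin d) (q : Form d),
    iterD ħ (k + 1) α q = iterD ħ k (fun i => α i.castSucc) (formD ħ (α (Fin.last k)) q)
  | 0, _, _ => rfl
  | k + 1, α, q => by
    rw [iterD, iterD_succ_last ħ k (fun i => α i.succ) q, iterD]
    rfl

theorem integrable_mul_formOf {f : Space d × Space d → ℂ} (hf : MemLp f 2)
    (φ ψ : 𝓢(Space d, ℂ)) : Integrable fun z => f z * formOf (W z) φ ψ :=
  integrable_mul_V hf _ _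

/-- The symbols of the components of the quantum gradient of `A`, with the Sobolev bounds
they inherit from the Hilbert–Schmidt norms of the gradients. -/
theorem exists_gradient_symbol {ħ : ℝ} {n : ℕ} {A : L2 d →L[ℂ] L2 d}
    {T₁ : (Fin 1 → Fin d ⊕ Fin d) → L2 d →L[ℂ] L2 d}
    (hT₁ : ∀ α, formOf (T₁ α) = iterD ħ 1 α (formOf A)) (h₁ : schattenNorm 2 T₁ ≠ ∞)
    {T₂ : (Fin (n + 1) → Fin d ⊕ Fin d) → L2 d →L[ℂ] L2 d}
    (hT₂ : ∀ α, formOf (T₂ α) = iterD ħ (n + 1) α (formOf A)) (h₂ : schattenNorm 2 T₂ ≠ ∞) :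
    ∃ f : Fin d ⊕ Fin d → Space d × Space d → ℂ, (∀ a, MemLp (f a) 2) ∧
      (∀ a, eLpNorm (f a) 2 volume ≤ schattenNorm 2 T₁) ∧
      (∀ a b, eLpNorm (fun z => symb ħ b z ^ n * f a z) 2 volume ≤ schattenNorm 2 T₂) ∧
      (∀ a b, ∀ᵐ z, symb ħ b z * f a z = symb ħ a z * f b z) ∧
      ∀ a φ ψ, ⟪φ, T₁ (fun _ => a) ψ⟫_ℂ = ∫ z, f a z * V φ ψ z := by
  choose f hf hfn hfT using fun a => exists_symbol_of_schattenNorm h₁ fun _ : Fin 1 => a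
  choose g hg hgn hgT using fun α => exists_symbol_of_schattenNorm h₂ α
  have hfa : ∀ a, formD ħ a (formOf A) = fun φ ψ => ∫ z, f a z * formOf (W z) φ ψ := by
    intro a
    have h := hT₁ fun _ => a
    simp only [iterD] at h
    rw [← h]
    funext φ ψ
    exact hfT a _ _
  have hunique : ∀ {u v : Space d × Space d → ℂ},
      (∀ φ ψ : 𝓢(Space d, ℂ), Integrable fun z => u z * formOf (W z) φ ψ) →
      (∀ φ ψ : 𝓢(Space d, ℂ), Integrable fun z => v z * formOf (W z) φ ψ) →
      (∀ φ ψ : 𝓢(Space d, ℂ), ∫ z, u z * formOf (W z) φ ψ = ∫ z, v z * formOf (W z) φ ψ) →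
      ∀ᵐ z, u z = v z := by
    intro u v hu hv huv
    have := symbol_ae_eq_zero (h := fun z => u z - v z)
      (fun φ ψ => by simp only [sub_mul]; exact (hu φ ψ).sub (hv φ ψ))
      (fun φ ψ => by
        simp only [sub_mul]
        rw [integral_sub (hu φ ψ) (hv φ ψ), huv, sub_self])
    exact this.mono fun z hz => sub_eq_zero.1 hz
  refine ⟨f, hf, hfn, fun a b => ?_, fun a b => ?_, hfT⟩
  · let α : Fin (n + 1) → Fin d ⊕ Fin d := fun i => if i = Fin.last n then a else b
    have hα : iterD ħ (n + 1) α (formOf A) =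
        iterD ħ n (fun _ => b) (fun φ ψ => ∫ z, f a z * formOf (W z) φ ψ) := by
      rw [iterD_succ_last, ← hfa]
      simp [α, (Fin.castSucc_lt_last _).ne]
    obtain ⟨h3, h4⟩ := iterD_integral (integrable_mul_formOf (hf a)) ħ n fun _ => b
    have h5 := hunique h3 (integrable_mul_formOf (hg α)) fun φ ψ => by
      have h6 := congrFun (congrFun ((hT₂ α).trans (hα.trans h4)) φ) ψ
      exact h6.symm.trans (hgT α _ _)
    refine le_of_eq_of_le (eLpNorm_congr_ae ?_) (hgn α)
    filter_upwards [h5] with z hz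
    rw [← hz, Finset.prod_const, Finset.card_univ, Fintype.card_fin]
  · refine hunique (fun φ ψ => (integrable_symb_mul (integrable_mul_formOf (hf a)) ħ b φ ψ).1)
      (fun φ ψ => (integrable_symb_mul (integrable_mul_formOf (hf b)) ħ a φ ψ).1) fun φ ψ => ?_
    rw [← (integrable_symb_mul (integrable_mul_formOf (hf a)) ħ b φ ψ).2,
      ← (integrable_symb_mul (integrable_mul_formOf (hf b)) ħ a φ ψ).2, ← hfa, ← hfa, formD_comm]

end Gradient

/-! ### Interpolation of the L¹ norm of a symbol on the phase space. -/

section Sobolev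

variable {d : ℕ}

theorem lintegral_comp_smul_space {J : Space d → ℝ≥0∞} (hJ : Measurable J) {a : ℝ} (ha : 0 < a) :
    ∫⁻ x, J (a • x) = ENNReal.ofReal ((a ^ d)⁻¹) * ∫⁻ x, J x := by
  have h := Measure.map_addHaar_smul (volume : Measure (Space d)) ha.ne'
  rw [finrank_euclideanSpace_fin, abs_of_pos (by positivity)] at h
  have h2 : ∫⁻ x, J (a • x) = ∫⁻ y, J y ∂(Measure.map (fun x : Space d => a • x) volume) :=
    (lintegral_map hJ (measurable_const_smul a)).symm
  rw [h2]
  erw [h]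
  rw [lintegral_smul_measure, smul_eq_mul]

theorem lintegral_comp_smul_prod {J : Space d × Space d → ℝ≥0∞} (hJ : Measurable J) {a b : ℝ}
    (ha : 0 < a) (hb : 0 < b) :
    ∫⁻ z : Space d × Space d, J (a • z.1, b • z.2) =
      ENNReal.ofReal ((a ^ d)⁻¹ * (b ^ d)⁻¹) * ∫⁻ z, J z := by
  rw [Measure.volume_eq_prod, lintegral_prod _ (by fun_prop), lintegral_prod _ (by fun_prop)]
  have h1 : ∀ r : Space d, ∫⁻ s, J (a • r, b • s) =
      ENNReal.ofReal ((b ^ d)⁻¹) * ∫⁻ s, J (a • r, s) := fun r =>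
    lintegral_comp_smul_space (J := fun s => J (a • r, s)) (by fun_prop) hb
  simp_rw [h1]
  rw [lintegral_const_mul' _ _ ENNReal.ofReal_ne_top,
    lintegral_comp_smul_space (J := fun r => ∫⁻ s, J (r, s)) hJ.lintegral_prod_right' ha,
    ← mul_assoc, ← ENNReal.ofReal_mul (by positivity), mul_comm (b ^ d)⁻¹]

/-- The sum of the `k`-th powers of the coordinates. -/
def powSum (k : ℕ) (z : Space d × Space d) : ℝ := ∑ j, |z.1 j| ^ k + ∑ j, |z.2 j| ^ k

theorem powSum_nonneg (k : ℕ) (z : Space d × Space d) : 0 ≤ powSum k z := by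
  unfold powSum; positivity

theorem continuous_powSum (k : ℕ) : Continuous (powSum (d := d) k) := by
  unfold powSum; fun_prop

theorem norm_le_sum_abs (x : Space d) : ‖x‖ ≤ ∑ j, |x j| := by
  have h : x = ∑ j, x j • EuclideanSpace.single j (1 : ℝ) := by
    have := (EuclideanSpace.basisFun (Fin d) ℝ).sum_repr x
    simpa using this.symm
  conv_lhs => rw [h]
  refine (norm_sum_le _ _).trans (Finset.sum_le_sum fun j _ => ?_)
  simp [norm_smul]

/-- Power mean inequality for the 1 + 2d numbers consisting of 1 and the absolute values of the
coordinates. -/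
theorem one_add_norm_pow_le (k : ℕ) (z : Space d × Space d) :
    (1 + ‖z‖) ^ (k + 1) ≤ (1 + 2 * d) ^ k * (1 + powSum (k + 1) z) := by
  let u : Option (Fin d ⊕ Fin d) → ℝ := fun o =>
    o.elim 1 (Sum.elim (fun j => |z.1 j|) fun j => |z.2 j|)
  have h0 : ∀ o ∈ Finset.univ, 0 ≤ u o := by
    rintro (_ | j | j) _ <;> simp [u]
  have h := pow_sum_div_card_le_sum_pow h0 k
  have hcard : ((Finset.univ : Finset (Option (Fin d ⊕ Fin d))).card : ℝ) = 1 + 2 * d := by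
    simp only [Finset.card_univ, Fintype.card_option, Fintype.card_sum, Fintype.card_fin]
    push_cast; ring
  have hsum : ∀ m : ℕ, ∑ o, u o ^ m = 1 + powSum m z := fun m => by
    simp [u, Fintype.sum_option, powSum]
  have h1 := hsum 1
  simp only [pow_one] at h1
  rw [hcard, hsum, h1, div_le_iff₀ (by positivity), mul_comm] at h
  refine le_trans ?_ h
  have h2 : ‖z‖ ≤ powSum 1 z := by
    have h3 := norm_le_sum_abs z.1
    have h4 := norm_le_sum_abs z.2
    have h5 : 0 ≤ ∑ j, |z.1 j| := by positivity
    have h6 : 0 ≤ ∑ j, |z.2 j| := by positivity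
    simp only [powSum, pow_one]
    exact max_le (by linarith) (by linarith)
  gcongr

/-- Decay of order 2n in dimension 2d: integrability uses n > d. -/
theorem lintegral_powSum_lt_top {n : ℕ} (hn : d < n) :
    ∫⁻ z : Space d × Space d, ENNReal.ofReal (1 + powSum (2 * n) z)⁻¹ < ∞ := by
  have : (volume : Measure (Space d × Space d)).IsAddHaarMeasure := by
    rw [Measure.volume_eq_prod]; infer_instance
  have h1 := integrable_one_add_norm (E := Space d × Space d) (μ := volume) (r := (2 * n : ℕ)) (by
    rw [Module.finrank_prod, finrank_euclideanSpace_fin, ← two_mul]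
    exact_mod_cast (by lia))
  have h2 := (h1.const_mul ((1 + 2 * d : ℝ) ^ (2 * n - 1))).lintegral_lt_top
  refine lt_of_le_of_lt (lintegral_mono fun z => ENNReal.ofReal_le_ofReal ?_) h2
  have h3 := one_add_norm_pow_le (2 * n - 1) z
  rw [show 2 * n - 1 + 1 = 2 * n by lia] at h3
  have h4 := powSum_nonneg (2 * n) z
  rw [Real.rpow_neg (by positivity), Real.rpow_natCast, ← div_eq_mul_inv,
    inv_le_comm₀ (by positivity) (by positivity), inv_div, div_le_iff₀ (by positivity)]
  linarith

/-- Rescaling r by t/ħ and s by 2πt removes ħ and t from the weight; the change of variables costs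
the factor (ħ/2π)^d t^{-2d}. -/
theorem sum_norm_symb_pow {ħ : ℝ} (hħ : 0 < ħ) (k : ℕ) {t : ℝ} (ht : 0 < t)
    (z : Space d × Space d) :
    ∑ a, (t * ‖symb ħ a z‖) ^ k = powSum k ((t / ħ) • z.1, (t * (2 * Real.pi)) • z.2) := by
  have hπ := Real.pi_pos
  rw [Fintype.sum_sum_type, powSum]
  congr 1 <;> refine Finset.sum_congr rfl fun j _ => ?_
  · congr 1
    simp only [symb, norm_mul, norm_inv, Complex.norm_I, Complex.norm_real, Real.norm_eq_abs,
      PiLp.smul_apply, smul_eq_mul, abs_mul, abs_div, abs_of_pos hħ, abs_of_pos ht]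
    field_simp
  · congr 1
    simp only [symb, norm_mul, Complex.norm_I, Complex.norm_real, Real.norm_eq_abs,
      PiLp.smul_apply, smul_eq_mul, abs_mul, abs_of_pos hπ, abs_of_pos ht, Complex.norm_ofNat,
      Nat.abs_ofNat]
    ring

theorem measurable_symb (ħ : ℝ) (a : Fin d ⊕ Fin d) : Measurable (symb (d := d) ħ a) := by
  rcases a with j | j
  · have : Continuous fun z : Space d × Space d => (Complex.I * ħ)⁻¹ * (z.1 j : ℂ) := by fun_prop
    exact this.measurable
  · have : Continuous fun z : Space d × Space d => 2 * Real.pi * Complex.I * (z.2 j : ℂ) := by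
      fun_prop
    exact this.measurable

theorem lintegral_enorm_sq_le {f : Space d × Space d → ℂ} {S : ℝ≥0∞}
    (h : eLpNorm f 2 volume ≤ S) : ∫⁻ z, ‖f z‖ₑ ^ 2 ≤ S ^ 2 := by
  have e1 := eLpNorm_nnreal_pow_eq_lintegral (f := f)
    (μ := (volume : Measure (Space d × Space d))) (p := 2) two_ne_zero
  simp only [ENNReal.coe_ofNat, NNReal.coe_ofNat, ENNReal.rpow_ofNat] at e1
  rw [← e1]
  gcongr

/-- The constant in the interpolation inequality. -/
def interpConst (d n : ℕ) : ℝ :=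
  (∫⁻ z : Space d × Space d, ENNReal.ofReal (1 + powSum (2 * n) z)⁻¹).toReal + 1

/-- Weighted Cauchy–Schwarz with w = 1 + ∑ (t |symb_a|)^{2n}: the integral of |f|² w is controlled
by S₁ and t^n S₂, that of 1/w by scaling. Optimizing t produces the interpolation. -/
theorem lintegral_enorm_le_of_pos {n : ℕ} (hn : d < n) {ħ : ℝ} (hħ : 0 < ħ)
    {f : Space d × Space d → ℂ} (hf : AEStronglyMeasurable f) {S₁ S₂ : ℝ} (hS₁ : 0 < S₁)
    (hS₂ : 0 < S₂) (h₁ : eLpNorm f 2 volume ≤ ENNReal.ofReal S₁)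
    (h₂ : ∀ b, eLpNorm (fun z => symb ħ b z ^ n * f z) 2 volume ≤ ENNReal.ofReal S₂) :
    ∫⁻ z, ‖f z‖ₑ ≤ ENNReal.ofReal ((1 + d) * √((ħ / (2 * Real.pi)) ^ d * interpConst d n) *
      (S₂ ^ ((d : ℝ) / n) * S₁ ^ (1 - (d : ℝ) / n))) := by
  have hπ := Real.pi_pos
  have hn0 : (n : ℝ) ≠ 0 := by
    have : 0 < n := by lia
    positivity
  set κ := interpConst d n with hκ
  -- The term +1 in `interpConst` provides this positivity directly.
  have hκ0 : 0 < κ := by rw [hκ, interpConst]; positivity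
  -- Chosen so that t^n S₂ = S₁: each of the 2d derivative terms then costs at most S₁².
  set t : ℝ := (S₁ / S₂) ^ ((n : ℝ)⁻¹) with ht
  have ht0 : 0 < t := by positivity
  have htn : t ^ n = S₁ / S₂ := by
    rw [ht, ← Real.rpow_natCast, ← Real.rpow_mul (by positivity), inv_mul_cancel₀ hn0,
      Real.rpow_one]
  let w : Space d × Space d → ℝ := fun z => 1 + ∑ a, (t * ‖symb ħ a z‖) ^ (2 * n)
  have hw : ∀ z, 0 < w z := fun z => by positivity
  have hwm : Measurable w := by
    have := measurable_symb (d := d) ħ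
    fun_prop
  set D : ℝ := √((ħ / (2 * Real.pi)) ^ d * κ) with hD
  have hD0 : 0 < D := by positivity
  have hY : ∫⁻ z, ENNReal.ofReal (w z)⁻¹ ≤ ENNReal.ofReal ((D * (t ^ d)⁻¹) ^ 2) := by
    simp_rw [w, sum_norm_symb_pow hħ (2 * n) ht0]
    rw [lintegral_comp_smul_prod (J := fun z => ENNReal.ofReal (1 + powSum (2 * n) z)⁻¹) (by
      have := (continuous_powSum (d := d) (2 * n)).measurable
      fun_prop) (by positivity) (by positivity),
      ← ENNReal.ofReal_toReal (lintegral_powSum_lt_top hn).ne, ← ENNReal.ofReal_mul (by positivity)]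
    refine ENNReal.ofReal_le_ofReal ?_
    have h3 : ((t / ħ) ^ d)⁻¹ * ((t * (2 * Real.pi)) ^ d)⁻¹ =
        (ħ / (2 * Real.pi)) ^ d * ((t ^ d)⁻¹) ^ 2 := by
      simp only [div_pow, mul_pow]
      field_simp
    rw [h3, mul_pow, hD, Real.sq_sqrt (by positivity)]
    have h4 : (∫⁻ z : Space d × Space d, ENNReal.ofReal (1 + powSum (2 * n) z)⁻¹).toReal ≤ κ := by
      rw [hκ, interpConst]; linarith
    nlinarith [mul_le_mul_of_nonneg_left h4
      (show 0 ≤ (ħ / (2 * Real.pi)) ^ d * ((t ^ d)⁻¹) ^ 2 by positivity)]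
  have hX : ∫⁻ z, ‖f z‖ₑ ^ 2 * ENNReal.ofReal (w z) ≤ ENNReal.ofReal ((1 + 2 * d) * S₁ ^ 2) := by
    have h3 : ∀ z, ‖f z‖ₑ ^ 2 * ENNReal.ofReal (w z) = ‖f z‖ₑ ^ 2 +
        ∑ a, ENNReal.ofReal ((t ^ n) ^ 2) * ‖symb ħ a z ^ n * f z‖ₑ ^ 2 := fun z => by
      simp only [w]
      rw [ENNReal.ofReal_add zero_le_one (by positivity),
        ENNReal.ofReal_sum_of_nonneg (fun _ _ => by positivity), mul_add, ENNReal.ofReal_one,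
        mul_one,
        Finset.mul_sum]
      congr 1
      refine Finset.sum_congr rfl fun a _ => ?_
      have h4 : ENNReal.ofReal ((t * ‖symb ħ a z‖) ^ (2 * n)) =
          ENNReal.ofReal ((t ^ n) ^ 2) * (‖symb ħ a z‖ₑ ^ n) ^ 2 := by
        rw [← ofReal_norm (symb ħ a z), ← ENNReal.ofReal_pow (by positivity),
          ← ENNReal.ofReal_pow (by positivity), ← ENNReal.ofReal_mul (by positivity)]
        congr 1
        ring
      rw [h4, enorm_mul, enorm_pow]
      ring
    simp_rw [h3]
    have hsm : ∀ a, AEMeasurable fun z =>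
        ENNReal.ofReal ((t ^ n) ^ 2) * ‖symb ħ a z ^ n * f z‖ₑ ^ 2 := fun a => by
      have := measurable_symb (d := d) ħ a
      have := hf.aemeasurable
      fun_prop
    rw [lintegral_add_right' _ (by
        exact Finset.aemeasurable_fun_sum _ fun a _ => hsm a),
      lintegral_finsetSum' _ fun a _ => hsm a]
    have h4 : ∀ a, ∫⁻ z, ENNReal.ofReal ((t ^ n) ^ 2) * ‖symb ħ a z ^ n * f z‖ₑ ^ 2 ≤
        ENNReal.ofReal (S₁ ^ 2) := fun a => by
      rw [lintegral_const_mul' _ _ ENNReal.ofReal_ne_top]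
      refine (mul_le_mul_right (lintegral_enorm_sq_le (h₂ a)) _).trans ?_
      rw [← ENNReal.ofReal_pow hS₂.le, ← ENNReal.ofReal_mul (by positivity), htn]
      refine ENNReal.ofReal_le_ofReal (le_of_eq ?_)
      field_simp
    refine (add_le_add (lintegral_enorm_sq_le h₁) (Finset.sum_le_sum fun a _ => h4 a)).trans ?_
    rw [Finset.sum_const, Finset.card_univ, Fintype.card_sum, Fintype.card_fin, nsmul_eq_mul,
      ← ENNReal.ofReal_natCast, ← ENNReal.ofReal_mul (by positivity), ← ENNReal.ofReal_pow hS₁.le,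
      ← ENNReal.ofReal_add (by positivity) (by positivity)]
    refine ENNReal.ofReal_le_ofReal (le_of_eq ?_)
    push_cast; ring
  -- The parameter of Young's inequality |f| ≤ (s/2) |f|² w + 1/(2 s w). It balances the two
  -- integrals up to the factor 1 + 2d, and their sum gives 1 + d.
  set s : ℝ := D * (t ^ d)⁻¹ / S₁ with hs
  have hs0 : 0 < s := by positivity
  have hpt : ∀ z, ‖f z‖ₑ ≤ ENNReal.ofReal (s / 2) * (‖f z‖ₑ ^ 2 * ENNReal.ofReal (w z)) +
      ENNReal.ofReal (1 / (2 * s)) * ENNReal.ofReal (w z)⁻¹ := fun z => by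
    have hwz := hw z
    rw [← ofReal_norm, ← ENNReal.ofReal_pow (norm_nonneg _), ← ENNReal.ofReal_mul (by positivity),
      ← ENNReal.ofReal_mul (by positivity), ← ENNReal.ofReal_mul (by positivity),
      ← ENNReal.ofReal_add (by positivity) (by positivity)]
    refine ENNReal.ofReal_le_ofReal ?_
    have h3 : s / 2 * (‖f z‖ ^ 2 * w z) + 1 / (2 * s) * (w z)⁻¹ - ‖f z‖ =
        (s * w z * ‖f z‖ - 1) ^ 2 / (2 * s * w z) := by
      field_simp; ring
    have h4 : 0 ≤ (s * w z * ‖f z‖ - 1) ^ 2 / (2 * s * w z) := by positivity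
    linarith
  calc ∫⁻ z, ‖f z‖ₑ ≤ ∫⁻ z, (ENNReal.ofReal (s / 2) * (‖f z‖ₑ ^ 2 * ENNReal.ofReal (w z)) +
        ENNReal.ofReal (1 / (2 * s)) * ENNReal.ofReal (w z)⁻¹) := lintegral_mono hpt
    _ = ENNReal.ofReal (s / 2) * (∫⁻ z, ‖f z‖ₑ ^ 2 * ENNReal.ofReal (w z)) +
        ENNReal.ofReal (1 / (2 * s)) * ∫⁻ z, ENNReal.ofReal (w z)⁻¹ := by
        rw [lintegral_add_right _ (by fun_prop), lintegral_const_mul' _ _ ENNReal.ofReal_ne_top,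
          lintegral_const_mul' _ _ ENNReal.ofReal_ne_top]
    _ ≤ ENNReal.ofReal (s / 2) * ENNReal.ofReal ((1 + 2 * d) * S₁ ^ 2) +
        ENNReal.ofReal (1 / (2 * s)) * ENNReal.ofReal ((D * (t ^ d)⁻¹) ^ 2) := by gcongr
    _ = _ := by
        rw [← ENNReal.ofReal_mul (by positivity), ← ENNReal.ofReal_mul (by positivity),
          ← ENNReal.ofReal_add (by positivity) (by positivity)]
        congr 1
        have h5 : S₂ ^ ((d : ℝ) / n) * S₁ ^ (1 - (d : ℝ) / n) = S₁ * (t ^ d)⁻¹ := by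
          rw [ht, ← Real.rpow_natCast, ← Real.rpow_mul (by positivity), ← Real.rpow_neg
            (by positivity), Real.div_rpow hS₁.le hS₂.le, Real.rpow_sub hS₁, Real.rpow_one,
            Real.rpow_neg hS₁.le, Real.rpow_neg hS₂.le,
            show (n : ℝ)⁻¹ * d = d / n by ring]
          field_simp
        rw [h5, hs]
        field_simp
        ring

/-- Vanishing norms are included by replacing S₁ and S₂ with S₁ + ε and S₂ + ε and letting ε tend to
0. -/
theorem lintegral_enorm_le {n : ℕ} (hd : 1 ≤ d) (hn : d < n) {ħ : ℝ} (hħ : 0 < ħ)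
    {f : Space d × Space d → ℂ} (hf : AEStronglyMeasurable f) {S₁ S₂ : ℝ≥0∞} (hS₁ : S₁ ≠ ∞)
    (hS₂ : S₂ ≠ ∞) (h₁ : eLpNorm f 2 volume ≤ S₁)
    (h₂ : ∀ b, eLpNorm (fun z => symb ħ b z ^ n * f z) 2 volume ≤ S₂) :
    ∫⁻ z, ‖f z‖ₑ ≤ ENNReal.ofReal ((1 + d) * √((ħ / (2 * Real.pi)) ^ d * interpConst d n)) *
      (S₂ ^ ((d : ℝ) / n) * S₁ ^ (1 - (d : ℝ) / n)) := by
  have hn0 : (0 : ℝ) < n := by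
    have : 0 < n := by lia
    positivity
  have hθ0 : 0 < (d : ℝ) / n := div_pos (by exact_mod_cast hd) hn0
  have hθ1 : 0 < 1 - (d : ℝ) / n := by
    rw [sub_pos, div_lt_one hn0]; exact_mod_cast hn
  lift S₁ to ℝ≥0 using hS₁
  lift S₂ to ℝ≥0 using hS₂
  set c := (1 + d) * √((ħ / (2 * Real.pi)) ^ d * interpConst d n)
  have hc : Continuous fun ε : ℝ => ENNReal.ofReal
      (c * ((S₂ + ε) ^ ((d : ℝ) / n) * (S₁ + ε) ^ (1 - (d : ℝ) / n))) := by
    refine ENNReal.continuous_ofReal.comp (continuous_const.mul (Continuous.mul ?_ ?_))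
    · exact (continuous_const.add continuous_id).rpow_const fun _ => Or.inr hθ0.le
    · exact (continuous_const.add continuous_id).rpow_const fun _ => Or.inr hθ1.le
  have h3 : ∫⁻ z, ‖f z‖ₑ ≤ ENNReal.ofReal
      (c * (((S₂ : ℝ) + 0) ^ ((d : ℝ) / n) * ((S₁ : ℝ) + 0) ^ (1 - (d : ℝ) / n))) := by
    refine ge_of_tendsto ((hc.tendsto 0).mono_left (nhdsWithin_le_nhds (s := Set.Ioi 0))) ?_
    filter_upwards [self_mem_nhdsWithin] with ε hε
    have hε' : (0 : ℝ) < ε := hε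
    have h4 : ∀ S : ℝ≥0, (S : ℝ≥0∞) ≤ ENNReal.ofReal (S + ε) := fun S => by
      rw [← ENNReal.ofReal_coe_nnreal]
      exact ENNReal.ofReal_le_ofReal (by linarith)
    exact lintegral_enorm_le_of_pos hn hħ hf (by positivity) (by positivity) (h₁.trans (h4 _))
      fun b => (h₂ b).trans (h4 _)
  refine h3.trans (le_of_eq ?_)
  rw [add_zero, add_zero, ENNReal.ofReal_mul (p := c) (by positivity),
    ENNReal.ofReal_mul (p := (S₂ : ℝ) ^ ((d : ℝ) / n)) (by positivity),
    ← ENNReal.ofReal_rpow_of_nonneg (by positivity) hθ0.le,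
    ← ENNReal.ofReal_rpow_of_nonneg (by positivity) hθ1.le, ENNReal.ofReal_coe_nnreal,
    ENNReal.ofReal_coe_nnreal]

end Sobolev

/-! ### Superpositions of commutators with isometries. -/

section Commutators

variable {H D Ω : Type*} [NormedAddCommGroup H] [InnerProductSpace ℂ H] [CompleteSpace H]
  {J : D → H} [MeasurableSpace Ω] {μ : Measure Ω}

/-- If the commutator of a generator with `A` is a superposition of the commutators of the
generator with isometries `W ω`, then the same holds for the commutators with the group. -/
theorem CoreGroup.inner_commutator_eq_integral [SFinite μ] (𝒢 : CoreGroup J) (hJ : DenseRange J)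
    {A S : H →L[ℂ] H} {W : Ω → H →L[ℂ] H} {a σ : Ω → ℂ} (hW : ∀ ω v, ‖W ω v‖ = ‖v‖)
    (hS : ∀ φ ψ, ⟪J φ, S (J ψ)⟫_ℂ = -⟪J (𝒢.G φ), A (J ψ)⟫_ℂ - ⟪J φ, A (J (𝒢.G ψ))⟫_ℂ)
    (hσ : ∀ ω φ ψ, ⟪J φ, (σ ω • W ω) (J ψ)⟫_ℂ =
      -⟪J (𝒢.G φ), W ω (J ψ)⟫_ℂ - ⟪J φ, W ω (J (𝒢.G ψ))⟫_ℂ)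
    (ha : Integrable (fun ω => a ω * σ ω) μ)
    (hSa : ∀ f g, ⟪f, S g⟫_ℂ = ∫ ω, a ω * σ ω * ⟪f, W ω g⟫_ℂ ∂μ)
    (hm : ∀ f g, AEStronglyMeasurable
      (fun q : ℝ × Ω => ⟪𝒢.U (-q.1) f, W q.2 (𝒢.U (1 - q.1) g)⟫_ℂ)
      ((volume.restrict (Set.Ioc 0 1)).prod μ)) (f g : H) :
    Integrable (fun ω => a ω * ⟪f, (𝒢.U 1 * W ω - W ω * 𝒢.U 1) g⟫_ℂ) μ ∧
      ⟪f, (𝒢.U 1 * A - A * 𝒢.U 1) g⟫_ℂ =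
        ∫ ω, a ω * ⟪f, (𝒢.U 1 * W ω - W ω * 𝒢.U 1) g⟫_ℂ ∂μ := by
  -- Only a σ is assumed integrable, not a; Duhamel's formula supplies the factor σ that makes
  -- Fubini applicable.
  have hint : Integrable (fun q : ℝ × Ω => a q.2 * σ q.2 *
      ⟪𝒢.U (-q.1) f, W q.2 (𝒢.U (1 - q.1) g)⟫_ℂ) ((volume.restrict (Set.Ioc 0 1)).prod μ) := by
    refine (ha.comp_snd (volume.restrict (Set.Ioc 0 1))).mul_bdd (c := ‖f‖ * ‖g‖) (hm f g)
      (.of_forall fun q => (norm_inner_le_norm _ _).trans_eq ?_)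
    rw [hW, 𝒢.norm_U, 𝒢.norm_U]
  have h1 : ∀ ω, a ω * ⟪f, (𝒢.U 1 * W ω - W ω * 𝒢.U 1) g⟫_ℂ =
      ∫ t in Set.Ioc (0 : ℝ) 1, a ω * σ ω * ⟪𝒢.U (-t) f, W ω (𝒢.U (1 - t) g)⟫_ℂ := fun ω => by
    rw [(𝒢.exists_integral hJ (hσ ω) f g).2, ← integral_const_mul]
    refine integral_congr_ae (.of_forall fun t => ?_)
    change a ω * ⟪f, 𝒢.U t (σ ω • W ω (𝒢.U (1 - t) g))⟫_ℂ =
      a ω * σ ω * ⟪𝒢.U (-t) f, W ω (𝒢.U (1 - t) g)⟫_ℂ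
    rw [← 𝒢.inner_U_neg, inner_smul_right, mul_assoc]
  simp_rw [h1]
  refine ⟨hint.integral_prod_right, ?_⟩
  rw [(𝒢.exists_integral hJ hS f g).2, ← integral_integral_swap hint]
  refine integral_congr_ae (.of_forall fun t => ?_)
  change ⟪f, 𝒢.U t (S (𝒢.U (1 - t) g))⟫_ℂ = _
  rw [← 𝒢.inner_U_neg, hSa]

/-- The difference between `A` and the superposition of the operators `W ω - 1`, at the vector
`v`. -/
def superpositionDiff (μ : Measure Ω) (A : H →L[ℂ] H) (a : Ω → ℂ) (W : Ω → H →L[ℂ] H) (v : H) : H :=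
  A v - ∫ ω, a ω • (W ω v - v) ∂μ

theorem continuous_sub_const {X E : Type*} [TopologicalSpace X] [NormedAddCommGroup E] {f : X → E}
    (hf : Continuous f) (v : E) : Continuous fun x => f x - v := hf.sub continuous_const

/-- The commutator of `A` with `X` minus the superposition of those of the `W ω` with `X`, in terms
of the difference of `A` and the (renormalized) superposition of the `W ω`. -/
theorem inner_sub_integral_eq {A X : H →L[ℂ] H} {W : Ω → H →L[ℂ] H} {a : Ω → ℂ} {φ ψ : H}
    (h₁ : Integrable (fun ω => a ω • (W ω ψ - ψ)) μ)
    (h₂ : Integrable (fun ω => starRingEnd ℂ (a ω) • (star (W ω) φ - φ)) μ) :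
    ⟪superpositionDiff μ (star A) (fun ω => starRingEnd ℂ (a ω)) (fun ω => star (W ω)) φ, X ψ⟫_ℂ -
        ⟪φ, X (superpositionDiff μ A a W ψ)⟫_ℂ =
      ⟪φ, (A * X - X * A) ψ⟫_ℂ - ∫ ω, a ω * ⟪φ, (W ω * X - X * W ω) ψ⟫_ℂ ∂μ := by
  have e1 : ⟪∫ ω, starRingEnd ℂ (a ω) • (star (W ω) φ - φ) ∂μ, X ψ⟫_ℂ =
      ∫ ω, a ω * (⟪φ, W ω (X ψ)⟫_ℂ - ⟪φ, X ψ⟫_ℂ) ∂μ := by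
    rw [← inner_conj_symm, ← integral_inner h₂, ← integral_conj]
    refine integral_congr_ae (.of_forall fun ω => ?_)
    simp only
    rw [inner_conj_symm, inner_smul_left, Complex.conj_conj, inner_sub_left,
      ContinuousLinearMap.star_eq_adjoint, ContinuousLinearMap.adjoint_inner_left]
  have i1 : Integrable (fun ω => a ω * (⟪φ, W ω (X ψ)⟫_ℂ - ⟪φ, X ψ⟫_ℂ)) μ := by
    refine (h₂.inner_const (𝕜 := ℂ) (X ψ)).congr (.of_forall fun ω => ?_)
    simp only
    rw [inner_smul_left, Complex.conj_conj, inner_sub_left,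
      ContinuousLinearMap.star_eq_adjoint, ContinuousLinearMap.adjoint_inner_left]
  have h₃ := X.integrable_comp h₁
  have e2 : ⟪φ, X (∫ ω, a ω • (W ω ψ - ψ) ∂μ)⟫_ℂ =
      ∫ ω, a ω * (⟪φ, X (W ω ψ)⟫_ℂ - ⟪φ, X ψ⟫_ℂ) ∂μ := by
    rw [← X.integral_comp_comm h₁, ← integral_inner h₃]
    refine integral_congr_ae (.of_forall fun ω => ?_)
    simp only [map_smul, map_sub, inner_smul_right, inner_sub_right]
  have i2 : Integrable (fun ω => a ω * (⟪φ, X (W ω ψ)⟫_ℂ - ⟪φ, X ψ⟫_ℂ)) μ := by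
    refine (h₃.const_inner (𝕜 := ℂ) φ).congr (.of_forall fun ω => ?_)
    simp only [map_smul, map_sub, inner_smul_right, inner_sub_right]
  -- The subtraction of 1 from W(ω) is invisible in the commutator: the two terms ⟨φ, X ψ⟩ cancel.
  have e3 : ∀ ω, a ω * ⟪φ, (W ω * X - X * W ω) ψ⟫_ℂ =
      a ω * (⟪φ, W ω (X ψ)⟫_ℂ - ⟪φ, X ψ⟫_ℂ) - a ω * (⟪φ, X (W ω ψ)⟫_ℂ - ⟪φ, X ψ⟫_ℂ) := fun ω => by
    rw [sub_apply, inner_sub_right, mul_apply_eq_comp, mul_apply_eq_comp]; ring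
  simp_rw [e3]
  rw [superpositionDiff, superpositionDiff, integral_sub i1 i2, inner_sub_left, e1, map_sub,
    inner_sub_right, e2, sub_apply, inner_sub_right, mul_apply_eq_comp, mul_apply_eq_comp, ContinuousLinearMap.star_eq_adjoint,
    ContinuousLinearMap.adjoint_inner_left]
  ring

end Commutators

/-! ### Commutators with Weyl operators. -/

section Weyl

variable {d : ℕ}

/-- The coefficients of the generator of `Mod s` in terms of the quantum gradient. -/
def modCoeff (ħ : ℝ) (s : Space d) : Fin d ⊕ Fin d → ℂ :=
  Sum.elim (fun j => -(2 * Real.pi * ħ * s j)) 0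

/-- The coefficients of the generator of `Trans r` in terms of the quantum gradient. -/
def transCoeff (r : Space d) : Fin d ⊕ Fin d → ℂ := Sum.elim 0 fun j => -(r j)

/-- Since [x_j, ·] is iħ times a gradient component, the generator 2πi s·x has the coefficients 2πi
· iħ s_j = -2πħ s_j. -/
theorem sum_modCoeff_mul_formD {ħ : ℝ} (hħ : ħ ≠ 0) (s : Space d) (X : L2 d →L[ℂ] L2 d)
    (φ ψ : 𝓢(Space d, ℂ)) :
    ∑ a, modCoeff ħ s a * formD ħ a (formOf X) φ ψ =
      -formOf X (modG s φ) ψ - formOf X φ (modG s ψ) := by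
  have hħ' : (ħ : ℂ) ≠ 0 := by exact_mod_cast hħ
  simp only [Fintype.sum_sum_type, modCoeff, Sum.elim_inl, Sum.elim_inr, Pi.zero_apply, zero_mul,
    Finset.sum_const_zero, add_zero, formD, formOf, modG, toLp_sum', toLp_smul', map_sum, map_smul,
    sum_inner, inner_sum, inner_smul_left, inner_smul_right]
  rw [← Finset.sum_neg_distrib, ← Finset.sum_sub_distrib]
  refine Finset.sum_congr rfl fun j _ => ?_
  simp only [map_mul, Complex.conj_I, Complex.conj_ofReal, map_ofNat]
  field_simp
  linear_combination (s j * ⟪φ.toLp 2 volume, X ((mulX j ψ).toLp 2 volume)⟫_ℂ -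
    s j * ⟪(mulX j φ).toLp 2 volume, X (ψ.toLp 2 volume)⟫_ℂ) * Complex.I_sq

theorem sum_transCoeff_mul_formD {ħ : ℝ} (r : Space d) (X : L2 d →L[ℂ] L2 d)
    (φ ψ : 𝓢(Space d, ℂ)) :
    ∑ a, transCoeff r a * formD ħ a (formOf X) φ ψ =
      -formOf X (transG r φ) ψ - formOf X φ (transG r ψ) := by
  simp only [Fintype.sum_sum_type, transCoeff, Sum.elim_inl, Sum.elim_inr, Pi.zero_apply, zero_mul,
    Finset.sum_const_zero, zero_add, formD, formOf, transG, toLp_sum', toLp_smul', map_sum,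
    map_smul,
    sum_inner, inner_sum, inner_smul_left, inner_smul_right]
  rw [← Finset.sum_neg_distrib, ← Finset.sum_sub_distrib]
  refine Finset.sum_congr rfl fun j _ => ?_
  simp only [map_neg, Complex.conj_ofReal]
  ring

theorem inner_sum_smul {κ : Type*} [Fintype κ] (c : κ → ℂ) (T : κ → L2 d →L[ℂ] L2 d)
    (φ ψ : L2 d) : ⟪φ, (∑ a, c a • T a) ψ⟫_ℂ = ∑ a, c a * ⟪φ, T a ψ⟫_ℂ := by
  rw [sum_apply, inner_sum]
  exact Finset.sum_congr rfl fun a _ => by rw [smul_apply, inner_smul_right]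

theorem commutator_generator {ħ : ℝ} {𝒢 : CoreGroup (schwartzL2 d)} {c : Fin d ⊕ Fin d → ℂ}
    (hc : ∀ (X : L2 d →L[ℂ] L2 d) φ ψ, ∑ a, c a * formD ħ a (formOf X) φ ψ =
      -formOf X (𝒢.G φ) ψ - formOf X φ (𝒢.G ψ)) {X : L2 d →L[ℂ] L2 d}
    {T : Fin d ⊕ Fin d → L2 d →L[ℂ] L2 d} (hT : ∀ a, formOf (T a) = formD ħ a (formOf X))
    (φ ψ : 𝓢(Space d, ℂ)) :
    ⟪schwartzL2 d φ, (∑ a, c a • T a) (schwartzL2 d ψ)⟫_ℂ =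
      -⟪schwartzL2 d (𝒢.G φ), X (schwartzL2 d ψ)⟫_ℂ -
        ⟪schwartzL2 d φ, X (schwartzL2 d (𝒢.G ψ))⟫_ℂ := by
  rw [inner_sum_smul]
  refine Eq.trans (Finset.sum_congr rfl fun a _ => ?_) (hc X φ ψ)
  rw [← hT]
  rfl

/-- Each W(ξ) is an eigenvector of the commutator with the generator, with eigenvalue ∑ c_a
symb_a(ξ), and â times this eigenvalue is integrable. -/
theorem group_commutator_eq_integral {ħ : ℝ} {A : L2 d →L[ℂ] L2 d}
    {T : Fin d ⊕ Fin d → L2 d →L[ℂ] L2 d} (hT : ∀ a, formOf (T a) = formD ħ a (formOf A))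
    {â : Space d × Space d → ℂ} (hi : ∀ a, Integrable fun z => â z * symb ħ a z)
    (hTa : ∀ a φ ψ, ⟪φ, T a ψ⟫_ℂ = ∫ z, â z * symb ħ a z * V φ ψ z)
    {𝒢 : CoreGroup (schwartzL2 d)} {c : Fin d ⊕ Fin d → ℂ}
    (hc : ∀ (X : L2 d →L[ℂ] L2 d) φ ψ, ∑ a, c a * formD ħ a (formOf X) φ ψ =
      -formOf X (𝒢.G φ) ψ - formOf X φ (𝒢.G ψ)) (f g : L2 d) :
    Integrable (fun ξ => â ξ * ⟪f, (𝒢.U 1 * W ξ - W ξ * 𝒢.U 1) g⟫_ℂ) ∧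
      ⟪f, (𝒢.U 1 * A - A * 𝒢.U 1) g⟫_ℂ =
        ∫ ξ, â ξ * ⟪f, (𝒢.U 1 * W ξ - W ξ * 𝒢.U 1) g⟫_ℂ := by
  have hsum : ∀ z, â z * ∑ a, c a * symb ħ a z = ∑ a, c a * (â z * symb ħ a z) := fun z => by
    rw [Finset.mul_sum]; exact Finset.sum_congr rfl fun a _ => by ring
  have hbd : ∀ (a : Fin d ⊕ Fin d) (φ ψ : L2 d),
      Integrable fun z => â z * symb ħ a z * V φ ψ z := fun a φ ψ =>
    (hi a).mul_bdd (c := ‖φ‖ * ‖ψ‖) (continuous_V φ ψ).aestronglyMeasurable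
      (.of_forall fun z => norm_V_le φ ψ z)
  refine 𝒢.inner_commutator_eq_integral denseRange_toLp (S := ∑ a, c a • T a)
    (σ := fun z => ∑ a, c a * symb ħ a z) norm_W_apply (commutator_generator hc hT)
    (fun ξ φ ψ => ?_) ?_ (fun f g => ?_) (fun f g => ?_) f g
  · have h := commutator_generator hc (X := W ξ) (T := fun a => symb ħ a ξ • W ξ) (fun a => by
      funext φ ψ
      rw [formD_formOf_W, formOf, smul_apply, inner_smul_right]
      rfl) φ ψ
    rw [← h]
    simp only [smul_smul, ← Finset.sum_smul]
  · simp_rw [hsum]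
    exact integrable_finsetSum _ fun a _ => (hi a).const_mul _
  · rw [inner_sum_smul]
    simp_rw [hTa, hsum, Finset.sum_mul]
    rw [integral_finsetSum _ fun a _ => ((hbd a f g).const_mul (c a)).congr
      (.of_forall fun z => by simp only [V]; ring)]
    refine Finset.sum_congr rfl fun a _ => ?_
    rw [← integral_const_mul]
    refine integral_congr_ae (.of_forall fun z => ?_)
    simp only [V]
    ring
  · refine Continuous.aestronglyMeasurable (Continuous.inner ?_ ?_)
    · exact (𝒢.continuous_U denseRange_toLp f).comp (continuous_neg.comp continuous_fst)
    · exact continuous_apply_of_isometric norm_W_apply continuous_W continuous_snd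
        ((𝒢.continuous_U denseRange_toLp g).comp (continuous_const.sub continuous_fst))

theorem adjoint_Mod_inner (s : Space d) (φ ψ : L2 d) : ⟪φ, Mod s ψ⟫_ℂ = ⟪Mod (-s) φ, ψ⟫_ℂ := by
  rw [← (LinearMap.norm_map_iff_inner_map_map (Mod s)).1 (norm_Mod_apply s) (Mod (-s) φ) ψ,
    ← mul_apply_eq_comp, ← Mod_add, add_neg_cancel, Mod_zero, one_apply_eq_self]

theorem modGroup_U_one (s : Space d) : (modGroup s).U 1 = Mod s := by
  change Mod ((1 : ℝ) • s) = _
  rw [one_smul]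

theorem transGroup_U_one (s : Space d) : (transGroup s).U 1 = Trans s := by
  change Trans ((1 : ℝ) • s) = _
  rw [one_smul]

theorem W_commutator (z : Space d × Space d) (X : L2 d →L[ℂ] L2 d) :
    W z * X - X * W z = Mod z.2 * (Trans z.1 * X - X * Trans z.1) * 1 +
      1 * (Mod z.2 * X - X * Mod z.2) * Trans z.1 := by
  rw [W]; noncomm_ring

/-- The commutators of `A` with the Weyl operators are superpositions of those of the Weyl
operators. -/
theorem inner_W_commutator_eq_integral {ħ : ℝ} (hħ : ħ ≠ 0) {A : L2 d →L[ℂ] L2 d}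
    {T : Fin d ⊕ Fin d → L2 d →L[ℂ] L2 d} (hT : ∀ a, formOf (T a) = formD ħ a (formOf A))
    {â : Space d × Space d → ℂ} (hi : ∀ a, Integrable fun z => â z * symb ħ a z)
    (hTa : ∀ a φ ψ, ⟪φ, T a ψ⟫_ℂ = ∫ z, â z * symb ħ a z * V φ ψ z) (z : Space d × Space d)
    (f g : L2 d) :
    ⟪f, (W z * A - A * W z) g⟫_ℂ = ∫ ξ, â ξ * ⟪f, (W z * W ξ - W ξ * W z) g⟫_ℂ := by
  obtain ⟨i1, e1⟩ := group_commutator_eq_integral hT hi hTa (𝒢 := modGroup z.2)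
    (sum_modCoeff_mul_formD hħ z.2) f (Trans z.1 g)
  obtain ⟨i2, e2⟩ := group_commutator_eq_integral hT hi hTa (𝒢 := transGroup z.1)
    (sum_transCoeff_mul_formD z.1) (Mod (-z.2) f) g
  rw [modGroup_U_one] at i1 e1
  rw [transGroup_U_one] at i2 e2
  have h : ∀ X : L2 d →L[ℂ] L2 d, ⟪f, (W z * X - X * W z) g⟫_ℂ =
      ⟪Mod (-z.2) f, (Trans z.1 * X - X * Trans z.1) g⟫_ℂ +
        ⟪f, (Mod z.2 * X - X * Mod z.2) (Trans z.1 g)⟫_ℂ := fun X => by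
    rw [W_commutator, mul_one, one_mul, add_apply, inner_add_right, mul_apply_eq_comp,
      mul_apply_eq_comp, adjoint_Mod_inner]
  simp_rw [h, mul_add]
  rw [integral_add i2 i1, ← e1, ← e2]

end Weyl

/-! ### Schur's lemma from Moyal's identity. -/

section Scalar

variable {H K D : Type*} [NormedAddCommGroup H] [InnerProductSpace ℂ H] [NormedAddCommGroup K]
  [InnerProductSpace ℂ K]

/-- Operators intertwined by an irreducible representation are scalar. -/
theorem IsMoyal.exists_scalar {Φ : H → H → K} (hΦ : IsMoyal Φ) {J L L' : D → H}
    (h : ∀ φ ψ, Φ (J φ) (L ψ) = Φ (L' φ) (J ψ)) (hJ : ∃ φ, J φ ≠ 0) :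
    ∃ c : ℂ, (∀ ψ, L ψ = c • J ψ) ∧ ∀ φ, L' φ = starRingEnd ℂ c • J φ := by
  obtain ⟨φ₀, h0⟩ := hJ
  have hne : ⟪J φ₀, J φ₀⟫_ℂ ≠ 0 := inner_self_ne_zero.2 h0
  -- Moyal's identity separates the variables φ and ψ, which forces both maps to be proportional to
  -- J. No continuity of L or L' is needed.
  have key : ∀ φ ψ φ' ψ', ⟪φ', J φ⟫_ℂ * ⟪L ψ, ψ'⟫_ℂ = ⟪φ', L' φ⟫_ℂ * ⟪J ψ, ψ'⟫_ℂ := by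
    intro φ ψ φ' ψ'
    rw [← hΦ.inner_eq, h, hΦ.inner_eq]
  set k := ⟪J φ₀, L' φ₀⟫_ℂ / ⟪J φ₀, J φ₀⟫_ℂ
  have h1 : ∀ ψ ψ', ⟪L ψ, ψ'⟫_ℂ = k * ⟪J ψ, ψ'⟫_ℂ := fun ψ ψ' => by
    rw [div_mul_eq_mul_div, eq_div_iff hne, mul_comm]
    exact key φ₀ ψ (J φ₀) ψ'
  refine ⟨starRingEnd ℂ k, fun ψ => ext_inner_right ℂ fun v => ?_,
    fun φ => ext_inner_left ℂ fun v => ?_⟩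
  · rw [h1, inner_smul_left, Complex.conj_conj]
  · have h2 := key φ φ₀ v (J φ₀)
    rw [h1, ← mul_assoc] at h2
    rw [Complex.conj_conj, inner_smul_right, ← mul_right_cancel₀ hne h2, mul_comm]

end Scalar

/-! ### The commutator as a superposition, and its Schatten bound. -/

section Main

variable {d : ℕ}

theorem norm_symb_inl {ħ : ℝ} (hħ : 0 < ħ) (j : Fin d) (z : Space d × Space d) :
    ‖symb ħ (.inl j) z‖ = ħ⁻¹ * |z.1 j| := by
  simp [symb, abs_of_pos hħ]

theorem norm_symb_inr {ħ : ℝ} (j : Fin d) (z : Space d × Space d) :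
    ‖symb ħ (.inr j) z‖ = 2 * Real.pi * |z.2 j| := by
  simp [symb, abs_of_pos Real.pi_pos]

theorem star_W (z : Space d × Space d) : star (W z) = Trans (-z.1) * Mod (-z.2) := by
  refine ContinuousLinearMap.ext fun φ => ext_inner_right ℂ fun ψ => ?_
  rw [ContinuousLinearMap.star_eq_adjoint, ContinuousLinearMap.adjoint_inner_left, W,
    mul_apply_eq_comp, mul_apply_eq_comp, adjoint_Mod_inner,
    ← (LinearMap.norm_map_iff_inner_map_map (Trans z.1)).1 (norm_Trans_apply z.1) _ ψ,
    ← mul_apply_eq_comp, ← Trans_add, add_neg_cancel, Trans_zero, one_apply_eq_self]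

theorem continuous_star_W (φ : L2 d) : Continuous fun z => star (W z) φ := by
  simp_rw [star_W]
  exact continuous_apply_of_isometric norm_Trans_apply continuous_Trans continuous_fst.neg
    ((continuous_Mod φ).comp continuous_snd.neg)

theorem norm_star_W_sub (z : Space d × Space d) (φ : L2 d) :
    ‖star (W z) φ - φ‖ = ‖W z φ - φ‖ := by
  have h : star (W z) * W z = 1 := by
    refine ContinuousLinearMap.ext fun φ => ext_inner_right ℂ fun ψ => ?_
    rw [mul_apply_eq_comp, ContinuousLinearMap.star_eq_adjoint,
      ContinuousLinearMap.adjoint_inner_left, one_apply_eq_self,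
      (LinearMap.norm_map_iff_inner_map_map (W z)).1 (norm_W_apply z)]
  have h2 : star (W z) φ - φ = star (W z) (φ - W z φ) := by
    rw [map_sub, ← mul_apply_eq_comp _ (W z), h, one_apply_eq_self]
  rw [h2, star_W, mul_apply_eq_comp, norm_Trans_apply, norm_Mod_apply, norm_sub_rev]

/-- W(z) - 1 vanishes to first order at the origin on Schwartz functions; this compensates the
possible singularity of â there. -/
theorem norm_W_sub_le {ħ : ℝ} (hħ : 0 < ħ) (φ : 𝓢(Space d, ℂ)) :
    ∃ C : ℝ, ∀ z, ‖W z (φ.toLp 2 volume) - φ.toLp 2 volume‖ ≤ C * ∑ a, ‖symb ħ a z‖ := by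
  refine ⟨∑ j, (ħ * ‖((dX j φ).toLp 2 volume : L2 d)‖ + ‖((mulX j φ).toLp 2 volume : L2 d)‖),
    fun z => ?_⟩
  have h1 : W z (φ.toLp 2 volume) - φ.toLp 2 volume =
      Mod z.2 (Trans z.1 (φ.toLp 2 volume) - φ.toLp 2 volume) +
        (Mod z.2 (φ.toLp 2 volume) - φ.toLp 2 volume) := by
    rw [W, mul_apply_eq_comp, map_sub]; abel
  rw [h1]
  refine (norm_add_le _ _).trans ?_
  rw [norm_Mod_apply]
  refine (add_le_add (norm_Trans_sub_le _ _) (norm_Mod_sub_le _ _)).trans ?_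
  rw [← Finset.sum_add_distrib, Finset.sum_mul]
  refine Finset.sum_le_sum fun j _ => ?_
  have hs : ∀ a, ‖symb ħ a z‖ ≤ ∑ a, ‖symb ħ a z‖ := fun a =>
    Finset.single_le_sum (f := fun a => ‖symb ħ a z‖) (fun _ _ => norm_nonneg _)
      (Finset.mem_univ a)
  have h2 := hs (.inl j)
  have h3 := hs (.inr j)
  rw [norm_symb_inl hħ] at h2
  rw [norm_symb_inr] at h3
  have h4 : |z.1 j| ≤ ħ * ∑ a, ‖symb ħ a z‖ := by
    rwa [inv_mul_le_iff₀ hħ] at h2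
  nlinarith [mul_le_mul_of_nonneg_right h4 (norm_nonneg ((dX j φ).toLp 2 volume : L2 d)),
    mul_le_mul_of_nonneg_right h3 (norm_nonneg ((mulX j φ).toLp 2 volume : L2 d))]

theorem schattenLE_sum_smul {H κ : Type*} [NormedAddCommGroup H] [InnerProductSpace ℂ H]
    [CompleteSpace H] [Fintype κ] {p : ℝ≥0∞} (hp : 1 ≤ p) (c : κ → ℂ) {T : κ → H →L[ℂ] H} {M : ℝ}
    (hM : 0 ≤ M) (h : ∀ a, SchattenLE p (T a) M) :
    SchattenLE p (∑ a, c a • T a) (∑ a, ‖c a‖ * M) :=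
  SchattenLE.sum hp (fun _ => by positivity) fun a => (h a).smul hM (c a)

theorem schattenLE_group_commutator {ħ : ℝ} {p : ℝ≥0∞} (hp : 1 ≤ p) {B : L2 d →L[ℂ] L2 d}
    {T : Fin d ⊕ Fin d → L2 d →L[ℂ] L2 d} (hT : ∀ a, formOf (T a) = formD ħ a (formOf B)) {M : ℝ}
    (hM : 0 ≤ M) (h : ∀ a, SchattenLE p (T a) M) {𝒢 : CoreGroup (schwartzL2 d)}
    {c : Fin d ⊕ Fin d → ℂ}
    (hc : ∀ (X : L2 d →L[ℂ] L2 d) φ ψ, ∑ a, c a * formD ħ a (formOf X) φ ψ =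
      -formOf X (𝒢.G φ) ψ - formOf X φ (𝒢.G ψ)) :
    SchattenLE p (𝒢.U 1 * B - B * 𝒢.U 1) (∑ a, ‖c a‖ * M) := by
  have h1 := commutator_generator hc hT
  have h2 := schattenLE_sum_smul hp c hM h
  have h3 : 0 ≤ ∑ a, ‖c a‖ * M := by positivity
  exact 𝒢.schattenLE denseRange_toLp hp h1 h3 h2

/-- The Leibniz rule splits W(z) into its two groups, and Duhamel's formula bounds each commutator.
The absolute values of the generator coefficients add up to ħ ∑ |symb_a(z)|. -/
theorem schattenLE_W_commutator {ħ : ℝ} (hħ : 0 < ħ) {p : ℝ≥0∞} (hp : 1 ≤ p)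
    {B : L2 d →L[ℂ] L2 d} {T : Fin d ⊕ Fin d → L2 d →L[ℂ] L2 d}
    (hT : ∀ a, formOf (T a) = formD ħ a (formOf B)) {M : ℝ} (hM : 0 ≤ M)
    (h : ∀ a, SchattenLE p (T a) M) (z : Space d × Space d) :
    SchattenLE p (W z * B - B * W z) (ħ * M * ∑ a, ‖symb ħ a z‖) := by
  have h1 := schattenLE_group_commutator hp hT hM h (𝒢 := modGroup z.2)
    (sum_modCoeff_mul_formD hħ.ne' z.2)
  have h2 := schattenLE_group_commutator hp hT hM h (𝒢 := transGroup z.1)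
    (sum_transCoeff_mul_formD z.1)
  rw [modGroup_U_one] at h1
  rw [transGroup_U_one] at h2
  have hMod : ‖Mod z.2‖ ≤ 1 :=
    ContinuousLinearMap.opNorm_le_bound _ zero_le_one fun ψ => by rw [norm_Mod_apply, one_mul]
  have hTrans : ‖Trans z.1‖ ≤ 1 :=
    ContinuousLinearMap.opNorm_le_bound _ zero_le_one fun ψ => by rw [norm_Trans_apply, one_mul]
  have hone : ‖(1 : L2 d →L[ℂ] L2 d)‖ ≤ 1 := ContinuousLinearMap.norm_id_le
  rw [W_commutator]
  have h3 := (h2.mul_mul hMod hone).add hp (by positivity) (by positivity) (h1.mul_mul hone hTrans)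
  have h4 : ∑ a, ‖transCoeff z.1 a‖ * M + ∑ a, ‖modCoeff ħ z.2 a‖ * M =
      ħ * M * ∑ a, ‖symb ħ a z‖ := by
    simp only [Fintype.sum_sum_type, transCoeff, modCoeff, Sum.elim_inl, Sum.elim_inr,
      Pi.zero_apply, norm_zero, zero_mul, Finset.sum_const_zero, zero_add, add_zero,
      norm_symb_inl hħ, norm_symb_inr, norm_neg, norm_mul, Complex.norm_real, Real.norm_eq_abs,
      abs_of_pos hħ, abs_of_pos Real.pi_pos, Complex.norm_ofNat, mul_add, Finset.mul_sum]
    congr 1 <;> refine Finset.sum_congr rfl fun j _ => ?_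
    · field_simp
    · ring
  rwa [h4] at h3

/-- The symbol calculus hypotheses: `â` is the symbol of `A` outside of the origin, in the sense
that its products with the coordinates are the integrable symbols of the gradient of `A`. -/
structure IsSymbol (ħ : ℝ) (A : L2 d →L[ℂ] L2 d) (â : Space d × Space d → ℂ) : Prop where
  aestronglyMeasurable : AEStronglyMeasurable â
  integrable : ∀ a, Integrable fun z => â z * symb ħ a z
  exists_eq : ∀ a, ∃ T : L2 d →L[ℂ] L2 d, formOf T = formD ħ a (formOf A) ∧
    ∀ φ ψ, ⟪φ, T ψ⟫_ℂ = ∫ z, â z * symb ħ a z * V φ ψ z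

namespace IsSymbol

variable {ħ : ℝ} {A : L2 d →L[ℂ] L2 d} {â : Space d × Space d → ℂ} (hA : IsSymbol ħ A â)
include hA

theorem integrable_norm : Integrable fun z => ‖â z‖ * ∑ a, ‖symb ħ a z‖ := by
  simp_rw [Finset.mul_sum, ← norm_mul]
  exact integrable_finsetSum _ fun a _ => (hA.integrable a).norm

theorem integrable_smul_W_sub (hħ : 0 < ħ) (φ : 𝓢(Space d, ℂ)) :
    Integrable fun z => â z • (W z (φ.toLp 2 volume) - φ.toLp 2 volume) := by
  obtain ⟨C, hC⟩ := norm_W_sub_le hħ φ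
  refine (hA.integrable_norm.const_mul C).mono' (hA.aestronglyMeasurable.smul
    (continuous_sub_const (continuous_W _) _).aestronglyMeasurable) (.of_forall fun z => ?_)
  rw [norm_smul]
  nlinarith [mul_le_mul_of_nonneg_left (hC z) (norm_nonneg (â z))]

theorem integrable_smul_star_W_sub (hħ : 0 < ħ) (φ : 𝓢(Space d, ℂ)) :
    Integrable fun z => starRingEnd ℂ (â z) • (star (W z) (φ.toLp 2 volume) - φ.toLp 2 volume) := by
  obtain ⟨C, hC⟩ := norm_W_sub_le hħ φ
  refine (hA.integrable_norm.const_mul C).mono' (hA.aestronglyMeasurable.star.smul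
    (continuous_sub_const (continuous_star_W _) _).aestronglyMeasurable) (.of_forall fun z => ?_)
  rw [norm_smul, norm_star_W_sub, RCLike.norm_conj]
  nlinarith [mul_le_mul_of_nonneg_left (hC z) (norm_nonneg (â z))]

theorem inner_W_commutator (hħ : 0 < ħ) (z : Space d × Space d) (f g : L2 d) :
    ⟪f, (A * W z - W z * A) g⟫_ℂ = ∫ ξ, â ξ * ⟪f, (W ξ * W z - W z * W ξ) g⟫_ℂ := by
  choose T hT hTa using hA.exists_eq
  have h := inner_W_commutator_eq_integral hħ.ne' hT hA.integrable hTa z f g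
  have h2 : ∀ X : L2 d →L[ℂ] L2 d, ⟪f, (X * W z - W z * X) g⟫_ℂ = -⟪f, (W z * X - X * W z) g⟫_ℂ :=
    fun X => by rw [← inner_neg_right, ← neg_apply, neg_sub]
  simp_rw [h2, mul_neg]
  rw [integral_neg, h]

/-- On Schwartz functions, `A` is a superposition of Weyl operators, up to a scalar. -/
theorem exists_scalar (hħ : 0 < ħ) : ∃ c : ℂ,
    (∀ ψ : 𝓢(Space d, ℂ),
      superpositionDiff volume A â W (ψ.toLp 2 volume) = c • ψ.toLp 2 volume) ∧
    ∀ φ : 𝓢(Space d, ℂ), superpositionDiff volume (star A) (fun z => starRingEnd ℂ (â z))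
      (fun z => star (W z)) (φ.toLp 2 volume) = starRingEnd ℂ c • φ.toLp 2 volume := by
  refine isMoyal_VL.exists_scalar (J := fun φ : 𝓢(Space d, ℂ) => φ.toLp 2 volume)
    (fun φ ψ => ?_) exists_schwartz_ne_zero
  -- A and its renormalized superposition have the same commutators with every W(z), which is the
  -- intertwining relation required by Schur's lemma.
  have h : V (φ.toLp 2 volume) (superpositionDiff volume A â W (ψ.toLp 2 volume)) =
      V (superpositionDiff volume (star A) (fun z => starRingEnd ℂ (â z))
        (fun z => star (W z)) (φ.toLp 2 volume)) (ψ.toLp 2 volume) := by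
    funext z
    have h1 := inner_sub_integral_eq (A := A) (X := W z) (hA.integrable_smul_W_sub hħ ψ)
      (hA.integrable_smul_star_W_sub hħ φ)
    rw [← hA.inner_W_commutator hħ, sub_self] at h1
    exact (sub_eq_zero.1 h1).symm
  rw [VL, VL]
  congr 1

/-- The scalar by which A differs from its superposition contributes c ⟨φ, B ψ⟩ on both sides of the
commutator. -/
theorem inner_commutator_schwartz (hħ : 0 < ħ) (B : L2 d →L[ℂ] L2 d) (φ ψ : 𝓢(Space d, ℂ)) :
    ⟪φ.toLp 2 volume, (A * B - B * A) (ψ.toLp 2 volume)⟫_ℂ =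
      ∫ z, â z * ⟪φ.toLp 2 volume, (W z * B - B * W z) (ψ.toLp 2 volume)⟫_ℂ := by
  obtain ⟨c, h1, h2⟩ := hA.exists_scalar hħ
  have h3 := inner_sub_integral_eq (A := A) (X := B) (hA.integrable_smul_W_sub hħ ψ)
    (hA.integrable_smul_star_W_sub hħ φ)
  rw [h1, h2, inner_smul_left, map_smul, inner_smul_right, Complex.conj_conj, sub_self] at h3
  exact sub_eq_zero.1 h3.symm

/-- The Schatten norm of a commutator is controlled by the `L¹` norms of the symbols of the
gradient of the first operator. -/
theorem schattenLE_commutator (hħ : 0 < ħ) {p : ℝ≥0∞} (hp : 1 ≤ p) {B : L2 d →L[ℂ] L2 d}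
    {T : Fin d ⊕ Fin d → L2 d →L[ℂ] L2 d} (hT : ∀ a, formOf (T a) = formD ħ a (formOf B)) {M : ℝ}
    (hM : 0 ≤ M) (h : ∀ a, SchattenLE p (T a) M) :
    SchattenLE p (A * B - B * A) (ħ * M * ∑ a, ∫ z, ‖â z * symb ħ a z‖) := by
  -- The case p = ∞ gives an integrable operator-norm bound, whatever p is, so the weak integral
  -- defines a bounded operator R.
  have hnorm : ∀ z, ‖â z • (W z * B - B * W z)‖ ≤
      ħ * (∑ a, ‖T a‖) * (‖â z‖ * ∑ a, ‖symb ħ a z‖) := fun z => by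
    have h1 := schattenLE_W_commutator (p := ∞) hħ le_top hT (M := ∑ a, ‖T a‖) (by positivity)
      (fun a => by
        rw [SchattenLE, if_pos rfl]
        exact Finset.single_le_sum (f := fun a => ‖T a‖) (fun _ _ => norm_nonneg _)
          (Finset.mem_univ a)) z
    rw [SchattenLE, if_pos rfl] at h1
    rw [norm_smul]
    nlinarith [mul_le_mul_of_nonneg_left h1 (norm_nonneg (â z))]
  have hmeas : ∀ v : L2 d, AEStronglyMeasurable fun z => (â z • (W z * B - B * W z)) v :=
    fun v => hA.aestronglyMeasurable.smul
      ((continuous_W (B v)).sub (B.continuous.comp (continuous_W v))).aestronglyMeasurable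
  obtain ⟨R, hRi, hR⟩ := exists_integral_operator hmeas (hA.integrable_norm.const_mul _)
    (.of_forall hnorm)
  have hAB : A * B - B * A = R := by
    refine formOf_injective (funext fun φ => funext fun ψ => ?_)
    rw [formOf, formOf, hR, hA.inner_commutator_schwartz hħ]
    simp only [smul_apply, inner_smul_right]
  have h1 := SchattenLE.of_integral hp hRi hR
    (b := fun z => ħ * M * (‖â z‖ * ∑ a, ‖symb ħ a z‖)) (hA.integrable_norm.const_mul _)
    (fun z => by positivity) (fun z => by
      have h2 := (schattenLE_W_commutator hħ hp hT hM h z).smul (by positivity) (â z)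
      rwa [mul_left_comm] at h2)
  rw [hAB]
  convert! h1 using 1
  rw [integral_const_mul]
  congr 1
  simp_rw [Finset.mul_sum, ← norm_mul]
  rw [integral_finsetSum _ fun a _ => (hA.integrable a).norm]

end IsSymbol

end Main

/-! ### Construction of â, powers of h, and the final estimate. -/

section Conclusion

variable {d : ℕ}

/-- The eigenvalues vanish simultaneously only at the origin, a null set because d ≥ 1. -/
theorem ae_exists_symb_ne_zero (hd : 1 ≤ d) {ħ : ℝ} (hħ : 0 < ħ) :
    ∀ᵐ z : Space d × Space d, ∃ a, symb ħ a z ≠ 0 := by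
  have : Nonempty (Fin d) := ⟨⟨0, hd⟩⟩
  have h0 : ∀ᵐ z : Space d × Space d, z ≠ 0 := by
    have : NullSingletonClass (volume : Measure (Space d)) :=
      Measure.IsAddHaarMeasure.nullSingletonClass volume
    rw [Measure.volume_eq_prod]
    exact compl_mem_ae_iff.2 (measure_singleton 0)
  filter_upwards [h0] with z hz
  by_contra! h
  refine hz (Prod.ext (PiLp.ext fun j => ?_) (PiLp.ext fun j => ?_))
  · have h1 := norm_eq_zero.2 (h (.inl j))
    rw [norm_symb_inl hħ] at h1
    simpa [hħ.ne'] using h1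
  · have h1 := norm_eq_zero.2 (h (.inr j))
    rw [norm_symb_inr] at h1
    simpa [Real.pi_ne_zero] using h1

/-- A compatible family of functions consists of the products of a function with the
coordinates. -/
theorem exists_mul_symb_eq (hd : 1 ≤ d) {ħ : ℝ} (hħ : 0 < ħ)
    {f : Fin d ⊕ Fin d → Space d × Space d → ℂ} (hf : ∀ a, AEStronglyMeasurable (f a))
    (h : ∀ a b, ∀ᵐ z, symb ħ b z * f a z = symb ħ a z * f b z) :
    ∃ â : Space d × Space d → ℂ, AEStronglyMeasurable â ∧
      ∀ a, (fun z => â z * symb ħ a z) =ᵐ[volume] f a := by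
  have hs : ∀ a, Measurable (symb (d := d) ħ a) := measurable_symb ħ
  -- Least-squares solution of the system â symb_a = f_a, exact by compatibility wherever some
  -- `symb` is nonzero.
  refine ⟨fun z => (∑ a, starRingEnd ℂ (symb ħ a z) * f a z) / ((∑ a, ‖symb ħ a z‖ ^ 2 : ℝ) : ℂ),
    ?_, fun b => ?_⟩
  · have h1 : Measurable fun z : Space d × Space d => ((∑ a, ‖symb ħ a z‖ ^ 2 : ℝ) : ℂ) := by
      fun_prop
    have h2 : AEMeasurable fun z => ∑ a, starRingEnd ℂ (symb ħ a z) * f a z := by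
      refine Finset.aemeasurable_fun_sum _ fun a _ => ?_
      exact (Complex.continuous_conj.measurable.comp (hs a)).aemeasurable.mul (hf a).aemeasurable
    exact (h2.div h1.aemeasurable).aestronglyMeasurable
  · have h1 : ∀ᵐ z, ∀ a, symb ħ b z * f a z = symb ħ a z * f b z :=
      ae_all_iff.2 fun a => h a b
    filter_upwards [h1, ae_exists_symb_ne_zero hd hħ] with z hz ⟨a, ha⟩
    have hpos : 0 < ∑ a, ‖symb ħ a z‖ ^ 2 :=
      Finset.sum_pos' (fun _ _ => by positivity) ⟨a, Finset.mem_univ _, by positivity⟩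
    have hne : ((∑ a, ‖symb ħ a z‖ ^ 2 : ℝ) : ℂ) ≠ 0 := by exact_mod_cast hpos.ne'
    rw [div_mul_eq_mul_div, div_eq_iff hne, Finset.sum_mul]
    push_cast
    rw [Finset.mul_sum]
    refine Finset.sum_congr rfl fun a _ => ?_
    rw [← Complex.conj_mul', mul_assoc, mul_comm (f a z), hz]
    ring

/-- With h = 2πħ one has ħ/(2π) = h/(2π)², so the square root releases h^{d/2}, the scaling of one
Hilbert–Schmidt norm. -/
theorem ofReal_interpConst_eq {n : ℕ} {ħ : ℝ} (hħ : 0 < ħ) :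
    ENNReal.ofReal ((1 + d) * √((ħ / (2 * Real.pi)) ^ d * interpConst d n)) =
      ENNReal.ofReal ((1 + d) * √(interpConst d n) / (2 * Real.pi) ^ d) *
        ENNReal.ofReal ((2 * Real.pi * ħ) ^ ((d : ℝ) / 2)) := by
  have hπ := Real.pi_pos
  rw [← ENNReal.ofReal_mul (by positivity)]
  congr 1
  have h1 : (ħ / (2 * Real.pi)) ^ d = (2 * Real.pi * ħ) ^ d / ((2 * Real.pi) ^ d) ^ 2 := by
    simp only [div_pow, mul_pow]
    field_simp
  have h2 : (2 * Real.pi * ħ) ^ ((d : ℝ) / 2) = √((2 * Real.pi * ħ) ^ d) := by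
    rw [Real.sqrt_eq_rpow, ← Real.rpow_natCast, ← Real.rpow_mul (by positivity)]
    congr 1
    ring
  rw [h1, h2, Real.sqrt_mul (by positivity), Real.sqrt_div (by positivity),
    Real.sqrt_sq (by positivity)]
  ring

/-- The exponents add up to 1, so the two gradient norms of A absorb exactly one factor h^{d/2}. -/
theorem mul_rpow_mul_mul_rpow {k S T : ℝ≥0∞} (hk : k ≠ 0) (hk' : k ≠ ∞) {θ : ℝ} (h0 : 0 ≤ θ)
    (h1 : 0 ≤ 1 - θ) : (k * S) ^ θ * (k * T) ^ (1 - θ) = k * (S ^ θ * T ^ (1 - θ)) := by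
  rw [ENNReal.mul_rpow_of_nonneg _ _ h0, ENNReal.mul_rpow_of_nonneg _ _ h1, mul_mul_mul_comm,
    ← ENNReal.rpow_add _ _ hk hk', add_sub_cancel, ENNReal.rpow_one]

theorem scaledNorm_two {ι : Type*} [Fintype ι] (ħ : ℝ) (T : ι → L2 d →L[ℂ] L2 d) :
    scaledNorm ħ 2 T =
      ENNReal.ofReal ((2 * Real.pi * ħ) ^ ((d : ℝ) / 2)) * schattenNorm 2 T := by
  simp [scaledNorm]

/-- The commutator estimate for unscaled Schatten norms. -/
theorem schattenNorm_commutator_le (hd : 1 ≤ d) {n : ℕ} (hn : d < n) {ħ : ℝ} (hħ : 0 < ħ)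
    {p : ℝ≥0∞} (hp : 1 ≤ p) {A B : L2 d →L[ℂ] L2 d}
    {T₁ : (Fin 1 → Fin d ⊕ Fin d) → L2 d →L[ℂ] L2 d}
    (hT₁ : ∀ α, formOf (T₁ α) = iterD ħ 1 α (formOf A)) (h₁ : schattenNorm 2 T₁ ≠ ∞)
    {T₂ : (Fin (n + 1) → Fin d ⊕ Fin d) → L2 d →L[ℂ] L2 d}
    (hT₂ : ∀ α, formOf (T₂ α) = iterD ħ (n + 1) α (formOf A)) (h₂ : schattenNorm 2 T₂ ≠ ∞)
    {T : (Fin 1 → Fin d ⊕ Fin d) → L2 d →L[ℂ] L2 d}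
    (hT : ∀ α, formOf (T α) = iterD ħ 1 α (formOf B)) (h : schattenNorm p T ≠ ∞) :
    schattenNorm p (fun _ : Unit => A * B - B * A) ≤
      ENNReal.ofReal ħ * schattenNorm p T * (2 * d *
        (ENNReal.ofReal ((1 + d) * √((ħ / (2 * Real.pi)) ^ d * interpConst d n)) *
          (schattenNorm 2 T₂ ^ ((d : ℝ) / n) * schattenNorm 2 T₁ ^ (1 - (d : ℝ) / n)))) := by
  obtain ⟨f, hf, hf₁, hf₂, hcomp, hfT⟩ := exists_gradient_symbol hT₁ h₁ hT₂ h₂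
  set R := ENNReal.ofReal ((1 + d) * √((ħ / (2 * Real.pi)) ^ d * interpConst d n)) *
          (schattenNorm 2 T₂ ^ ((d : ℝ) / n) * schattenNorm 2 T₁ ^ (1 - (d : ℝ) / n)) with hR
  have hL1 : ∀ a, ∫⁻ z, ‖f a z‖ₑ ≤ R := fun a =>
    lintegral_enorm_le hd hn hħ (hf a).1 h₁ h₂ (hf₁ a) (hf₂ a)
  have hθ : (d : ℝ) / n ≤ 1 := by
    refine div_le_one_of_le₀ ?_ (by positivity)
    exact_mod_cast hn.le
  have hθ0 : (0 : ℝ) ≤ (d : ℝ) / n := by positivity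
  have hRfin : R ≠ ∞ := by
    have := ENNReal.rpow_ne_top_of_nonneg hθ0 h₂
    have := ENNReal.rpow_ne_top_of_nonneg (sub_nonneg.2 hθ) h₁
    rw [hR]
    finiteness
  have hfi : ∀ a, Integrable (f a) := fun a => ⟨(hf a).1, (hL1 a).trans_lt hRfin.lt_top⟩
  obtain ⟨â, hâ, hâf⟩ := exists_mul_symb_eq hd hħ (fun a => (hf a).1) hcomp
  have hA : IsSymbol ħ A â :=
    { aestronglyMeasurable := hâ
      integrable := fun a => (hfi a).congr (hâf a).symm
      exists_eq := fun a => ⟨T₁ fun _ => a, hT₁ _, fun φ ψ => by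
        rw [hfT]
        refine integral_congr_ae ?_
        filter_upwards [hâf a] with z hz
        rw [hz]⟩ }
  have hle := schattenNorm_le_of_schattenLE hp (by positivity)
    (hA.schattenLE_commutator hħ hp (T := fun a => T fun _ => a) (fun a => hT _)
      ENNReal.toReal_nonneg fun a => schattenLE_of_schattenNorm hp h _)
  refine hle.trans ?_
  rw [ENNReal.ofReal_mul (by positivity), ENNReal.ofReal_mul hħ.le, ENNReal.ofReal_toReal h]
  gcongr
  rw [ENNReal.ofReal_sum_of_nonneg fun a _ => by positivity]
  -- All 2d symbols share the bound R, whence the factor 2d.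
  refine (Finset.sum_le_card_nsmul _ _ R fun a _ => ?_).trans_eq ?_
  · rw [ofReal_integral_norm_eq_lintegral_enorm (hA.integrable a)]
    refine le_of_eq_of_le (lintegral_congr_ae ?_) (hL1 a)
    filter_upwards [hâf a] with z hz
    rw [hz]
  · rw [Finset.card_univ, Fintype.card_sum, Fintype.card_fin, nsmul_eq_mul]
    push_cast
    ring

end Conclusion

end QuantumGradient

end

theorem mainTheorem2 (d n : ℕ) (hd : 1 ≤ d) (hn : d < n) :
    ∃ C : ℝ≥0, ∀ (ħ : ℝ) (p : ℝ≥0∞) (A B : QuantumGradient.L2 d →L[ℂ] QuantumGradient.L2 d),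
      0 < ħ → 1 ≤ p →
      QuantumGradient.gradNorm ħ 2 (n + 1) A ≠ ∞ →
      QuantumGradient.gradNorm ħ 2 1 A ≠ ∞ →
      QuantumGradient.gradNorm ħ p 1 B ≠ ∞ →
      QuantumGradient.opNorm ħ p (A * B - B * A) ≤
        (C : ℝ≥0∞) * ENNReal.ofReal ħ *
          QuantumGradient.gradNorm ħ 2 (n + 1) A ^ ((d : ℝ) / n) *
          QuantumGradient.gradNorm ħ 2 1 A ^ (1 - (d : ℝ) / n) *
          QuantumGradient.gradNorm ħ p 1 B := by
  -- The factor 2d counts the gradient components of A; the rest is the interpolation constant once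
  -- h^{d/2} has been extracted.
  refine ⟨2 * d * Real.toNNReal
    ((1 + d) * √(QuantumGradient.interpConst d n) / (2 * Real.pi) ^ d), ?_⟩
  intro ħ p A B hħ hp h₂ h₁ hB
  obtain ⟨T₂, hT₂, e₂⟩ := QuantumGradient.gradNorm_eq_scaledNorm h₂
  obtain ⟨T₁, hT₁, e₁⟩ := QuantumGradient.gradNorm_eq_scaledNorm h₁
  obtain ⟨T, hT, e⟩ := QuantumGradient.gradNorm_eq_scaledNorm hB
  have h := QuantumGradient.schattenNorm_commutator_le hd hn hħ hp hT₁
    (QuantumGradient.schattenNorm_ne_top_of_scaledNorm hħ (e₁ ▸ h₁)) hT₂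
    (QuantumGradient.schattenNorm_ne_top_of_scaledNorm hħ (e₂ ▸ h₂)) hT
    (QuantumGradient.schattenNorm_ne_top_of_scaledNorm hħ (e ▸ hB))
  have hθ : (d : ℝ) / n ≤ 1 := by
    refine div_le_one_of_le₀ ?_ (by positivity)
    exact_mod_cast hn.le
  have hk : 0 < (2 * Real.pi * ħ) ^ ((d : ℝ) / 2) := by
    have := Real.pi_pos
    positivity
  have hmul := QuantumGradient.mul_rpow_mul_mul_rpow
    (S := QuantumGradient.schattenNorm 2 T₂) (T := QuantumGradient.schattenNorm 2 T₁)
    (ENNReal.ofReal_pos.2 hk).ne' ENNReal.ofReal_ne_top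
    (show 0 ≤ (d : ℝ) / n by positivity) (sub_nonneg.2 hθ)
  rw [e₂, e₁, e, mul_assoc (_ * ENNReal.ofReal ħ), QuantumGradient.scaledNorm_two,
    QuantumGradient.scaledNorm_two, hmul, QuantumGradient.opNorm]
  unfold QuantumGradient.scaledNorm
  -- The factor h^{d/p} is common to the commutator and to the gradient of B, so it multiplies the
  -- unscaled estimate.
  refine (mul_le_mul_right h _).trans_eq ?_
  rw [QuantumGradient.ofReal_interpConst_eq hħ]
  push_cast
  rw [← ENNReal.ofReal]
  ring
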